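/- A permutation $\pi$ of $\{1,\dots,n\}$, $n\ge 1$, is \emph{Baxter} if there are no $i<j<k$ with $\pi(j+1)<\pi(i)<\pi(k)<\pi(j)$ or $\pi(j)<\pi(k)<\pi(i)<\pi(j+1)$. A value $\pi(i)$ is a left-to-right (lr-) maximum if $\pi(j)<\pi(i)$ for all $j<i$, and a right-to-left (rl-) maximum if $\pi(j)<\pi(i)$ for all $j>i$; lr-minima and rl-minima are defined similarly, and $\mathrm{rev}(\pi)=\pi(n)\cdots\pi(1)$. A \emph{plane bipolar orientation} is an acyclic orientation of a planar map (a connected graph with at least one edge, multiple edges allowed, embedded in the plane up to continuous deformation) with a unique source $s$ and a unique sink $t$, both on the outer face. Its left (right) border is the directed path from $s$ to $t$ that has the outer face on its left (right), and the left (right) outer degree is the length of this path. The mirror image of $O$ is denoted $\mathrm{mir}(O)$. The dual $O^*$ has one vertex in each bounded face of $O$ and two vertices (its poles) in the outer face, a source on the right of $O$ and a sink on the left of $O$; the dual of an edge $e$ goes from the face on the right of $e$ to the face on the left of $e$. For a Baxter permutation $\sigma$ of size $n$, let $L_k(\sigma)$ (resp. $R_k(\sigma)$) be obtained by inserting the value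 $n+1$ just before the $k$-th lr-maximum from the left (resp. just after the $k$-th rl-maximum from the right). Every Baxter permutation of size at least $2$ is obtained from a unique Baxter permutation by a unique such insertion, and all these insertions give Baxter permutations. For a plane bipolar orientation $P$ with left border $s=v_1,\dots,v_i,v_{i+1}=t$ and edges $e_1,\dots,e_j$ at $t$ from right to left, let $L_k(P)$ ($1\le k\le i$) be obtained by adding an edge from $v_k$ to $t$ having the outer face on its left, and let $R_k(P)$ ($1\le k\le j$) be obtained by splitting $t$ into $t$, which keeps $e_1,\dots,e_{k-1}$, and a new vertex $v$, which receives $e_k,\dots,e_j$, and adding an edge from $v$ to $t$. Let $\Lambda$ be the map that sends the permutation $1$ to the one-edge orientation and satisfies $\Lambda(L_k(\sigma))=L_k(\Lambda(\sigma))$ and $\Lambda(R_k(\sigma))=R_k(\Lambda(\sigma))$. \textbf{Theorem.} For every $n\ge 1$, $\Lambda$ is a bijection from the Baxter permutations of size $n$ to the plane bipolar orientations with $n$ edges. If $\pi$ is a Baxter permutation and $O=\Lambda(\pi)$, then the number of ascents of $\pi$ is the number of non-polar vertices of $O$; the number of lr-maxima is the left outer degree; the number of rl-minima is the right outer degree;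 the number of rl-maxima is the degree of the sink; the number of lr-minima is the degree of the source. Moreover $\Lambda(\mathrm{rev}(\pi))=\mathrm{mir}(O^*)$. -/

import Mathlib

/-! ### Permutations

A permutation of size `n` is an element of `Equiv.Perm (Fin n)`; positions and values are
numbered from `0` to `n - 1`. -/

namespace BaxterPerm

/-- `π` is Baxter: there are no positions `i < j < k` with
`π (j+1) < π i < π k < π j` or `π j < π k < π i < π (j+1)`. -/
def IsBaxter {n : ℕ} (π : Equiv.Perm (Fin n)) : Prop :=
  ¬ ∃ i j j' k : Fin n, i < j ∧ j < k ∧ (j' : ℕ) = j + 1 ∧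
    ((π j' < π i ∧ π i < π k ∧ π k < π j) ∨ (π j < π k ∧ π k < π i ∧ π i < π j'))

/-- `π` has a left-to-right maximum at position `p`. -/
abbrev IsLRMax {n : ℕ} (π : Equiv.Perm (Fin n)) (p : Fin n) : Prop := ∀ j, j < p → π j < π p

/-- `π` has a right-to-left maximum at position `p`. -/
abbrev IsRLMax {n : ℕ} (π : Equiv.Perm (Fin n)) (p : Fin n) : Prop := ∀ j, p < j → π j < π p

/-- `π` has a left-to-right minimum at position `p`. -/
abbrev IsLRMin {n : ℕ} (π : Equiv.Perm (Fin n)) (p : Fin n) : Prop := ∀ j, j < p → π p < π j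

/-- `π` has a right-to-left minimum at position `p`. -/
abbrev IsRLMin {n : ℕ} (π : Equiv.Perm (Fin n)) (p : Fin n) : Prop := ∀ j, p < j → π p < π j

/-- The number of left-to-right maxima. -/
def lrMaxima {n : ℕ} (π : Equiv.Perm (Fin n)) : ℕ := (Finset.univ.filter (IsLRMax π)).card

/-- The number of right-to-left maxima. -/
def rlMaxima {n : ℕ} (π : Equiv.Perm (Fin n)) : ℕ := (Finset.univ.filter (IsRLMax π)).card

/-- The number of left-to-right minima. -/
def lrMinima {n : ℕ} (π : Equiv.Perm (Fin n)) : ℕ := (Finset.univ.filter (IsLRMin π)).card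

/-- The number of right-to-left minima. -/
def rlMinima {n : ℕ} (π : Equiv.Perm (Fin n)) : ℕ := (Finset.univ.filter (IsRLMin π)).card

/-- The number of ascents. -/
def ascents {n : ℕ} (π : Equiv.Perm (Fin (n + 1))) : ℕ :=
  (Finset.univ.filter fun a : Fin n => π a.castSucc < π a.succ).card

/-- The reversed permutation, `rev π i = π (n - 1 - i)`. -/
def rev {n : ℕ} (π : Equiv.Perm (Fin n)) : Equiv.Perm (Fin n) := Fin.revPerm.trans π

/-- Insertion of a new maximal value into `σ`, so that it gets position `p`. -/
def insertMax {n : ℕ} (σ : Equiv.Perm (Fin n)) (p : Fin (n + 1)) : Equiv.Perm (Fin (n + 1)) :=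
  ((finSuccEquiv' p).trans σ.optionCongr).trans (finSuccEquiv' (Fin.last n)).symm

theorem insertMax_self {n : ℕ} (σ : Equiv.Perm (Fin n)) (p : Fin (n + 1)) :
    insertMax σ p p = Fin.last n := by
  simp [insertMax]

theorem insertMax_succAbove {n : ℕ} (σ : Equiv.Perm (Fin n)) (p : Fin (n + 1)) (i : Fin n) :
    insertMax σ p (p.succAbove i) = (σ i).castSucc := by
  simp [insertMax]

/-- Position of the maximal value of `π`. -/
def maxPos {n : ℕ} (π : Equiv.Perm (Fin (n + 1))) : Fin (n + 1) := π.symm (Fin.last n)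

/-- Removal of the maximal value of `π`. -/
def removeMax {n : ℕ} (π : Equiv.Perm (Fin (n + 1))) : Equiv.Perm (Fin n) :=
  Equiv.removeNone (((finSuccEquiv' (maxPos π)).symm.trans π).trans (finSuccEquiv' (Fin.last n)))

theorem maxPos_insertMax {n : ℕ} (σ : Equiv.Perm (Fin n)) (p : Fin (n + 1)) :
    maxPos (insertMax σ p) = p := by
  rw [maxPos, Equiv.symm_apply_eq, insertMax_self]

theorem removeMax_insertMax {n : ℕ} (σ : Equiv.Perm (Fin n)) (p : Fin (n + 1)) :
    removeMax (insertMax σ p) = σ := by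
  rw [removeMax, maxPos_insertMax]
  have h : ((finSuccEquiv' p).symm.trans (insertMax σ p)).trans (finSuccEquiv' (Fin.last n))
      = σ.optionCongr := by
    ext x : 1
    simp [insertMax]
  rw [h, Equiv.removeNone_optionCongr]

end BaxterPerm

/-! ### Plane orientations

An oriented map with `n` edges, labelled by `Fin n`, is encoded by its rotation system.
Each edge `e` has two darts (half-edges): `(e, true)`, attached to the origin of `e`, and
`(e, false)`, attached to the end of `e`. -/

/-- The darts of a map with `n` edges. -/
abbrev Dart (n : ℕ) := Fin n × Bool

/-- The involution that exchanges the two darts of every edge. -/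
def dartFlip (n : ℕ) : Equiv.Perm (Dart n) := Equiv.prodCongr (Equiv.refl _) Equiv.boolNot

/-- An oriented map, embedded in an oriented surface, with a distinguished edge `root`:
`rot d` is the dart that follows `d` in clockwise order around the vertex of `d`.
The root edge only serves to point at a face, the one on its left, which is the outer face:
see `Iso`, where the isomorphisms are required to preserve that face, but not the root.
Among the edges with the outer face on their left, `IsPlaneBipolar` requires `root` to be one
that starts at the source. -/
@[ext]
structure PlaneMap (n : ℕ) where
  rot : Equiv.Perm (Dart n)
  root : Fin n

namespace PlaneMap

variable {n : ℕ}

/-- Walking along the edge of the dart `d`, away from the vertex of `d`, and keeping the face on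
the left, the next dart that one takes is `facePerm d`. Hence the orbits of this permutation
correspond to the faces: a face is the set of the darts that have it on their left. -/
def facePerm (O : PlaneMap n) : Equiv.Perm (Dart n) := O.rot * dartFlip n

/-- The vertices: the orbits of the rotation. -/
def Vertex (O : PlaneMap n) : Type := Quotient (Equiv.Perm.SameCycle.setoid O.rot)

/-- The faces: the orbits of the face permutation. -/
def Face (O : PlaneMap n) : Type := Quotient (Equiv.Perm.SameCycle.setoid O.facePerm)

/-- The vertex that a dart is attached to. -/
def vertexOf (O : PlaneMap n) (d : Dart n) : O.Vertex :=
  Quotient.mk (Equiv.Perm.SameCycle.setoid O.rot) d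

/-- The face on the left of a dart (directed away from its vertex). -/
def faceOf (O : PlaneMap n) (d : Dart n) : O.Face :=
  Quotient.mk (Equiv.Perm.SameCycle.setoid O.facePerm) d

/-- The origin of an edge. -/
def tail (O : PlaneMap n) (e : Fin n) : O.Vertex := O.vertexOf (e, true)

/-- The end of an edge. -/
def head (O : PlaneMap n) (e : Fin n) : O.Vertex := O.vertexOf (e, false)

/-- The outer face. -/
def outerFace (O : PlaneMap n) : O.Face := O.faceOf (O.root, true)

/-- There is an edge from `u` to `v`. -/
def Arc (O : PlaneMap n) (u v : O.Vertex) : Prop := ∃ e, O.tail e = u ∧ O.head e = v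

/-- A source is a vertex with no ingoing edge. -/
def IsSource (O : PlaneMap n) (v : O.Vertex) : Prop := ∀ e, O.head e ≠ v

/-- A sink is a vertex with no outgoing edge. -/
def IsSink (O : PlaneMap n) (v : O.Vertex) : Prop := ∀ e, O.tail e ≠ v

/-- The degree of a vertex: the number of darts attached to it. -/
noncomputable def degree (O : PlaneMap n) (v : O.Vertex) : ℕ :=
  Set.ncard {d : Dart n | O.vertexOf d = v}

/-- The number of vertices that are neither a source nor a sink. -/
noncomputable def nonPolar (O : PlaneMap n) : ℕ :=
  Set.ncard {v : O.Vertex | ¬ O.IsSource v ∧ ¬ O.IsSink v}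

/-- Plane bipolar orientations: acyclic orientations of a connected planar map
(planarity is Euler's relation `V + F = E + 2`) with a unique source and a unique sink, both
incident to the outer face. -/
structure IsPlaneBipolar (O : PlaneMap n) : Prop where
  connected : ∀ d d' : Dart n,
    Relation.ReflTransGen (fun a b => b = O.rot a ∨ b = dartFlip n a) d d'
  planar : Nat.card O.Vertex + Nat.card O.Face = n + 2
  acyclic : ∀ v, ¬ Relation.TransGen O.Arc v v
  source_root : O.IsSource (O.tail O.root)
  source_unique : ∀ v, O.IsSource v → v = O.tail O.root
  sink_unique : ∃! v, O.IsSink v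
  sink_outer : ∀ v, O.IsSink v → ∃ d, O.vertexOf d = v ∧ O.faceOf d = O.outerFace

/-- Two maps are the same up to continuous deformation of the plane (and up to the names of the
edges): there is a bijection of the edges that preserves the directions of the edges, the
clockwise order around the vertices and the outer face. -/
def Iso (O O' : PlaneMap n) : Prop :=
  ∃ f : Equiv.Perm (Fin n),
    (∀ d : Dart n, Prod.map f id (O.rot d) = O'.rot (Prod.map f id d)) ∧
    O'.faceOf (f O.root, true) = O'.outerFace

theorem Iso.map_rot {O O' : PlaneMap n} {f : Equiv.Perm (Fin n)}
    (h : ∀ d : Dart n, Prod.map f id (O.rot d) = O'.rot (Prod.map f id d)) {a b : Dart n}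
    (hab : O.faceOf a = O.faceOf b) :
    O'.faceOf (Prod.map f id a) = O'.faceOf (Prod.map f id b) := by
  have hf : ∀ d : Dart n, Prod.map f id (O.facePerm d) = O'.facePerm (Prod.map f id d) := by
    rintro ⟨e, b⟩
    exact h _
  have hc : Function.Semiconj (Prod.map f id) O.facePerm O'.facePerm := hf
  obtain ⟨i, -, hi⟩ := (Quotient.exact hab : O.facePerm.SameCycle a b).exists_pow_eq'
  refine Quotient.sound (s := Equiv.Perm.SameCycle.setoid O'.facePerm) ⟨(i : ℤ), ?_⟩
  rw [zpow_natCast, ← hi, Equiv.Perm.coe_pow, Equiv.Perm.coe_pow]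
  exact ((hc.iterate_right i) a).symm

theorem Iso.refl (O : PlaneMap n) : O.Iso O := ⟨Equiv.refl _, fun _ => rfl, rfl⟩

theorem Iso.symm {O O' : PlaneMap n} (h : O.Iso O') : O'.Iso O := by
  obtain ⟨f, hf, hr⟩ := h
  have hg : ∀ d : Dart n, Prod.map f.symm id (O'.rot d) = O.rot (Prod.map f.symm id d) := by
    intro d
    have h1 := hf (Prod.map f.symm id d)
    have h2 : Prod.map f id (Prod.map f.symm id d) = d := by simp [Prod.map]
    rw [h2] at h1
    rw [← h1]
    simp [Prod.map]
  refine ⟨f.symm, hg, ?_⟩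
  have := Iso.map_rot hg hr
  simpa [Prod.map, outerFace] using this.symm

theorem Iso.trans {O O' O'' : PlaneMap n} (h : O.Iso O') (h' : O'.Iso O'') : O.Iso O'' := by
  obtain ⟨f, hf, hr⟩ := h
  obtain ⟨g, hg, hr'⟩ := h'
  refine ⟨f.trans g, fun d => ?_, ?_⟩
  · have := hg (Prod.map f id d)
    rw [← hf d] at this
    exact this
  · exact (Iso.map_rot hg hr).trans hr'

/-! #### Borders -/

/-- The dart reached after `k` steps of the walk around the outer face (kept on the left) that
starts at the source with the root edge. As long as this walk has only followed edges in their
direction, it is the left border. -/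
def leftWalk (O : PlaneMap n) (k : ℕ) : Dart n := (O.facePerm ^ k) (O.root, true)

/-- The left outer degree, i.e. the length of the left border: the number of steps for which the
walk from the source along the outer face (kept on the left) follows edges in their direction. -/
noncomputable def leftOuterDegree (O : PlaneMap n) : ℕ := sInf {k | (O.leftWalk k).2 = false}

/-- The dart reached after `k` steps of the walk around the outer face, kept on the right, that
starts at the source with the first edge of the right border. -/
def rightWalk (O : PlaneMap n) (k : ℕ) : Dart n :=
  ((O.rot⁻¹ * dartFlip n) ^ k) (O.rot⁻¹ (O.root, true))

/-- The right outer degree, i.e. the length of the right border. -/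
noncomputable def rightOuterDegree (O : PlaneMap n) : ℕ := sInf {k | (O.rightWalk k).2 = false}

/-- The ingoing dart, at the sink, of the last edge of the left border. -/
noncomputable def sinkDart (O : PlaneMap n) : Dart n :=
  dartFlip n (O.leftWalk (O.leftOuterDegree - 1))

/-! #### Mirror image and duality -/

/-- The mirror image. The outer face is now on the left of the edges that had it on their
right; among them, the one that starts at the source becomes the root. -/
def mir (O : PlaneMap n) : PlaneMap n where
  rot := O.rot⁻¹
  root := (O.rot⁻¹ (O.root, true)).1

/-- The dual orientation. The dual of an edge `e` (which keeps its name) goes from the face on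
the right of `e` to the face on the left of `e`. So the dart `d` of the dual is attached to the
face on the left of `dartFlip n d`, and `O.rot⁻¹ * dartFlip n` sends it to the next one
in clockwise order around this face. The outer face is split into two poles, a source on
the right of `O` and a sink on the left of `O`: the product with the transposition cuts the cycle
of the outer face at the two poles of `O`. -/
noncomputable def dual (O : PlaneMap n) : PlaneMap n where
  rot := Equiv.swap O.sinkDart (O.rot⁻¹ (O.root, true)) * (O.rot⁻¹ * dartFlip n)
  root := (O.rot⁻¹ (O.root, true)).1

/-! #### Edge insertions -/

/-- The inclusion of the old darts when an edge `Fin.last n` is added. -/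
def oldDart (n : ℕ) : Dart n ↪ Dart (n + 1) where
  toFun d := (d.1.castSucc, d.2)
  inj' := by
    rintro ⟨a, b⟩ ⟨a', b'⟩ h
    simpa using h

/-- The new edge. -/
abbrev newEdge (n : ℕ) : Fin (n + 1) := Fin.last n

/-- The rotation of `O` where the two darts of the new edge are added as fixed points. -/
def extRot (O : PlaneMap n) : Equiv.Perm (Dart (n + 1)) :=
  O.rot.viaFintypeEmbedding (oldDart n)

/-- The insertion `L_k`, for `1 ≤ k ≤ leftOuterDegree`: an edge is added from the `k`-th vertex of
the left border to the sink, with the outer face on its left. Thus its end comes just after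
`sinkDart` in clockwise order around the sink, and its origin comes just before the `k`-th edge
of the left border in clockwise order around the `k`-th vertex. -/
noncomputable def insertL (O : PlaneMap n) (k : ℕ) : PlaneMap (n + 1) where
  rot := Equiv.swap (oldDart n (O.leftWalk (k - 1))) (newEdge n, true) *
    O.extRot * Equiv.swap (oldDart n O.sinkDart) (newEdge n, false)
  root := if k = 1 then newEdge n else O.root.castSucc

/-- The insertion `R_k`, for `1 ≤ k ≤` degree of the sink. Let `e_1, …, e_j` be the ingoing edges at
the sink `t`, from right to left. Then `t` is split into `t`, which keeps `e_1, …, e_{k-1}`, and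
a new vertex `v`, which receives `e_k, …, e_j`, and an edge is added from `v` to `t`.
In terms of cycles `(e_1 … e_j)` becomes `(e_1 … e_j new⁺ new⁻)` and then
`(e_1 … e_{k-1} new⁻) (e_k … e_j new⁺)`, with `new⁺`, `new⁻` the origin and the end of the new edge.
The dart of `e_k` at `t` is `rot ^ k` applied to that of `e_j`. -/
noncomputable def insertR (O : PlaneMap n) (k : ℕ) : PlaneMap (n + 1) where
  rot := Equiv.swap (oldDart n ((O.rot ^ k) O.sinkDart)) (newEdge n, false) *
    O.extRot * Equiv.swap (oldDart n O.sinkDart) (newEdge n, false) *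
    Equiv.swap (oldDart n O.sinkDart) (newEdge n, true)
  root := O.root.castSucc

/-- The orientation with one edge. -/
def single : PlaneMap 1 where
  rot := 1
  root := 0

end PlaneMap

/-- Plane bipolar orientations with `n` edges, up to isomorphism. -/
def planeBipolarSetoid (n : ℕ) : Setoid {O : PlaneMap n // O.IsPlaneBipolar} where
  r O O' := O.1.Iso O'.1
  iseqv := ⟨fun O => PlaneMap.Iso.refl O.1, PlaneMap.Iso.symm, PlaneMap.Iso.trans⟩

/-- The set of plane bipolar orientations with `n` edges. -/
def PlaneBipolar (n : ℕ) : Type := Quotient (planeBipolarSetoid n)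

open BaxterPerm in
/-- The canonical map `Λ`, for permutations of size `n + 1`. The permutation of size `1` is sent
to the orientation with one edge. A larger permutation is obtained from `σ = removeMax π`
by inserting the maximal value either just before the `k`-th left-to-right maximum of `σ`, and then
the image is `L_k (Λ σ)`, or just after the `k`-th right-to-left maximum of `σ` (counted from the
right), and then the image is `R_k (Λ σ)`. (The value is irrelevant for other permutations,
which are not Baxter.) -/
noncomputable def canonicalMap : (n : ℕ) → Equiv.Perm (Fin (n + 1)) → PlaneMap (n + 1)
  | 0, _ => PlaneMap.single
  | n + 1, π =>
    if ∃ q, IsLRMax (removeMax π) q ∧ q.castSucc = maxPos π then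
      (canonicalMap n (removeMax π)).insertL
        (Finset.univ.filter fun q => IsLRMax (removeMax π) q ∧ q.castSucc ≤ maxPos π).card
    else
      (canonicalMap n (removeMax π)).insertR
        (Finset.univ.filter fun q => IsRLMax (removeMax π) q ∧ maxPos π ≤ q.succ).card

open Equiv

/-! ### Cycles of permutations -/

/-! Baxter permutations and plane bipolar orientations grow along the same generating tree. Deleting
the largest value of a Baxter permutation leaves a Baxter permutation (`IsBaxter.of_insertMax`), and
the sites where it can be put back are those just before an lr-maximum and just after an rl-maximum
(`IsBaxter.position`, `IsBaxter.insertMax_castSucc`, `IsBaxter.insertMax_succ`). On the side of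
maps, the last edge of the left border is removed: it is deleted if the dart that follows it
clockwise at its origin is outgoing, and contracted if that dart is ingoing
(`Good.exists_insert_eq`). These are the inverses of `insertL` and `insertR`. The numbers of sites
agree, because lr-maxima match the left outer degree and rl-maxima match the degree of the sink;
these equalities are carried along the induction (`CanonicalSpec`).

Euler's relation is hard to follow through an insertion. Every end of an edge is followed in the
rotation either by an origin (a turn) or by an end (a peak). Turns surject onto the non-polar
vertices and peaks onto the faces, so Euler's relation says exactly that both surjections are
injective (`euler_iff`). This local form is `Good`, and it is equivalent to `IsPlaneBipolar`. The
steps `LStep` and `RStep` preserve it in both directions (`LStep.good`, `LStep.of_good`,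
`RStep.good`, `RStep.of_good`). Vertices and faces before and after a step are compared through
functions constant on cycles, which extend to the new darts or restrict to the old ones.

The operation `mir` of the dual exchanges the two kinds of insertions (`MirDual.insert`), as `rev`
does for permutations. So `canonicalMap` transports one symmetry to the other, and the degrees of
the sink and of the source follow from the outer degrees of the image of `rev π`.

Isomorphisms do not have to preserve the root, but for bipolar orientations they do
(`Iso.exists_commutes`). Hence they preserve the last edge of the left border, and restrict to the
parents in the tree; this gives injectivity. -/

theorem Equiv.Perm.SameCycle.eq_of_invariant {α β : Type*} [Finite α] {σ : Perm α} {c : α → β}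
    (hc : ∀ x, c (σ x) = c x) {x y : α} (h : σ.SameCycle x y) : c x = c y := by
  obtain ⟨i, -, rfl⟩ := h.exists_pow_eq'
  induction i with
  | zero => rfl
  | succ i ih =>
    rw [pow_succ', Perm.mul_apply, hc]
    exact ih ⟨i, by simp⟩

theorem Equiv.Perm.SameCycle.induct {α : Type*} [Finite α] {σ : Perm α} {p : α → Prop} {x y : α}
    (h : σ.SameCycle x y) (hx : p x) (hs : ∀ z, σ.SameCycle x z → p z → p (σ z)) : p y := by
  obtain ⟨i, -, rfl⟩ := h.exists_pow_eq'
  induction i with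
  | zero => exact hx
  | succ i ih =>
    rw [pow_succ', Perm.mul_apply]
    exact hs _ ⟨i, by simp⟩ (ih ⟨i, by simp⟩)

/-- A segment of a cycle, from `c` to `b`. -/
theorem Equiv.Perm.SameCycle.exists_segment {α : Type*} [Finite α] {σ : Perm α} {b c : α}
    (h : σ.SameCycle c b) : ∃ S : Set α, b ∈ S ∧ c ∈ S ∧ (∀ x ∈ S, σ.SameCycle c x) ∧
      (∀ x, x ≠ b → x ∈ S → σ x ∈ S) ∧ (∀ x, σ x ∈ S → σ x ≠ c → x ∈ S) ∧
      (σ b ∈ S → σ b = c) ∧ (∀ x ∈ S, σ x = c → x = b) := by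
  classical
  have hex : ∃ i, (σ ^ i) c = b := by
    obtain ⟨i, -, hi⟩ := h.exists_pow_eq'
    exact ⟨i, hi⟩
  have hJ := Nat.find_spec hex
  have hmin := fun i => Nat.find_min hex (m := i)
  set J := Nat.find hex
  -- `J` is the first time at which the orbit of `c` meets `b`; the segment is the orbit up to that
  -- time.
  refine ⟨{x | ∃ j ≤ J, (σ ^ j) c = x}, ⟨J, le_rfl, hJ⟩, ⟨0, Nat.zero_le _, by simp⟩, ?_, ?_, ?_, ?_, ?_⟩
  · rintro x ⟨j, -, rfl⟩
    exact ⟨j, by simp⟩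
  · rintro x hx ⟨j, hj, rfl⟩
    refine ⟨j + 1, ?_, by rw [pow_succ', Perm.mul_apply]⟩
    rcases hj.lt_or_eq with h | rfl
    · exact h
    · exact absurd hJ hx
  · rintro x ⟨j, hj, hx⟩ hc
    cases j with
    | zero => exact absurd hx.symm hc
    | succ j =>
      rw [pow_succ', Perm.mul_apply] at hx
      exact ⟨j, by omega, σ.injective hx⟩
  · rintro ⟨j, hj, hx⟩
    cases j with
    | zero => exact hx.symm
    | succ j =>
      rw [pow_succ', Perm.mul_apply] at hx
      exact absurd (σ.injective hx) (hmin j (by omega))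
  -- If the orbit returned to `c` after `j + 1 ≤ J` steps, the remaining `J - (j + 1)` steps would
  -- already lead from `c` to `b`, against the minimality of `J`.
  · rintro x ⟨j, hj, rfl⟩ hx
    by_contra hne
    have hjJ : j ≠ J := by rintro rfl; exact hne hJ
    have h1 : (σ ^ (j + 1)) c = c := by rw [pow_succ', Perm.mul_apply, hx]
    refine hmin (J - (j + 1)) (by omega) ?_
    have h2 := hJ
    rw [← Nat.sub_add_cancel (show j + 1 ≤ J by omega), pow_add, Perm.mul_apply, h1] at h2
    exact h2

namespace PlaneMap

variable {n : ℕ}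

/-! ### Darts -/

/-- The origin dart of the new edge. -/
abbrev newTail (n : ℕ) : Dart (n + 1) := (newEdge n, true)

/-- The end dart of the new edge. -/
abbrev newHead (n : ℕ) : Dart (n + 1) := (newEdge n, false)

@[simp] theorem dartFlip_mk (e : Fin n) (b : Bool) : dartFlip n (e, b) = (e, !b) := rfl

@[simp] theorem dartFlip_snd (d : Dart n) : (dartFlip n d).2 = !d.2 := rfl

@[simp] theorem dartFlip_dartFlip (d : Dart n) : dartFlip n (dartFlip n d) = d := by
  rcases d with ⟨e, b⟩; simp

theorem dartFlip_mul_self : dartFlip n * dartFlip n = 1 := by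
  ext1 d; exact dartFlip_dartFlip d

@[simp] theorem dartFlip_inv : (dartFlip n)⁻¹ = dartFlip n :=
  inv_eq_of_mul_eq_one_left dartFlip_mul_self

theorem dartFlip_eq_iff {d d' : Dart n} : dartFlip n d = d' ↔ d = dartFlip n d' := by
  constructor
  · rintro rfl; simp
  · rintro rfl; simp

@[simp] theorem oldDart_snd (d : Dart n) : (oldDart n d).2 = d.2 := rfl

@[simp] theorem dartFlip_oldDart (d : Dart n) :
    dartFlip (n + 1) (oldDart n d) = oldDart n (dartFlip n d) := rfl

@[simp] theorem oldDart_ne_new (d : Dart n) (b : Bool) : oldDart n d ≠ (newEdge n, b) := by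
  intro h
  exact Fin.castSucc_ne_last _ (congrArg Prod.fst h)

@[simp] theorem new_ne_oldDart (d : Dart n) (b : Bool) : (newEdge n, b) ≠ oldDart n d :=
  (oldDart_ne_new d b).symm

theorem oldDart_mk (e : Fin n) (b : Bool) : oldDart n (e, b) = (e.castSucc, b) := rfl

theorem dart_cases {p : Dart (n + 1) → Prop} (tail : p (newTail n)) (head : p (newHead n))
    (old : ∀ d, p (oldDart n d)) (d : Dart (n + 1)) : p d := by
  rcases d with ⟨e, b⟩
  refine Fin.lastCases ?_ (fun e => old (e, b)) e
  cases b
  · exact head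
  · exact tail

@[simp] theorem extRot_oldDart (O : PlaneMap n) (d : Dart n) :
    O.extRot (oldDart n d) = oldDart n (O.rot d) :=
  Perm.viaFintypeEmbedding_apply_image ..

@[simp] theorem extRot_new (O : PlaneMap n) (b : Bool) :
    O.extRot (newEdge n, b) = (newEdge n, b) := by
  refine Perm.viaFintypeEmbedding_apply_notMem_range _ _ ?_
  rintro ⟨d, hd⟩
  exact oldDart_ne_new d b hd

theorem facePerm_apply (O : PlaneMap n) (d : Dart n) : O.facePerm d = O.rot (dartFlip n d) := rfl

theorem vertexOf_rot (O : PlaneMap n) (d : Dart n) : O.vertexOf (O.rot d) = O.vertexOf d :=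
  Quotient.sound (s := Perm.SameCycle.setoid O.rot) (Perm.sameCycle_apply_left.2 (.refl _ _))

theorem faceOf_facePerm (O : PlaneMap n) (d : Dart n) : O.faceOf (O.facePerm d) = O.faceOf d :=
  Quotient.sound (s := Perm.SameCycle.setoid O.facePerm) (Perm.sameCycle_apply_left.2 (.refl _ _))

theorem vertexOf_eq_iff {O : PlaneMap n} {d d' : Dart n} :
    O.vertexOf d = O.vertexOf d' ↔ O.rot.SameCycle d d' :=
  Quotient.eq (r := Perm.SameCycle.setoid O.rot)

theorem faceOf_eq_iff {O : PlaneMap n} {d d' : Dart n} :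
    O.faceOf d = O.faceOf d' ↔ O.facePerm.SameCycle d d' :=
  Quotient.eq (r := Perm.SameCycle.setoid O.facePerm)

/-! ### Heights and borders -/

/-- A function on the vertices, increasing along the edges. -/
structure IsHeight (O : PlaneMap n) (h : Dart n → ℕ) : Prop where
  rot : ∀ d, h (O.rot d) = h d
  lt : ∀ e, h (e, true) < h (e, false)

theorem IsHeight.sameCycle {O : PlaneMap n} {h : Dart n → ℕ} (hh : O.IsHeight h) {d d' : Dart n}
    (hd : O.rot.SameCycle d d') : h d = h d' := hd.eq_of_invariant hh.rot

theorem IsHeight.lt_flip {O : PlaneMap n} {h : Dart n → ℕ} (hh : O.IsHeight h) {d : Dart n}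
    (hd : d.2 = true) : h d < h (dartFlip n d) := by
  rcases d with ⟨e, b⟩
  cases hd
  exact hh.lt e

theorem IsHeight.flip_lt {O : PlaneMap n} {h : Dart n → ℕ} (hh : O.IsHeight h) {d : Dart n}
    (hd : d.2 = false) : h (dartFlip n d) < h d := by
  rcases d with ⟨e, b⟩
  cases hd
  exact hh.lt e

theorem IsHeight.lt_facePerm {O : PlaneMap n} {h : Dart n → ℕ} (hh : O.IsHeight h) {d : Dart n}
    (hd : d.2 = true) : h d < h (O.facePerm d) := by
  rw [facePerm_apply, hh.rot]
  exact hh.lt_flip hd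

/-- The walk from `d` that keeps the face on the left follows exactly `ℓ` edges before it would
have to follow an edge backwards. -/
structure Run (O : PlaneMap n) (d : Dart n) (ℓ : ℕ) : Prop where
  up : ∀ j < ℓ, ((O.facePerm ^ j) d).2 = true
  down : ((O.facePerm ^ ℓ) d).2 = false

theorem facePerm_pow_succ (O : PlaneMap n) (d : Dart n) (j : ℕ) :
    (O.facePerm ^ (j + 1)) d = O.facePerm ((O.facePerm ^ j) d) := by
  rw [pow_succ', Perm.mul_apply]

theorem leftWalk_succ (O : PlaneMap n) (j : ℕ) :
    O.leftWalk (j + 1) = O.facePerm (O.leftWalk j) := facePerm_pow_succ ..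

@[simp] theorem leftWalk_zero (O : PlaneMap n) : O.leftWalk 0 = (O.root, true) := rfl

theorem Run.height_lt {O : PlaneMap n} {d : Dart n} {ℓ : ℕ} (hr : O.Run d ℓ) {h : Dart n → ℕ}
    (hh : O.IsHeight h) {i j : ℕ} (hij : i < j) (hj : j ≤ ℓ) :
    h ((O.facePerm ^ i) d) < h ((O.facePerm ^ j) d) := by
  induction j with
  | zero => omega
  | succ j ih =>
    have h1 : h ((O.facePerm ^ j) d) < h ((O.facePerm ^ (j + 1)) d) := by
      rw [facePerm_pow_succ]
      exact hh.lt_facePerm (hr.up j hj)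
    rcases (Nat.lt_succ_iff.mp hij).lt_or_eq with h2 | rfl
    · exact (ih h2 (by omega)).trans h1
    · exact h1

/-- The height grows by at least one with each forward edge, while the sum of all heights bounds
each of them; so the walk must turn back. -/
theorem exists_run {O : PlaneMap n} {h : Dart n → ℕ} (hh : O.IsHeight h) {d : Dart n}
    (hd : d.2 = true) : ∃ ℓ, O.Run d (ℓ + 1) := by
  classical
  have hex : ∃ j, ((O.facePerm ^ j) d).2 = false := by
    by_contra! hall
    have hall' : ∀ j, ((O.facePerm ^ j) d).2 = true := fun j => by simpa using hall j
    have hge : ∀ j, j ≤ h ((O.facePerm ^ j) d) := by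
      intro j
      induction j with
      | zero => simp
      | succ j ih =>
        rw [facePerm_pow_succ]
        have := hh.lt_facePerm (hall' j)
        omega
    have h1 := hge (∑ x, h x + 1)
    have h2 : h ((O.facePerm ^ (∑ x, h x + 1)) d) ≤ ∑ x, h x :=
      Finset.single_le_sum (f := h) (fun _ _ => Nat.zero_le _) (Finset.mem_univ _)
    omega
  have h0 : Nat.find hex ≠ 0 := by
    intro h0
    have := Nat.find_spec hex
    rw [h0] at this
    simp [hd] at this
  obtain ⟨ℓ, hℓ⟩ := Nat.exists_eq_succ_of_ne_zero h0
  refine ⟨ℓ, fun j hj => ?_, ?_⟩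
  · have := Nat.find_min hex (m := j) (by omega)
    simpa using this
  · have := Nat.find_spec hex
    rwa [hℓ] at this

theorem Run.leftOuterDegree {O : PlaneMap n} {ℓ : ℕ} (hr : O.Run (O.root, true) ℓ) :
    O.leftOuterDegree = ℓ := by
  refine le_antisymm (Nat.sInf_le hr.down) ?_
  refine le_csInf ⟨ℓ, hr.down⟩ fun j hj => ?_
  by_contra hlt
  have h1 := hr.up j (by omega)
  have h2 : ((O.facePerm ^ j) (O.root, true)).2 = false := hj
  simp [h1] at h2

theorem IsHeight.run_leftOuterDegree {O : PlaneMap n} {h : Dart n → ℕ} (hh : O.IsHeight h) :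
    O.Run (O.root, true) O.leftOuterDegree := by
  obtain ⟨ℓ, hr⟩ := exists_run hh (d := (O.root, true)) rfl
  rwa [hr.leftOuterDegree]

theorem IsHeight.leftOuterDegree_pos {O : PlaneMap n} {h : Dart n → ℕ} (hh : O.IsHeight h) :
    0 < O.leftOuterDegree := by
  obtain ⟨ℓ, hr⟩ := exists_run hh (d := (O.root, true)) rfl
  rw [hr.leftOuterDegree]
  omega

/-- The last edge of the left border, as a dart of the outer face. -/
theorem dartFlip_sinkDart (O : PlaneMap n) :
    dartFlip n O.sinkDart = O.leftWalk (O.leftOuterDegree - 1) := by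
  simp [sinkDart]

theorem IsHeight.sinkDart_snd {O : PlaneMap n} {h : Dart n → ℕ} (hh : O.IsHeight h) :
    O.sinkDart.2 = false := by
  have := hh.run_leftOuterDegree.up _ (Nat.sub_lt hh.leftOuterDegree_pos one_pos)
  simp only [sinkDart, dartFlip_snd, leftWalk, this, Bool.not_true]

theorem IsHeight.rot_sinkDart {O : PlaneMap n} {h : Dart n → ℕ} (hh : O.IsHeight h) :
    O.rot O.sinkDart = O.leftWalk O.leftOuterDegree := by
  have h1 := O.leftWalk_succ (O.leftOuterDegree - 1)
  rw [Nat.sub_add_cancel hh.leftOuterDegree_pos] at h1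
  rw [h1, facePerm_apply]
  rfl

theorem leftWalk_sameCycle (O : PlaneMap n) (i j : ℕ) :
    O.facePerm.SameCycle (O.leftWalk i) (O.leftWalk j) :=
  (Perm.SameCycle.trans (y := (O.root, true)) ⟨-(i : ℤ), by simp [leftWalk]⟩ ⟨j, by simp [leftWalk]⟩)

/-! ### Bipolar orientations in terms of darts -/

/-- A reformulation of `IsPlaneBipolar`: Euler's relation is replaced by the unicity of the
change from ingoing to outgoing edges around every vertex, and from forward to backward edges
around every face. -/
structure Good (O : PlaneMap n) : Prop where
  height : ∃ h, O.IsHeight h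
  source : ∀ d, O.rot.SameCycle (O.root, true) d → d.2 = true
  source_unique : ∀ d, (∀ x, O.rot.SameCycle d x → x.2 = true) → O.rot.SameCycle (O.root, true) d
  sink : ∀ d, O.rot.SameCycle O.sinkDart d → d.2 = false
  sink_unique : ∀ d, (∀ x, O.rot.SameCycle d x → x.2 = false) → O.rot.SameCycle O.sinkDart d
  turn_inj : ∀ d d', d.2 = false → (O.rot d).2 = true → d'.2 = false → (O.rot d').2 = true →
    O.rot.SameCycle d d' → d = d'
  peak_inj : ∀ d d', d.2 = true → (O.facePerm d).2 = false → d'.2 = true →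
    (O.facePerm d').2 = false → O.facePerm.SameCycle d d' → d = d'

end PlaneMap

namespace PlaneMap

variable {n : ℕ}

/-! ### Adding an edge -/

/-- The extension of a function on the darts to the darts of a new edge. -/
def extendDart {γ : Type*} (c : Dart n → γ) (t h : γ) (d : Dart (n + 1)) : γ :=
  if hd : d.1 = newEdge n then (if d.2 then t else h) else c (d.1.castPred hd, d.2)

@[simp] theorem extendDart_tail {γ : Type*} (c : Dart n → γ) (t h : γ) :
    extendDart c t h (newTail n) = t := by simp [extendDart]

@[simp] theorem extendDart_head {γ : Type*} (c : Dart n → γ) (t h : γ) :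
    extendDart c t h (newHead n) = h := by simp [extendDart]

@[simp] theorem extendDart_old {γ : Type*} (c : Dart n → γ) (t h : γ) (d : Dart n) :
    extendDart c t h (oldDart n d) = c d := by
  have h1 : (oldDart n d).1 ≠ newEdge n := Fin.castSucc_ne_last d.1
  rw [extendDart, dif_neg h1]
  rfl

/-- `O'` is obtained from `O` by adding an edge, whose origin comes just before `a` and whose end
comes just after `b`. -/
structure LStep (O : PlaneMap n) (O' : PlaneMap (n + 1)) (a b : Dart n) : Prop where
  tail : O'.rot (newTail n) = oldDart n a
  head : O'.rot (newHead n) = oldDart n (O.rot b)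
  before_head : O'.rot (oldDart n b) = newHead n
  before_tail : ∀ x, O.rot x = a → O'.rot (oldDart n x) = newTail n
  old : ∀ x, x ≠ b → O.rot x ≠ a → O'.rot (oldDart n x) = oldDart n (O.rot x)
  a_out : a.2 = true
  b_in : b.2 = false
  rot_b_in : (O.rot b).2 = false

theorem LStep.of_rot {O : PlaneMap n} {O' : PlaneMap (n + 1)} {a b : Dart n}
    (h : O'.rot = swap (oldDart n a) (newTail n) * O.extRot * swap (oldDart n b) (newHead n))
    (ha : a.2 = true) (hb : b.2 = false) (hb' : (O.rot b).2 = false) : LStep O O' a b := by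
  have hne : O.rot b ≠ a := by rintro rfl; simp [hb'] at ha
  have hne' : newHead n ≠ newTail n := by simp
  refine ⟨?_, ?_, ?_, ?_, ?_, ha, hb, hb'⟩
  · rw [h]
    simp [swap_apply_of_ne_of_ne]
  · rw [h]
    simp [swap_apply_of_ne_of_ne, hne]
  · rw [h]
    simp [swap_apply_of_ne_of_ne]
  · rintro x rfl
    have hx : x ≠ b := by rintro rfl; exact hne rfl
    rw [h]
    simp [swap_apply_of_ne_of_ne, hx]
  · intro x hx hx'
    rw [h]
    simp [swap_apply_of_ne_of_ne, hx, hx']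


namespace LStep

variable {O : PlaneMap n} {O' : PlaneMap (n + 1)} {a b : Dart n}

theorem rot_b_ne (s : LStep O O' a b) : O.rot b ≠ a := by
  rintro h
  have := s.rot_b_in
  simp [h, s.a_out] at this

/-- The new darts take the values of the vertices they are attached to. With `restrict_rot`, this
transfers functions on vertices both ways; applied to `vertexOf` it compares the vertices of `O` and
`O'`. -/
theorem extend_rot (s : LStep O O' a b) {γ : Type*} {c : Dart n → γ}
    (hc : ∀ x, c (O.rot x) = c x) (x : Dart (n + 1)) :
    extendDart c (c a) (c b) (O'.rot x) = extendDart c (c a) (c b) x := by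
  induction x using dart_cases with
  | tail => simp [s.tail]
  | head => simp [s.head, hc]
  | old x =>
    by_cases h1 : x = b
    · subst h1
      simp [s.before_head]
    by_cases h2 : O.rot x = a
    · simp [s.before_tail x h2, ← h2, hc]
    · simp [s.old x h1 h2, hc]

theorem restrict_rot (s : LStep O O' a b) {γ : Type*} {c : Dart (n + 1) → γ}
    (hc : ∀ x, c (O'.rot x) = c x) (x : Dart n) :
    c (oldDart n (O.rot x)) = c (oldDart n x) := by
  by_cases h1 : x = b
  · subst h1
    rw [← s.head, hc, ← s.before_head, hc]
  by_cases h2 : O.rot x = a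
  · rw [h2, ← s.tail, hc, ← s.before_tail x h2, hc]
  · rw [← s.old x h1 h2, hc]

theorem sameCycle_iff (s : LStep O O' a b) {x y : Dart n} :
    O'.rot.SameCycle (oldDart n x) (oldDart n y) ↔ O.rot.SameCycle x y := by
  constructor
  · intro h
    simpa [vertexOf_eq_iff] using h.eq_of_invariant (s.extend_rot O.vertexOf_rot)
  · intro h
    simpa [vertexOf_eq_iff] using
      h.eq_of_invariant (c := fun x => O'.vertexOf (oldDart n x)) (s.restrict_rot O'.vertexOf_rot)

theorem sameCycle_tail (s : LStep O O' a b) : O'.rot.SameCycle (newTail n) (oldDart n a) := by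
  rw [← s.tail, Perm.sameCycle_apply_right]

theorem sameCycle_head (s : LStep O O' a b) : O'.rot.SameCycle (newHead n) (oldDart n b) := by
  rw [← s.before_head, Perm.sameCycle_apply_left]

theorem facePerm_tail (s : LStep O O' a b) :
    O'.facePerm (newTail n) = oldDart n (O.rot b) := s.head

theorem facePerm_head (s : LStep O O' a b) : O'.facePerm (newHead n) = oldDart n a := s.tail

theorem facePerm_flip_b (s : LStep O O' a b) :
    O'.facePerm (oldDart n (dartFlip n b)) = newHead n := by
  rw [facePerm_apply, dartFlip_oldDart, dartFlip_dartFlip, s.before_head]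

theorem facePerm_before_tail (s : LStep O O' a b) {x : Dart n} (hx : O.facePerm x = a) :
    O'.facePerm (oldDart n x) = newTail n :=
  s.before_tail _ hx

theorem facePerm_old (s : LStep O O' a b) {x : Dart n} (hx : x ≠ dartFlip n b)
    (hx' : O.facePerm x ≠ a) : O'.facePerm (oldDart n x) = oldDart n (O.facePerm x) :=
  s.old _ (fun h => hx (dartFlip_eq_iff.1 h)) hx'

theorem facePerm_old_snd (s : LStep O O' a b) (x : Dart n) :
    (O'.facePerm (oldDart n x)).2 = (O.facePerm x).2 := by
  by_cases h1 : x = dartFlip n b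
  · subst h1
    rw [s.facePerm_flip_b, facePerm_apply, dartFlip_dartFlip, s.rot_b_in]
  by_cases h2 : O.facePerm x = a
  · rw [s.facePerm_before_tail h2, h2, s.a_out]
  · rw [s.facePerm_old h1 h2, oldDart_snd]

theorem rot_old_snd (s : LStep O O' a b) (x : Dart n) :
    (O'.rot (oldDart n x)).2 = (O.rot x).2 := by
  have := s.facePerm_old_snd (dartFlip n x)
  rwa [facePerm_apply, facePerm_apply, dartFlip_oldDart, dartFlip_dartFlip] at this

/-- Both sides of the new edge are sent to the face that it cuts. So each face of `O'` projects to a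
face of `O`, but the cut face has two preimages. -/
theorem extend_facePerm (s : LStep O O' a b) {γ : Type*} {c : Dart n → γ}
    (hc : ∀ x, c (O.facePerm x) = c x) (hab : c a = c (dartFlip n b)) (x : Dart (n + 1)) :
    extendDart c (c a) (c a) (O'.facePerm x) = extendDart c (c a) (c a) x := by
  induction x using dart_cases with
  | tail =>
    have := hc (dartFlip n b)
    rw [facePerm_apply, dartFlip_dartFlip] at this
    simp [s.facePerm_tail, this, hab]
  | head => simp [s.facePerm_head]
  | old x =>
    by_cases h1 : x = dartFlip n b
    · subst h1
      simp [s.facePerm_flip_b, hab]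
    by_cases h2 : O.facePerm x = a
    · simp [s.facePerm_before_tail h2, ← h2, hc]
    · simp [s.facePerm_old h1 h2, hc]

theorem sameCycle_face (s : LStep O O' a b) (hab : O.facePerm.SameCycle a (dartFlip n b))
    {x y : Dart n} (h : O'.facePerm.SameCycle (oldDart n x) (oldDart n y)) :
    O.facePerm.SameCycle x y := by
  simpa [faceOf_eq_iff] using
    h.eq_of_invariant (s.extend_facePerm O.faceOf_facePerm (faceOf_eq_iff.2 hab))

theorem sameCycle_face_tail (s : LStep O O' a b) (hab : O.facePerm.SameCycle a (dartFlip n b))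
    {x : Dart n} (h : O'.facePerm.SameCycle (newTail n) (oldDart n x)) :
    O.facePerm.SameCycle a x := by
  simpa [faceOf_eq_iff] using
    h.eq_of_invariant (s.extend_facePerm O.faceOf_facePerm (faceOf_eq_iff.2 hab))

/-- The new edge cuts its face. -/
theorem not_sameCycle_face (s : LStep O O' a b) (hab : O.facePerm.SameCycle a (dartFlip n b)) :
    ¬ O'.facePerm.SameCycle (newTail n) (oldDart n (dartFlip n b)) := by
  obtain ⟨S, hb, ha, -, h1, h2, h3, h4⟩ := hab.exists_segment
  intro h
  -- `S` is the arc from `a` to `dartFlip n b` of the old face. Closed up by the new head, it is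
  -- stable under the new face permutation, and the new tail stays outside.
  have hS : ∀ x, extendDart (· ∈ S) False True (O'.facePerm x) =
      extendDart (· ∈ S) False True x := by
    intro x
    induction x using dart_cases with
    | tail =>
      rw [facePerm_apply, dartFlip_dartFlip] at h3
      simp only [s.facePerm_tail, extendDart_old, extendDart_tail, eq_iff_iff, iff_false]
      exact fun h => s.rot_b_ne (h3 h)
    | head => simp [s.facePerm_head, ha]
    | old x =>
      by_cases hx : x = dartFlip n b
      · subst hx
        simp [s.facePerm_flip_b, hb]
      by_cases hx' : O.facePerm x = a
      · simp only [s.facePerm_before_tail hx', extendDart_old, extendDart_tail, eq_iff_iff,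
          false_iff]
        intro hxS
        exact hx (h4 x hxS hx')
      · simp only [s.facePerm_old hx hx', extendDart_old, eq_iff_iff]
        exact ⟨fun h => h2 _ h hx', h1 _ hx⟩
  have := h.eq_of_invariant hS
  simp [hb] at this


/-! #### Orientations with an additional edge -/

/-- Here `k` counts the border edges that precede `a`, hence is one less than the index of
`insertL`. The two walks agree until the step that would enter `a`, where the new edge takes over;
strict growth of heights excludes an earlier change. -/
theorem leftWalk_eq (s : LStep O O' a b) (hO : O.Good) {k : ℕ} (hk : k < O.leftOuterDegree)
    (ha : a = O.leftWalk k) (hb : b = O.sinkDart)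
    (hroot : O'.root = if k = 0 then newEdge n else O.root.castSucc) :
    (∀ j < k, O'.leftWalk j = oldDart n (O.leftWalk j)) ∧ O'.leftWalk k = newTail n := by
  obtain ⟨h, hh⟩ := hO.height
  have hr := hh.run_leftOuterDegree
  have hlt : ∀ {i j}, i < j → j ≤ O.leftOuterDegree → O.leftWalk i ≠ O.leftWalk j := by
    intro i j hij hj heq
    have := hr.height_lt hh hij hj
    simp only [leftWalk] at heq
    simp [heq] at this
  by_cases hk0 : k = 0
  · subst hk0
    simp [hroot]
  rw [if_neg hk0] at hroot
  have hold : ∀ j < k, O'.leftWalk j = oldDart n (O.leftWalk j) := by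
    intro j hj
    induction j with
    | zero => simp [hroot, oldDart_mk]
    | succ j ih =>
      rw [leftWalk_succ, ih (by omega), s.facePerm_old, leftWalk_succ]
      · rw [hb, dartFlip_sinkDart]
        exact hlt (by omega) (by omega)
      · rw [ha, ← leftWalk_succ]
        exact hlt hj (by omega)
  refine ⟨hold, ?_⟩
  obtain ⟨k, rfl⟩ := Nat.exists_eq_succ_of_ne_zero hk0
  rw [leftWalk_succ, hold k (by omega), s.facePerm_before_tail]
  rw [ha, ← leftWalk_succ]

theorem run (s : LStep O O' a b) (hO : O.Good) {k : ℕ} (hk : k < O.leftOuterDegree)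
    (ha : a = O.leftWalk k) (hb : b = O.sinkDart)
    (hroot : O'.root = if k = 0 then newEdge n else O.root.castSucc) :
    O'.Run (O'.root, true) (k + 1) := by
  obtain ⟨h1, h2⟩ := s.leftWalk_eq hO hk ha hb hroot
  obtain ⟨h, hh⟩ := hO.height
  constructor
  · intro j hj
    change (O'.leftWalk j).2 = true
    rcases (Nat.lt_succ_iff.1 hj).lt_or_eq with h3 | rfl
    · rw [h1 j h3, oldDart_snd]
      exact hh.run_leftOuterDegree.up j (by omega)
    · rw [h2]
  · change (O'.leftWalk (k + 1)).2 = false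
    rw [leftWalk_succ, h2, s.facePerm_tail, oldDart_snd, s.rot_b_in]

theorem sinkDart_eq (s : LStep O O' a b) (hO : O.Good) {k : ℕ} (hk : k < O.leftOuterDegree)
    (ha : a = O.leftWalk k) (hb : b = O.sinkDart)
    (hroot : O'.root = if k = 0 then newEdge n else O.root.castSucc) :
    O'.sinkDart = newHead n := by
  rw [sinkDart, (s.run hO hk ha hb hroot).leftOuterDegree, Nat.add_sub_cancel,
    (s.leftWalk_eq hO hk ha hb hroot).2]
  rfl

theorem sameCycle_root (s : LStep O O' a b) {k : ℕ} (ha : a = O.leftWalk k)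
    (hroot : O'.root = if k = 0 then newEdge n else O.root.castSucc) :
    O'.rot.SameCycle (O'.root, true) (oldDart n (O.root, true)) := by
  rw [hroot]
  split_ifs with hk
  · subst hk
    rw [← leftWalk_zero, ← ha]
    exact s.sameCycle_tail
  · rfl

theorem isHeight (s : LStep O O' a b) {h : Dart n → ℕ} (hh : O.IsHeight h) (hab : h a < h b) :
    O'.IsHeight (extendDart h (h a) (h b)) where
  rot := s.extend_rot hh.rot
  lt e := by
    induction e using Fin.lastCases with
    | last => simpa using hab
    | cast e => simpa [← oldDart_mk] using hh.lt e

theorem good (s : LStep O O' a b) (hO : O.Good) {k : ℕ} (hk : k < O.leftOuterDegree)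
    (ha : a = O.leftWalk k) (hb : b = O.sinkDart)
    (hroot : O'.root = if k = 0 then newEdge n else O.root.castSucc) : O'.Good := by
  have hsink := s.sinkDart_eq hO hk ha hb hroot
  have hsr := s.sameCycle_root ha hroot
  obtain ⟨h, hh⟩ := hO.height
  have hr := hh.run_leftOuterDegree
  have hface : O.facePerm.SameCycle a (dartFlip n b) := by
    rw [ha, hb, dartFlip_sinkDart]
    exact leftWalk_sameCycle ..
  have hbsink : ∀ d, O.rot.SameCycle b d → d.2 = false := by rw [hb]; exact hO.sink
  constructor
  · refine ⟨_, s.isHeight hh ?_⟩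
    -- One step after the last edge of the left border, the walk is at `O.rot b`, at the sink; so
    -- the height of `b` is that of the end of the run.
    have := hr.height_lt hh hk le_rfl
    change h (O.leftWalk k) < h (O.leftWalk _) at this
    rwa [← hh.rot_sinkDart, hh.rot, ← ha, ← hb] at this
  · intro d hd
    replace hd := hsr.symm.trans hd
    induction d using dart_cases with
    | tail => rfl
    | head =>
      have := hO.source _ (s.sameCycle_iff.1 (hd.trans s.sameCycle_head))
      simp [s.b_in] at this
    | old d => exact hO.source _ (s.sameCycle_iff.1 hd)
  · intro d hd
    refine hsr.trans ?_
    have key : ∀ d, (∀ x, O'.rot.SameCycle (oldDart n d) x → x.2 = true) →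
        O'.rot.SameCycle (oldDart n (O.root, true)) (oldDart n d) := fun d hd =>
      s.sameCycle_iff.2 (hO.source_unique d fun x hx => hd (oldDart n x) (s.sameCycle_iff.2 hx))
    induction d using dart_cases with
    | tail => exact (key a fun x hx => hd x (s.sameCycle_tail.trans hx)).trans s.sameCycle_tail.symm
    | head => simpa using hd _ (.refl _ _)
    | old d => exact key d hd
  · intro d hd
    rw [hsink] at hd
    replace hd := s.sameCycle_head.symm.trans hd
    induction d using dart_cases with
    | tail =>
      have := hbsink a (s.sameCycle_iff.1 (hd.trans s.sameCycle_tail))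
      simp [s.a_out] at this
    | head => rfl
    | old d => exact hbsink _ (s.sameCycle_iff.1 hd)
  · intro d hd
    rw [hsink]
    induction d using dart_cases with
    | tail => simpa using hd _ (.refl _ _)
    | head => rfl
    | old d =>
      refine s.sameCycle_head.trans (s.sameCycle_iff.2 ?_)
      rw [hb]
      exact hO.sink_unique d fun x hx => hd (oldDart n x) (s.sameCycle_iff.2 hx)
  · intro d d' hd1 hd2 hd1' hd2' hdd
    induction d using dart_cases with
    | tail => simp at hd1
    | head => simp [s.head, s.rot_b_in] at hd2
    | old d =>
      induction d' using dart_cases with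
      | tail => simp at hd1'
      | head => simp [s.head, s.rot_b_in] at hd2'
      | old d' =>
        rw [s.rot_old_snd] at hd2 hd2'
        rw [hO.turn_inj d d' hd1 hd2 hd1' hd2' (s.sameCycle_iff.1 hdd)]
  -- The new tail is a peak. The only peak of the face that was cut is `dartFlip n b`, which is now
  -- on the other side of the new edge.
  · have key : ∀ d, d.2 = true → (O'.facePerm (oldDart n d)).2 = false →
        ¬ O'.facePerm.SameCycle (newTail n) (oldDart n d) := by
      intro d hd1 hd2 hdd
      rw [s.facePerm_old_snd] at hd2
      have h1 : dartFlip n b = d := by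
        refine hO.peak_inj _ _ (by simp [s.b_in]) ?_ hd1 hd2
          (hface.symm.trans (s.sameCycle_face_tail hface hdd))
        rw [facePerm_apply, dartFlip_dartFlip, s.rot_b_in]
      rw [← h1] at hdd
      exact s.not_sameCycle_face hface hdd
    intro d d' hd1 hd2 hd1' hd2' hdd
    induction d using dart_cases with
    | tail =>
      induction d' using dart_cases with
      | tail => rfl
      | head => simp at hd1'
      | old d' => exact absurd hdd (key d' hd1' hd2')
    | head => simp at hd1
    | old d =>
      induction d' using dart_cases with
      | tail => exact absurd hdd.symm (key d hd1 hd2)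
      | head => simp at hd1'
      | old d' =>
        rw [s.facePerm_old_snd] at hd2 hd2'
        rw [hO.peak_inj d d' hd1 hd2 hd1' hd2' (s.sameCycle_face hface hdd)]

end LStep
end PlaneMap

/-! ### Deleting the last edge of the left border -/

namespace PlaneMap

variable {n : ℕ}

theorem Good.leftWalk_last {O : PlaneMap n} (hO : O.Good) {d : Dart n} (hd : O.sinkDart = d) :
    ∃ k, O.leftOuterDegree = k + 1 ∧ O.leftWalk k = dartFlip n d ∧
      ∀ j < k, (O.leftWalk j).2 = true ∧ O.leftWalk j ≠ dartFlip n d := by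
  obtain ⟨h, hh⟩ := hO.height
  have hr := hh.run_leftOuterDegree
  obtain ⟨k, hk⟩ := Nat.exists_eq_succ_of_ne_zero hh.leftOuterDegree_pos.ne'
  have h1 : O.leftWalk k = dartFlip n d := by
    rw [← hd, dartFlip_sinkDart, hk, Nat.succ_sub_one]
  refine ⟨k, hk, h1, fun j hj => ⟨hr.up j (by omega), fun heq => ?_⟩⟩
  have := hr.height_lt hh hj (by omega)
  simp only [leftWalk] at heq h1
  simp [heq, h1] at this

theorem Good.leftWalk_inj {O : PlaneMap n} (hO : O.Good) {i j : ℕ} (hi : i < O.leftOuterDegree)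
    (hj : j < O.leftOuterDegree) (hij : O.leftWalk i = O.leftWalk j) : i = j := by
  obtain ⟨h, hh⟩ := hO.height
  have hr := hh.run_leftOuterDegree
  simp only [leftWalk] at hij
  by_contra hne
  rcases Nat.lt_or_gt_of_ne hne with hlt | hlt
  · have := hr.height_lt hh hlt hj.le
    simp [hij] at this
  · have := hr.height_lt hh hlt hi.le
    simp [hij] at this

namespace LStep

variable {O : PlaneMap n} {O' : PlaneMap (n + 1)} {a b : Dart n}

/-- Deletion merges the faces on both sides of the edge, so an invariant function descends as soon
as it agrees on these two faces. -/
theorem restrict_facePerm (s : LStep O O' a b) {γ : Type*} {c : Dart (n + 1) → γ}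
    (hc : ∀ x, c (O'.facePerm x) = c x) (hnew : c (newTail n) = c (newHead n)) (x : Dart n) :
    c (oldDart n (O.facePerm x)) = c (oldDart n x) := by
  by_cases h1 : x = dartFlip n b
  · subst h1
    rw [← hc (oldDart n (dartFlip n b)), s.facePerm_flip_b, ← hnew, ← hc (newTail n),
      s.facePerm_tail, facePerm_apply, dartFlip_dartFlip]
  by_cases h2 : O.facePerm x = a
  · rw [h2, ← s.facePerm_head, hc, ← hnew, ← hc (oldDart n x), s.facePerm_before_tail h2]
  · rw [← s.facePerm_old h1 h2, hc]

/-- By `hsink` the left border of `O'` ends with the new edge. The part before it is a forward walk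
in `O`, whose next dart in `O` is `a`. -/
theorem exists_leftWalk_eq (s : LStep O O' a b) (hO' : O'.Good) (hsink : O'.sinkDart = newHead n)
    (hroot : O'.root = newEdge n ∧ a = (O.root, true) ∨ O'.root = O.root.castSucc) :
    ∃ k, a = O.leftWalk k ∧ (∀ j < k, (O.leftWalk j).2 = true) ∧
      O'.root = if k = 0 then newEdge n else O.root.castSucc := by
  obtain ⟨k, hk, hlast, hlt⟩ := hO'.leftWalk_last hsink
  rcases hroot with ⟨h1, h2⟩ | h1
  · exact ⟨0, h2, by simp, by simp [h1]⟩
  have hk0 : k ≠ 0 := by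
    rintro rfl
    rw [leftWalk_zero, h1, ← oldDart_mk] at hlast
    exact oldDart_ne_new _ _ hlast
  have hold : ∀ j < k, O'.leftWalk j = oldDart n (O.leftWalk j) := by
    intro j hj
    induction j with
    | zero => rw [leftWalk_zero, h1, leftWalk_zero, oldDart_mk]
    | succ j ih =>
      have h2 := hlt _ hj
      rw [leftWalk_succ, ih (by omega)] at h2 ⊢
      rw [s.facePerm_old, leftWalk_succ]
      · intro h
        rw [h, s.facePerm_flip_b] at h2
        simp at h2
      · intro h
        rw [s.facePerm_before_tail h] at h2
        simp at h2
  obtain ⟨m, rfl⟩ := Nat.exists_eq_succ_of_ne_zero hk0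
  refine ⟨m + 1, ?_, fun j hj => ?_, by simp [h1]⟩
  · rw [Nat.succ_eq_add_one, leftWalk_succ, hold m (by omega)] at hlast
    by_contra hne
    rw [leftWalk_succ] at hne
    by_cases h2 : O.leftWalk m = dartFlip n b
    · rw [h2, s.facePerm_flip_b] at hlast
      simp at hlast
    · rw [s.facePerm_old h2 (Ne.symm hne)] at hlast
      exact oldDart_ne_new _ _ hlast
  · have := (hlt j hj).1
    rwa [hold j hj, oldDart_snd] at this

/-- The face on the right of the new edge has the single peak `dartFlip n b`. The forward run from
`a` stays in this face and stops at a peak, hence at that one. It avoids the new tail, which would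
be a second peak there. -/
theorem exists_run_a (s : LStep O O' a b) (hO' : O'.Good) :
    ∃ ℓ, (∀ j ≤ ℓ, ((O.facePerm ^ j) a).2 = true) ∧ (O.facePerm ^ ℓ) a = dartFlip n b := by
  obtain ⟨h, hh⟩ := hO'.height
  obtain ⟨ℓ, hr⟩ := exists_run hh (d := oldDart n a) s.a_out
  have hcycle : ∀ j, O'.facePerm.SameCycle ((O'.facePerm ^ j) (oldDart n a))
      (oldDart n (dartFlip n b)) := by
    intro j
    have h1 : O'.facePerm.SameCycle ((O'.facePerm ^ j) (oldDart n a)) (oldDart n a) :=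
      Perm.SameCycle.symm ⟨j, by simp⟩
    refine h1.trans ?_
    rw [← s.facePerm_head, Perm.sameCycle_apply_left, ← s.facePerm_flip_b,
      Perm.sameCycle_apply_left]
  have hpeak : ∀ x, x.2 = true → (O'.facePerm x).2 = false →
      O'.facePerm.SameCycle x (oldDart n (dartFlip n b)) → x = oldDart n (dartFlip n b) := by
    intro x h1 h2 h3
    exact hO'.peak_inj _ _ h1 h2 (by simp [s.b_in]) (by rw [s.facePerm_flip_b]) h3
  have hne : ∀ j, (O'.facePerm ^ j) (oldDart n a) ≠ newTail n := by
    intro j hj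
    have h1 := hcycle j
    rw [hj] at h1
    exact new_ne_oldDart _ _
      (hpeak _ rfl (by rw [s.facePerm_tail, oldDart_snd, s.rot_b_in]) h1)
  have hold : ∀ j ≤ ℓ, (O'.facePerm ^ j) (oldDart n a) = oldDart n ((O.facePerm ^ j) a) := by
    intro j hj
    induction j with
    | zero => rfl
    | succ j ih =>
      have h2 := hr.up (j + 1) (by omega)
      have h3 := hne (j + 1)
      rw [facePerm_pow_succ, ih (by omega)] at h2 h3 ⊢
      rw [s.facePerm_old, facePerm_pow_succ]
      · intro h
        rw [h, s.facePerm_flip_b] at h2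
        simp at h2
      · intro h
        exact h3 (s.facePerm_before_tail h)
  refine ⟨ℓ, fun j hj => ?_, ?_⟩
  · have := hr.up j (by omega)
    rwa [hold j hj, oldDart_snd] at this
  · have h1 := hpeak _ (hr.up ℓ (by omega)) (by rw [← facePerm_pow_succ]; exact hr.down) (hcycle ℓ)
    rw [hold ℓ le_rfl] at h1
    exact (oldDart n).injective h1

theorem of_good (s : LStep O O' a b) (hO' : O'.Good) (hsink : O'.sinkDart = newHead n)
    (hroot : O'.root = newEdge n ∧ a = (O.root, true) ∨ O'.root = O.root.castSucc) :
    O.Good ∧ ∃ k < O.leftOuterDegree, a = O.leftWalk k ∧ b = O.sinkDart ∧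
      O'.root = if k = 0 then newEdge n else O.root.castSucc := by
  obtain ⟨k, ha, hup, hroot'⟩ := s.exists_leftWalk_eq hO' hsink hroot
  obtain ⟨ℓ, hup', hb⟩ := s.exists_run_a hO'
  have hadd : ∀ j, O.leftWalk (k + j) = (O.facePerm ^ j) a := by
    intro j
    rw [ha, leftWalk, leftWalk, ← Perm.mul_apply, ← pow_add, add_comm]
  -- The left border of `O` is the walk of length `k` up to `a`, followed by the run from `a` that
  -- ends with `dartFlip n b`.
  have hdeg : O.leftOuterDegree = k + ℓ + 1 := by
    refine Run.leftOuterDegree ⟨fun j hj => ?_, ?_⟩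
    · rcases lt_or_ge j k with h1 | h1
      · exact hup j h1
      · obtain ⟨i, rfl⟩ := Nat.exists_eq_add_of_le h1
        have := hup' i (by omega)
        rwa [← hadd] at this
    · change (O.leftWalk (k + (ℓ + 1))).2 = false
      rw [hadd, facePerm_pow_succ, hb, facePerm_apply, dartFlip_dartFlip, s.rot_b_in]
  have hbs : b = O.sinkDart := by
    rw [sinkDart, hdeg, Nat.add_sub_cancel, hadd, hb, dartFlip_dartFlip]
  refine ⟨?_, k, by omega, ha, hbs, hroot'⟩
  have hsr := s.sameCycle_root ha hroot'
  obtain ⟨h, hh⟩ := hO'.height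
  constructor
  · exact ⟨fun x => h (oldDart n x), s.restrict_rot hh.rot, fun e => hh.lt e.castSucc⟩
  · intro d hd
    exact hO'.source (oldDart n d) (hsr.trans (s.sameCycle_iff.2 hd))
  · intro d hd
    refine s.sameCycle_iff.1 (hsr.symm.trans (hO'.source_unique (oldDart n d) fun x hx => ?_))
    induction x using dart_cases with
    | tail => rfl
    | head =>
      have := hd b (s.sameCycle_iff.1 (hx.trans s.sameCycle_head))
      simp [s.b_in] at this
    | old x => exact hd x (s.sameCycle_iff.1 hx)
  · intro d hd
    rw [← hbs] at hd
    refine hO'.sink (oldDart n d) ?_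
    rw [hsink]
    exact s.sameCycle_head.trans (s.sameCycle_iff.2 hd)
  · intro d hd
    rw [← hbs]
    refine s.sameCycle_iff.1 (s.sameCycle_head.symm.trans ?_)
    rw [← hsink]
    refine hO'.sink_unique (oldDart n d) fun x hx => ?_
    induction x using dart_cases with
    | tail =>
      have := hd a (s.sameCycle_iff.1 (hx.trans s.sameCycle_tail))
      simp [s.a_out] at this
    | head => rfl
    | old x => exact hd x (s.sameCycle_iff.1 hx)
  · intro d d' h1 h2 h1' h2' hdd
    rw [← s.rot_old_snd] at h2 h2'
    exact (oldDart n).injective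
      (hO'.turn_inj (oldDart n d) (oldDart n d') h1 h2 h1' h2' (s.sameCycle_iff.2 hdd))
  · intro d d' h1 h2 h1' h2' hdd
    classical
    rw [← s.facePerm_old_snd] at h2 h2'
    have hne : ∀ d, d.2 = true → (O'.facePerm (oldDart n d)).2 = false →
        O'.faceOf (oldDart n d) ≠ O'.faceOf (newTail n) := by
      intro d h1 h2 h3
      refine oldDart_ne_new _ _ (hO'.peak_inj _ _ h1 h2 rfl ?_ (faceOf_eq_iff.1 h3))
      rw [s.facePerm_tail, oldDart_snd, s.rot_b_in]
    -- Giving the face of the new tail the name of the face of the new head yields an invariant of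
    -- the faces of `O`. Old peaks are not in the face of the new tail, which is itself a peak, so
    -- for them the renaming has no effect.
    have := hdd.eq_of_invariant
      (c := fun x => if O'.faceOf (oldDart n x) = O'.faceOf (newTail n) then O'.faceOf (newHead n)
        else O'.faceOf (oldDart n x))
      (s.restrict_facePerm (c := fun x =>
        if O'.faceOf x = O'.faceOf (newTail n) then O'.faceOf (newHead n) else O'.faceOf x)
        (fun x => by simp only [faceOf_facePerm]) (by simp))
    rw [if_neg (hne d h1 h2), if_neg (hne d' h1' h2')] at this
    exact (oldDart n).injective (hO'.peak_inj _ _ h1 h2 h1' h2' (faceOf_eq_iff.1 this))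

end LStep

end PlaneMap

namespace PlaneMap

variable {n : ℕ}

/-! ### Splitting the sink -/

/-- `O'` is obtained from `O` by splitting the vertex of `b` into an end of a new edge, which
keeps the darts from the one after `b` to the one before `c`, and the origin of the new edge, which
receives the darts from `c` to `b`. -/
structure RStep (O : PlaneMap n) (O' : PlaneMap (n + 1)) (b c : Dart n) : Prop where
  tail : O'.rot (newTail n) = oldDart n c
  before_tail : O'.rot (oldDart n b) = newTail n
  head : O.rot b ≠ c → O'.rot (newHead n) = oldDart n (O.rot b)
  head_of_eq : O.rot b = c → O'.rot (newHead n) = newHead n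
  before_head : ∀ x, x ≠ b → O.rot x = c → O'.rot (oldDart n x) = newHead n
  old : ∀ x, x ≠ b → O.rot x ≠ c → O'.rot (oldDart n x) = oldDart n (O.rot x)
  b_in : b.2 = false
  c_in : c.2 = false
  rot_b_in : (O.rot b).2 = false

theorem RStep.of_rot {O : PlaneMap n} {O' : PlaneMap (n + 1)} {b c : Dart n}
    (h : O'.rot = swap (oldDart n c) (newHead n) * O.extRot * swap (oldDart n b) (newHead n) *
      swap (oldDart n b) (newTail n))
    (hb : b.2 = false) (hc : c.2 = false) (hb' : (O.rot b).2 = false) : RStep O O' b c := by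
  have h1 : newHead n ≠ newTail n := by simp
  refine ⟨?_, ?_, ?_, ?_, ?_, ?_, hb, hc, hb'⟩
  · rw [h]
    simp
  · rw [h]
    simp [swap_apply_of_ne_of_ne]
  · intro hne
    rw [h]
    simp [swap_apply_of_ne_of_ne, hne]
  · rintro rfl
    rw [h]
    simp [swap_apply_of_ne_of_ne]
  · rintro x hx rfl
    rw [h]
    simp [swap_apply_of_ne_of_ne, hx]
  · intro x hx hx'
    rw [h]
    simp [swap_apply_of_ne_of_ne, hx, hx']

namespace RStep

variable {O : PlaneMap n} {O' : PlaneMap (n + 1)} {b c : Dart n}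

/-- Contracting the new edge merges its two ends into the vertex of `b`. Functions on the vertices
of `O` pull back, whereas `restrict_rot` must ask for equal values at both ends. -/
theorem extend_rot (s : RStep O O' b c) {γ : Type*} {f : Dart n → γ}
    (hf : ∀ x, f (O.rot x) = f x) (hbc : f c = f b) (x : Dart (n + 1)) :
    extendDart f (f b) (f b) (O'.rot x) = extendDart f (f b) (f b) x := by
  induction x using dart_cases with
  | tail => simp [s.tail, hbc]
  | head =>
    by_cases h : O.rot b = c
    · rw [s.head_of_eq h]
    · simp [s.head h, hf]
  | old x =>
    by_cases h1 : x = b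
    · subst h1
      simp [s.before_tail]
    by_cases h2 : O.rot x = c
    · simp [s.before_head x h1 h2, ← hbc, ← h2, hf]
    · simp [s.old x h1 h2, hf]

theorem restrict_rot (s : RStep O O' b c) {γ : Type*} {f : Dart (n + 1) → γ}
    (hf : ∀ x, f (O'.rot x) = f x) (hnew : f (newTail n) = f (newHead n)) (x : Dart n) :
    f (oldDart n (O.rot x)) = f (oldDart n x) := by
  by_cases h1 : x = b
  · subst h1
    by_cases h : O.rot x = c
    · rw [h, ← s.tail, hf, ← s.before_tail, hf]
    · rw [← s.head h, hf, ← hnew, ← s.before_tail, hf]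
  by_cases h2 : O.rot x = c
  · rw [h2, ← s.tail, hf, hnew, ← s.before_head x h1 h2, hf]
  · rw [← s.old x h1 h2, hf]

theorem sameCycle_of (s : RStep O O' b c) (hbc : O.rot.SameCycle b c) {x y : Dart (n + 1)}
    (h : O'.rot.SameCycle x y) :
    O.rot.SameCycle (extendDart id b b x) (extendDart id b b y) := by
  have h1 : ∀ x, extendDart O.vertexOf (O.vertexOf b) (O.vertexOf b) x =
      O.vertexOf (extendDart id b b x) := by
    intro x
    induction x using dart_cases <;> simp
  have := h.eq_of_invariant (s.extend_rot O.vertexOf_rot (vertexOf_eq_iff.2 hbc.symm))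
  rwa [h1, h1, vertexOf_eq_iff] at this

/-- The vertices not incident to the new edge are unchanged. Identifying the vertex of the new head
with that of the new tail gives an invariant of the vertices of `O`. -/
theorem sameCycle_old (s : RStep O O' b c) {x y : Dart n} (h : O.rot.SameCycle x y)
    (ht : ¬ O'.rot.SameCycle (newTail n) (oldDart n x))
    (hh : ¬ O'.rot.SameCycle (newHead n) (oldDart n x)) :
    O'.rot.SameCycle (oldDart n x) (oldDart n y) := by
  classical
  have := h.eq_of_invariant
    (c := fun x => if O'.vertexOf (oldDart n x) = O'.vertexOf (newHead n) then
      O'.vertexOf (newTail n) else O'.vertexOf (oldDart n x))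
    (s.restrict_rot (f := fun x => if O'.vertexOf x = O'.vertexOf (newHead n) then
      O'.vertexOf (newTail n) else O'.vertexOf x)
      (fun x => by simp only [vertexOf_rot]) (by simp))
  rw [← vertexOf_eq_iff] at ht hh ⊢
  rw [if_neg (Ne.symm hh)] at this
  split_ifs at this with h1
  · exact absurd this.symm ht
  · exact this

theorem sameCycle_tail (s : RStep O O' b c) : O'.rot.SameCycle (newTail n) (oldDart n b) := by
  rw [← s.before_tail, Perm.sameCycle_apply_left]

theorem rot_old_snd (s : RStep O O' b c) {x : Dart n} (hx : x ≠ b) :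
    (O'.rot (oldDart n x)).2 = (O.rot x).2 := by
  by_cases h2 : O.rot x = c
  · rw [s.before_head x hx h2, h2, s.c_in]
  · rw [s.old x hx h2, oldDart_snd]

theorem rot_head_snd (s : RStep O O' b c) : (O'.rot (newHead n)).2 = false := by
  by_cases h : O.rot b = c
  · rw [s.head_of_eq h]
  · rw [s.head h, oldDart_snd, s.rot_b_in]

/-! #### Faces -/

theorem facePerm_head (s : RStep O O' b c) : O'.facePerm (newHead n) = oldDart n c := s.tail

theorem facePerm_flip_b (s : RStep O O' b c) :
    O'.facePerm (oldDart n (dartFlip n b)) = newTail n := by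
  rw [facePerm_apply, dartFlip_oldDart, dartFlip_dartFlip, s.before_tail]

theorem facePerm_before_head (s : RStep O O' b c) {x : Dart n} (hx : x ≠ dartFlip n b)
    (hx' : O.facePerm x = c) : O'.facePerm (oldDart n x) = newHead n :=
  s.before_head _ (fun h => hx (dartFlip_eq_iff.1 h)) hx'

theorem facePerm_old (s : RStep O O' b c) {x : Dart n} (hx : x ≠ dartFlip n b)
    (hx' : O.facePerm x ≠ c) : O'.facePerm (oldDart n x) = oldDart n (O.facePerm x) :=
  s.old _ (fun h => hx (dartFlip_eq_iff.1 h)) hx'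

theorem facePerm_old_snd (s : RStep O O' b c) {x : Dart n} (hx : x ≠ dartFlip n b) :
    (O'.facePerm (oldDart n x)).2 = (O.facePerm x).2 :=
  s.rot_old_snd (fun h => hx (dartFlip_eq_iff.1 h))

/-- A split creates no face: the new tail is inserted in the face just after `dartFlip n b`, and the
new head in the face just before `c`. Hence the faces correspond exactly. -/
theorem extend_facePerm (s : RStep O O' b c) {γ : Type*} {f : Dart n → γ}
    (hf : ∀ x, f (O.facePerm x) = f x) (x : Dart (n + 1)) :
    extendDart f (f (dartFlip n b)) (f c) (O'.facePerm x) =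
      extendDart f (f (dartFlip n b)) (f c) x := by
  have hb : f (O.rot b) = f (dartFlip n b) := by
    rw [← hf (dartFlip n b), facePerm_apply, dartFlip_dartFlip]
  induction x using dart_cases with
  | tail =>
    change extendDart f _ _ (O'.rot (newHead n)) = _
    by_cases h : O.rot b = c
    · simp [s.head_of_eq h, ← h, hb]
    · simp [s.head h, hb]
  | head => simp [s.facePerm_head]
  | old x =>
    by_cases h1 : x = dartFlip n b
    · subst h1
      simp [s.facePerm_flip_b]
    by_cases h2 : O.facePerm x = c
    · simp [s.facePerm_before_head h1 h2, ← h2, hf]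
    · simp [s.facePerm_old h1 h2, hf]

theorem restrict_facePerm (s : RStep O O' b c) {γ : Type*} {f : Dart (n + 1) → γ}
    (hf : ∀ x, f (O'.facePerm x) = f x) (x : Dart n) :
    f (oldDart n (O.facePerm x)) = f (oldDart n x) := by
  by_cases h1 : x = dartFlip n b
  · subst h1
    have h2 : f (O'.rot (newHead n)) = f (oldDart n (dartFlip n b)) := by
      rw [← hf (oldDart n _), s.facePerm_flip_b, ← hf (newTail n)]
      rfl
    rw [facePerm_apply, dartFlip_dartFlip]
    by_cases h : O.rot b = c
    · rw [← h2, s.head_of_eq h, ← hf (newHead n), s.facePerm_head, h]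
    · rw [← h2, s.head h]
  by_cases h2 : O.facePerm x = c
  · rw [h2, ← s.facePerm_head, hf, ← s.facePerm_before_head h1 h2, hf]
  · rw [← s.facePerm_old h1 h2, hf]

theorem sameCycle_face_iff (s : RStep O O' b c) {x y : Dart n} :
    O'.facePerm.SameCycle (oldDart n x) (oldDart n y) ↔ O.facePerm.SameCycle x y := by
  constructor
  · intro h
    simpa [faceOf_eq_iff] using h.eq_of_invariant (s.extend_facePerm O.faceOf_facePerm)
  · intro h
    simpa [faceOf_eq_iff] using h.eq_of_invariant (c := fun x => O'.faceOf (oldDart n x))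
      (s.restrict_facePerm O'.faceOf_facePerm)

theorem sameCycle_face_tail (s : RStep O O' b c) :
    O'.facePerm.SameCycle (newTail n) (oldDart n (dartFlip n b)) := by
  rw [← s.facePerm_flip_b, Perm.sameCycle_apply_left]

/-- The peak `dartFlip n b` moves one edge further, to the new tail, inside the same face; the other
peaks are the same in both maps. -/
theorem peak_inj_iff (s : RStep O O' b c) :
    (∀ d d', d.2 = true → (O'.facePerm d).2 = false → d'.2 = true →
      (O'.facePerm d').2 = false → O'.facePerm.SameCycle d d' → d = d') ↔
    (∀ d d', d.2 = true → (O.facePerm d).2 = false → d'.2 = true →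
      (O.facePerm d').2 = false → O.facePerm.SameCycle d d' → d = d') := by
  have hbt : (dartFlip n b).2 = true := by simp [s.b_in]
  have hbf : (O.facePerm (dartFlip n b)).2 = false := by
    rw [facePerm_apply, dartFlip_dartFlip, s.rot_b_in]
  have hnf : (O'.facePerm (newTail n)).2 = false := s.rot_head_snd
  constructor
  · intro H d d' h1 h2 h1' h2' hdd
    by_cases hd : d = dartFlip n b <;> by_cases hd' : d' = dartFlip n b
    · rw [hd, hd']
    · subst hd
      rw [← s.facePerm_old_snd hd'] at h2'
      exact absurd (H _ _ rfl hnf h1' h2'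
        (s.sameCycle_face_tail.trans (s.sameCycle_face_iff.2 hdd))) (new_ne_oldDart _ _)
    · subst hd'
      rw [← s.facePerm_old_snd hd] at h2
      exact absurd (H _ _ h1 h2 rfl hnf
        ((s.sameCycle_face_iff.2 hdd).trans s.sameCycle_face_tail.symm)) (oldDart_ne_new _ _)
    · rw [← s.facePerm_old_snd hd] at h2
      rw [← s.facePerm_old_snd hd'] at h2'
      exact (oldDart n).injective
        (H (oldDart n d) (oldDart n d') h1 h2 h1' h2' (s.sameCycle_face_iff.2 hdd))
  · intro H
    have hold : ∀ d : Dart n, (O'.facePerm (oldDart n d)).2 = false → d ≠ dartFlip n b := by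
      rintro d h rfl
      rw [s.facePerm_flip_b] at h
      simp at h
    have key : ∀ d, d.2 = true → (O'.facePerm (oldDart n d)).2 = false →
        ¬ O'.facePerm.SameCycle (newTail n) (oldDart n d) := by
      intro d h1 h2 hdd
      have hd := hold d h2
      rw [s.facePerm_old_snd hd] at h2
      exact hd (H _ _ h1 h2 hbt hbf
        (s.sameCycle_face_iff.1 (hdd.symm.trans s.sameCycle_face_tail)))
    intro d d' h1 h2 h1' h2' hdd
    induction d using dart_cases with
    | tail =>
      induction d' using dart_cases with
      | tail => rfl
      | head => simp at h1'
      | old d' => exact absurd hdd (key d' h1' h2')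
    | head => simp at h1
    | old d =>
      induction d' using dart_cases with
      | tail => exact absurd hdd.symm (key d h1 h2)
      | head => simp at h1'
      | old d' =>
        rw [s.facePerm_old_snd (hold d h2)] at h2
        rw [s.facePerm_old_snd (hold d' h2')] at h2'
        rw [H d d' h1 h2 h1' h2' (s.sameCycle_face_iff.1 hdd)]

/-! #### Orientations with a split sink -/

theorem leftWalk_eq (s : RStep O O' b c) (hO : O.Good) (hb : b = O.sinkDart)
    (hroot : O'.root = O.root.castSucc) :
    (∀ j < O.leftOuterDegree, O'.leftWalk j = oldDart n (O.leftWalk j)) ∧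
      O'.leftWalk O.leftOuterDegree = newTail n := by
  obtain ⟨k, hk, hlast, hlt⟩ := hO.leftWalk_last hb.symm
  have hold : ∀ j < O.leftOuterDegree, O'.leftWalk j = oldDart n (O.leftWalk j) := by
    intro j hj
    induction j with
    | zero => simp [hroot, oldDart_mk]
    | succ j ih =>
      obtain ⟨h, hh⟩ := hO.height
      have hup := hh.run_leftOuterDegree.up (j + 1) hj
      change (O.leftWalk (j + 1)).2 = true at hup
      rw [leftWalk_succ, ih (by omega), s.facePerm_old, leftWalk_succ]
      · exact (hlt j (by omega)).2
      · rintro h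
        rw [leftWalk_succ, h, s.c_in] at hup
        simp at hup
  refine ⟨hold, ?_⟩
  rw [hk, leftWalk_succ, hold k (by omega), hlast, s.facePerm_flip_b]

theorem run (s : RStep O O' b c) (hO : O.Good) (hb : b = O.sinkDart)
    (hroot : O'.root = O.root.castSucc) : O'.Run (O'.root, true) (O.leftOuterDegree + 1) := by
  obtain ⟨h1, h2⟩ := s.leftWalk_eq hO hb hroot
  obtain ⟨h, hh⟩ := hO.height
  constructor
  · intro j hj
    change (O'.leftWalk j).2 = true
    rcases (Nat.lt_succ_iff.1 hj).lt_or_eq with h3 | rfl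
    · rw [h1 j h3, oldDart_snd]
      exact hh.run_leftOuterDegree.up j (by omega)
    · rw [h2]
  · change (O'.leftWalk (O.leftOuterDegree + 1)).2 = false
    rw [leftWalk_succ, h2]
    exact s.rot_head_snd

theorem sinkDart_eq (s : RStep O O' b c) (hO : O.Good) (hb : b = O.sinkDart)
    (hroot : O'.root = O.root.castSucc) : O'.sinkDart = newHead n := by
  rw [sinkDart, (s.run hO hb hroot).leftOuterDegree, Nat.add_sub_cancel,
    (s.leftWalk_eq hO hb hroot).2]
  rfl

/-- The segment from `c` to `b` becomes the new vertex and keeps its height, while what remains of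
the old sink is raised by one. This is harmless because no edge leaves the sink. -/
theorem exists_isHeight (s : RStep O O' b c) {h : Dart n → ℕ} (hh : O.IsHeight h)
    (hbc : O.rot.SameCycle b c) (hsink : ∀ d, O.rot.SameCycle b d → d.2 = false) :
    ∃ h', O'.IsHeight h' ∧ h' (newTail n) < h' (newHead n) := by
  classical
  obtain ⟨S, hb, hc, hS, h1, h2, h3, h4⟩ := hbc.symm.exists_segment
  have hcb := hh.sameCycle hbc
  refine ⟨extendDart (fun x => if O.rot.SameCycle b x ∧ x ∉ S then h b + 1 else h x) (h b)
    (h b + 1), ⟨fun x => ?_, fun e => ?_⟩, by simp⟩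
  · induction x using dart_cases with
    | tail => simp [s.tail, hc, hcb]
    | head =>
      by_cases h : O.rot b = c
      · rw [s.head_of_eq h]
      · have h5 : O.rot b ∉ S := fun h6 => h (h3 h6)
        simp [s.head h, h5, Perm.SameCycle.refl]
    | old x =>
      by_cases hx : x = b
      · subst hx
        simp [s.before_tail, hb]
      by_cases hx' : O.rot x = c
      · have h5 : x ∉ S := fun h6 => hx (h4 x h6 hx')
        have h6 : O.rot.SameCycle b x := by rwa [← Perm.sameCycle_apply_right, hx']
        simp [s.before_head x hx hx', h5, h6]
      · have h5 : O.rot x ∈ S ↔ x ∈ S := ⟨fun h => h2 x h hx', h1 x hx⟩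
        simp [s.old x hx hx', h5, hh.rot]
  · induction e using Fin.lastCases with
    | last => simp
    | cast e =>
      have ht : ¬ O.rot.SameCycle b (e, true) := fun h => by simpa using hsink _ h
      have := hh.lt e
      simp only [← oldDart_mk, extendDart_old, ht, false_and, if_false]
      split_ifs with h5
      · have := hh.sameCycle h5.1
        omega
      · exact this

theorem good (s : RStep O O' b c) (hO : O.Good) (hbc : O.rot.SameCycle b c) (hb : b = O.sinkDart)
    (hroot : O'.root = O.root.castSucc) : O'.Good := by
  have hsink := s.sinkDart_eq hO hb hroot
  have hbsink : ∀ d, O.rot.SameCycle b d → d.2 = false := by rw [hb]; exact hO.sink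
  obtain ⟨h, hh⟩ := hO.height
  obtain ⟨h', hh', hlt⟩ := s.exists_isHeight hh hbc hbsink
  have hroot' : (O'.root, true) = oldDart n (O.root, true) := by rw [hroot, oldDart_mk]
  have hnotb : ∀ d : Dart n, ¬ O.rot.SameCycle b d →
      ∀ x, O.rot.SameCycle d x → O'.rot.SameCycle (oldDart n d) (oldDart n x) := by
    intro d hd x hx
    refine s.sameCycle_old hx (fun h => hd ?_) (fun h => hd ?_)
    · simpa using s.sameCycle_of hbc h
    · simpa using s.sameCycle_of hbc h
  constructor
  · exact ⟨h', hh'⟩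
  · intro d hd
    replace hd := s.sameCycle_of hbc hd
    rw [hroot', extendDart_old] at hd
    induction d using dart_cases with
    | tail => rfl
    | head =>
      have := hO.source _ hd
      simp [s.b_in] at this
    | old d => exact hO.source d (by simpa using hd)
  · intro d hd
    induction d using dart_cases with
    | tail =>
      have := hd (oldDart n b) s.sameCycle_tail
      simp [s.b_in] at this
    | head => simpa using hd _ (.refl _ _)
    | old d =>
      have hdb : ¬ O.rot.SameCycle b d := fun h => by
        have h1 := hbsink _ h
        have h2 := hd _ (.refl _ _)
        rw [oldDart_snd, h1] at h2
        simp at h2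
      rw [hroot']
      exact (hnotb d hdb _ (hO.source_unique d fun x hx => hd _ (hnotb d hdb x hx)).symm).symm
  · intro d hd
    rw [hsink] at hd
    induction d using dart_cases with
    | tail =>
      have := hh'.sameCycle hd
      omega
    | head => rfl
    | old d =>
      have := s.sameCycle_of hbc hd
      rw [extendDart_head, extendDart_old] at this
      exact hbsink d this
  · intro d hd
    rw [hsink]
    induction d using dart_cases with
    | tail => simpa using hd _ (.refl _ _)
    | head => rfl
    | old d =>
      -- An old dart at a second sink of `O'` would be at a sink of `O` as well, hence at the vertex
      -- of `b`; but `b` is now at the origin of the new edge.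
      by_contra hne
      have ht : ¬ O'.rot.SameCycle (newTail n) (oldDart n d) := fun h => by
        simpa using hd _ h.symm
      have h1 := hO.sink_unique d fun x hx => hd (oldDart n x) (s.sameCycle_old hx ht hne)
      rw [← hb] at h1
      exact ht (s.sameCycle_tail.trans (s.sameCycle_old h1.symm ht hne).symm)
  -- The only turn created is `b`, followed by the new tail. The old sink has no outgoing dart, so
  -- no other turn comes from it.
  · have key : ∀ d : Dart n, d ≠ b → (O'.rot (oldDart n d)).2 = true →
        ¬ O'.rot.SameCycle (oldDart n b) (oldDart n d) := by
      intro d hd hd2 hdd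
      rw [s.rot_old_snd hd] at hd2
      have h1 := s.sameCycle_of hbc hdd
      rw [extendDart_old, extendDart_old, id, id, ← Perm.sameCycle_apply_right] at h1
      simp [hbsink _ h1] at hd2
    intro d d' hd1 hd2 hd1' hd2' hdd
    induction d using dart_cases with
    | tail => simp at hd1
    | head => simp [s.rot_head_snd] at hd2
    | old d =>
      induction d' using dart_cases with
      | tail => simp at hd1'
      | head => simp [s.rot_head_snd] at hd2'
      | old d' =>
        by_cases hdb : d = b <;> by_cases hdb' : d' = b
        · rw [hdb, hdb']
        · subst hdb
          exact absurd hdd (key d' hdb' hd2')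
        · subst hdb'
          exact absurd hdd.symm (key d hdb hd2)
        · rw [s.rot_old_snd hdb] at hd2
          rw [s.rot_old_snd hdb'] at hd2'
          have := s.sameCycle_of hbc hdd
          rw [hO.turn_inj d d' hd1 hd2 hd1' hd2' (by simpa using this)]
  · exact s.peak_inj_iff.2 hO.peak_inj

end RStep

end PlaneMap

/-! ### Contracting the last edge of the left border -/

namespace PlaneMap

variable {n : ℕ}

namespace RStep

variable {O : PlaneMap n} {O' : PlaneMap (n + 1)} {b c : Dart n}

theorem leftWalk_eq_of_good (s : RStep O O' b c) (hO' : O'.Good) (hsink : O'.sinkDart = newHead n)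
    (hroot : O'.root = O.root.castSucc) :
    ∃ k, O.leftOuterDegree = k + 1 ∧ O.leftWalk k = dartFlip n b := by
  obtain ⟨k, hk, hlast, hlt⟩ := hO'.leftWalk_last hsink
  have hk0 : k ≠ 0 := by
    rintro rfl
    rw [leftWalk_zero, hroot, ← oldDart_mk] at hlast
    exact oldDart_ne_new _ _ hlast
  obtain ⟨m, rfl⟩ := Nat.exists_eq_succ_of_ne_zero hk0
  have hold : ∀ j < m + 1, O'.leftWalk j = oldDart n (O.leftWalk j) := by
    intro j hj
    induction j with
    | zero => rw [leftWalk_zero, hroot, leftWalk_zero, oldDart_mk]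
    | succ j ih =>
      have h2 := hlt _ hj
      rw [leftWalk_succ, ih (by omega)] at h2 ⊢
      rw [s.facePerm_old, leftWalk_succ]
      · intro h
        rw [h, s.facePerm_flip_b] at h2
        simp at h2
      · intro h
        by_cases h3 : O.leftWalk j = dartFlip n b
        · rw [h3, s.facePerm_flip_b] at h2
          simp at h2
        · rw [s.facePerm_before_head h3 h] at h2
          simp at h2
  have hb : O.leftWalk m = dartFlip n b := by
    by_contra hne
    rw [Nat.succ_eq_add_one, leftWalk_succ, hold m (by omega)] at hlast
    by_cases h2 : O.facePerm (O.leftWalk m) = c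
    · rw [s.facePerm_before_head hne h2] at hlast
      simp at hlast
    · rw [s.facePerm_old hne h2] at hlast
      exact oldDart_ne_new _ _ hlast
  refine ⟨m, Run.leftOuterDegree ⟨fun j hj => ?_, ?_⟩, hb⟩
  · have := (hlt j hj).1
    rwa [hold j hj, oldDart_snd] at this
  · change (O.leftWalk (m + 1)).2 = false
    rw [leftWalk_succ, hb, facePerm_apply, dartFlip_dartFlip, s.rot_b_in]

/-- All the old darts at the origin of the new edge are ends. -/
theorem snd_of_sameCycle_tail (s : RStep O O' b c) (hO' : O'.Good) {x : Dart n}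
    (hx : O'.rot.SameCycle (newTail n) (oldDart n x)) : x.2 = false := by
  -- The unique turn at this vertex is from `b` to the new tail. Starting from the new tail, the
  -- rotation therefore meets only ends of edges until it is back.
  have := hx.induct (p := fun y => y = newTail n ∨ y.2 = false) (.inl rfl) fun z hz hp => by
    rcases hp with rfl | hp
    · exact .inr (by rw [s.tail, oldDart_snd, s.c_in])
    · by_cases h : (O'.rot z).2 = false
      · exact .inr h
      · refine .inl ?_
        have h1 := hO'.turn_inj z (oldDart n b) hp (by simpa using h) s.b_in
          (by rw [s.before_tail]) (hz.symm.trans s.sameCycle_tail)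
        rw [h1, s.before_tail]
  simpa using this

/-- The rotation of `O'` from the new tail to `b` copies that of `O` from `c` to `b`: before `b`,
they could only differ by meeting the new head, which is at the sink. -/
theorem sameCycle_of_good (s : RStep O O' b c) (hO' : O'.Good) (hsink : O'.sinkDart = newHead n) :
    O.rot.SameCycle b c := by
  have h1 : ∀ y, O'.rot.SameCycle (newTail n) y → y ≠ newHead n := by
    rintro _ hy rfl
    have := hO'.sink (newTail n) (by rw [hsink]; exact hy.symm)
    simp at this
  have := (s.sameCycle_tail).induct (p := fun y => ∀ x, y = oldDart n x → O.rot.SameCycle c x)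
    (fun x hx => by simp at hx) (fun z hz hp x hx => by
      have hz' := h1 _ (hz.trans (Perm.sameCycle_apply_right.2 (.refl _ _)))
      induction z using dart_cases with
      | tail =>
        rw [s.tail] at hx
        rw [(oldDart n).injective hx]
      | head => exact absurd rfl (h1 _ hz)
      | old z =>
        by_cases hzb : z = b
        · subst hzb
          rw [s.before_tail] at hx
          simp at hx
        by_cases hzc : O.rot z = c
        · exact absurd (s.before_head z hzb hzc) hz'
        · rw [s.old z hzb hzc] at hx
          rw [← (oldDart n).injective hx, Perm.sameCycle_apply_right]
          exact hp z rfl)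
  exact (this b rfl).symm

theorem of_good (s : RStep O O' b c) (hO' : O'.Good) (hsink : O'.sinkDart = newHead n)
    (hroot : O'.root = O.root.castSucc) :
    O.Good ∧ O.rot.SameCycle b c ∧ b = O.sinkDart := by
  have hbc := s.sameCycle_of_good hO' hsink
  obtain ⟨k, hk, hlast⟩ := s.leftWalk_eq_of_good hO' hsink hroot
  have hbs : b = O.sinkDart := by
    rw [sinkDart, hk, Nat.add_sub_cancel, hlast, dartFlip_dartFlip]
  refine ⟨?_, hbc, hbs⟩
  have hroot' : (O'.root, true) = oldDart n (O.root, true) := by rw [hroot, oldDart_mk]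
  have ht : ∀ x : Dart n, x.2 = true → ¬ O'.rot.SameCycle (newTail n) (oldDart n x) :=
    fun x hx h => by simp [s.snd_of_sameCycle_tail hO' h] at hx
  have hh : ∀ x : Dart n, x.2 = true → ¬ O'.rot.SameCycle (newHead n) (oldDart n x) :=
    fun x hx h => by simpa [hx] using hO'.sink (oldDart n x) (by rwa [hsink])
  have hold : ∀ {x y : Dart n}, O'.rot.SameCycle (oldDart n x) (oldDart n y) →
      O.rot.SameCycle x y := fun h => by simpa using s.sameCycle_of hbc h
  have hnotb : ∀ x : Dart n, x.2 = true → ¬ O.rot.SameCycle b x := fun x hx h =>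
    ht x hx (s.sameCycle_tail.trans (s.sameCycle_old h.symm (ht x hx) (hh x hx)).symm)
  obtain ⟨h, hH⟩ := hO'.height
  constructor
  · classical
    -- The two ends of the new edge merge into the sink of `O`, for which any height above all the
    -- others will do.
    have hM : ∀ d, h d < ∑ x, h x + 1 := fun d => Nat.lt_succ_of_le
      (Finset.single_le_sum (f := h) (fun _ _ => Nat.zero_le _) (Finset.mem_univ _))
    set f : Dart (n + 1) → ℕ := fun x => if O'.rot.SameCycle (newTail n) x ∨
      O'.rot.SameCycle (newHead n) x then ∑ x, h x + 1 else h x with hf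
    refine ⟨fun x => f (oldDart n x), s.restrict_rot (fun x => ?_)
      (by simp [hf, Perm.SameCycle.refl]), fun e => ?_⟩
    · simp only [hf, Perm.sameCycle_apply_right, hH.rot]
    · have := hH.lt e.castSucc
      have h1 : ¬ (O'.rot.SameCycle (newTail n) (oldDart n (e, true)) ∨
          O'.rot.SameCycle (newHead n) (oldDart n (e, true))) :=
        not_or.2 ⟨ht (e, true) rfl, hh (e, true) rfl⟩
      simp only [hf, if_neg h1]
      split_ifs with h2
      · exact hM _
      · exact this
  · intro d hd
    refine hO'.source (oldDart n d) ?_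
    rw [hroot']
    exact s.sameCycle_old hd (ht _ rfl) (hh _ rfl)
  · intro d hd
    have hd1 := hd d (.refl _ _)
    refine hold ?_
    rw [← hroot']
    refine hO'.source_unique (oldDart n d) fun x hx => ?_
    induction x using dart_cases with
    | tail => rfl
    | head => exact absurd hx.symm (hh d hd1)
    | old x => exact hd x (hold hx)
  · intro d hd
    rw [← hbs] at hd
    by_contra hd1
    exact hnotb d (by simpa using hd1) hd
  · intro d hd
    rw [← hbs]
    by_cases h1 : O'.rot.SameCycle (newTail n) (oldDart n d)
    · simpa using s.sameCycle_of hbc h1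
    · have h2 := hO'.sink_unique (oldDart n d) fun x hx => by
        induction x using dart_cases with
        | tail => exact absurd hx.symm h1
        | head => rfl
        | old x => exact hd x (hold hx)
      rw [hsink] at h2
      simpa using s.sameCycle_of hbc h2
  · intro d d' h1 h2 h1' h2' hdd
    have hne : ∀ d, (O.rot d).2 = true → d ≠ b := by
      rintro d h2 rfl
      simp [s.rot_b_in] at h2
    have h3 : O'.rot.SameCycle (oldDart n (O.rot d)) (oldDart n (O.rot d')) :=
      s.sameCycle_old (Perm.sameCycle_apply_left.2 (Perm.sameCycle_apply_right.2 hdd))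
        (ht _ h2) (hh _ h2)
    have h4 : ∀ d, (O.rot d).2 = true → O'.rot (oldDart n d) = oldDart n (O.rot d) :=
      fun d h2 => s.old d (hne d h2) (fun h => by simp [h, s.c_in] at h2)
    rw [← h4 d h2, ← h4 d' h2', Perm.sameCycle_apply_left, Perm.sameCycle_apply_right] at h3
    refine (oldDart n).injective (hO'.turn_inj _ _ h1 ?_ h1' ?_ h3)
    · rw [h4 d h2, oldDart_snd, h2]
    · rw [h4 d' h2', oldDart_snd, h2']
  · exact s.peak_inj_iff.1 hO'.peak_inj

end RStep

end PlaneMap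

namespace PlaneMap

variable {n : ℕ}

/-! ### Comparison with `IsPlaneBipolar` -/

instance (O : PlaneMap n) : Finite O.Vertex := Quotient.finite _

instance (O : PlaneMap n) : Finite O.Face := Quotient.finite _

theorem exists_vertexOf_eq {O : PlaneMap n} (v : O.Vertex) : ∃ d, O.vertexOf d = v :=
  Quotient.exists_rep v

theorem exists_faceOf_eq {O : PlaneMap n} (F : O.Face) : ∃ d, O.faceOf d = F :=
  Quotient.exists_rep F

theorem isSource_vertexOf {O : PlaneMap n} {d : Dart n} :
    O.IsSource (O.vertexOf d) ↔ ∀ x, O.rot.SameCycle d x → x.2 = true := by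
  constructor
  · rintro h ⟨e, b⟩ hx
    cases b
    · exact absurd (vertexOf_eq_iff.2 hx.symm) (h e)
    · rfl
  · intro h e he
    simpa using h _ (vertexOf_eq_iff.1 he).symm

theorem isSink_vertexOf {O : PlaneMap n} {d : Dart n} :
    O.IsSink (O.vertexOf d) ↔ ∀ x, O.rot.SameCycle d x → x.2 = false := by
  constructor
  · rintro h ⟨e, b⟩ hx
    cases b
    · rfl
    · exact absurd (vertexOf_eq_iff.2 hx.symm) (h e)
  · intro h e he
    simpa using h _ (vertexOf_eq_iff.1 he).symm

/-- For an acyclic orientation, a height is the number of vertices from which a nonempty directed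
path leads to the given one. -/
theorem exists_isHeight_iff {O : PlaneMap n} :
    (∃ h, O.IsHeight h) ↔ ∀ v, ¬ Relation.TransGen O.Arc v v := by
  constructor
  · rintro ⟨h, hh⟩
    have key : ∀ u v, Relation.TransGen O.Arc u v →
        ∀ d d', O.vertexOf d = u → O.vertexOf d' = v → h d < h d' := by
      intro u v huv
      induction huv with
      | single huv =>
        obtain ⟨e, rfl, rfl⟩ := huv
        intro d d' hd hd'
        rw [hh.sameCycle (vertexOf_eq_iff.1 hd), hh.sameCycle (vertexOf_eq_iff.1 hd')]
        exact hh.lt e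
      | tail _ huv ih =>
        obtain ⟨e, rfl, rfl⟩ := huv
        intro d d' hd hd'
        refine (ih d (e, true) hd rfl).trans ?_
        rw [hh.sameCycle (vertexOf_eq_iff.1 hd')]
        exact hh.lt e
    intro v hv
    obtain ⟨d, hd⟩ := exists_vertexOf_eq v
    exact lt_irrefl _ (key v v hv d d hd hd)
  · intro h
    refine ⟨fun d => Set.ncard {v | Relation.TransGen O.Arc v (O.vertexOf d)}, fun d => ?_,
      fun e => ?_⟩
    · simp only [vertexOf_rot]
    · have harc : O.Arc (O.vertexOf (e, true)) (O.vertexOf (e, false)) := ⟨e, rfl, rfl⟩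
      refine Set.ncard_lt_ncard ⟨fun v hv => ?_, fun hsub => ?_⟩
      · exact Relation.TransGen.tail hv harc
      · exact h _ (hsub (show O.vertexOf (e, true) ∈ _ from .single harc))

/-- The ends of edges that are followed by the origin of an edge. -/
def turns (O : PlaneMap n) : Set (Dart n) := {d | d.2 = false ∧ (O.rot d).2 = true}

/-- The ends of edges that are followed by the end of an edge. -/
def peaks (O : PlaneMap n) : Set (Dart n) := {d | d.2 = false ∧ (O.rot d).2 = false}

theorem ncard_turns_add_ncard_peaks (O : PlaneMap n) : O.turns.ncard + O.peaks.ncard = n := by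
  rw [← Set.ncard_union_eq]
  · have : O.turns ∪ O.peaks = (fun e : Fin n => (e, false)) '' Set.univ := by
      ext ⟨e, b⟩
      simp only [turns, peaks, Set.mem_union, Set.mem_ofPred_eq, Set.image_univ, Set.mem_range,
        Prod.mk.injEq]
      cases h : (O.rot (e, b)).2 <;> simp [eq_comm]
    rw [this, Set.ncard_image_of_injective _ (fun a b h => congrArg Prod.fst h), Set.ncard_univ,
      Nat.card_fin]
  · rw [Set.disjoint_left]
    rintro d ⟨-, h1⟩ ⟨-, h2⟩
    simp [h1] at h2

/-- The vertices that are neither a source nor a sink. -/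
def nonPolarSet (O : PlaneMap n) : Set O.Vertex := {v | ¬ O.IsSource v ∧ ¬ O.IsSink v}

theorem card_vertex {O : PlaneMap n} {s t : O.Vertex} (hs : ∀ v, O.IsSource v ↔ v = s)
    (ht : ∀ v, O.IsSink v ↔ v = t) (hst : s ≠ t) : Nat.card O.Vertex = O.nonPolar + 2 := by
  have h1 : O.nonPolarSetᶜ = {s, t} := by
    ext v
    simp only [nonPolarSet, hs, ht, Set.mem_compl_iff, Set.mem_ofPred_eq, Set.mem_insert_iff,
      Set.mem_singleton_iff]
    tauto
  rw [← Set.ncard_add_ncard_compl O.nonPolarSet, h1, Set.ncard_pair hst]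
  rfl

/-- The vertex of a turn. -/
def turnVertex (O : PlaneMap n) (d : O.turns) : O.nonPolarSet :=
  ⟨O.vertexOf d.1, fun h => by
    have := isSource_vertexOf.1 h d.1 (.refl _ _)
    simp [d.2.1] at this, fun h => by
    have := isSink_vertexOf.1 h (O.rot d.1) (Perm.sameCycle_apply_right.2 (.refl _ _))
    simp [d.2.2] at this⟩

/-- Rotating from an ingoing dart to an outgoing one must pass from an end to an origin somewhere.
-/
theorem turnVertex_surjective (O : PlaneMap n) : Function.Surjective O.turnVertex := by
  rintro ⟨v, h1, h2⟩
  obtain ⟨d, rfl⟩ := exists_vertexOf_eq v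
  rw [isSource_vertexOf] at h1
  rw [isSink_vertexOf] at h2
  push Not at h1 h2
  obtain ⟨x, hx, hx1⟩ := h1
  obtain ⟨y, hy, hy1⟩ := h2
  by_contra! hno
  have := (hx.symm.trans hy).induct (p := fun z => z.2 = false) (by simpa using hx1)
    fun z hz hz1 => by
      by_contra hz2
      refine hno ⟨z, hz1, by simpa using hz2⟩ (Subtype.ext ?_)
      exact vertexOf_eq_iff.2 (hx.trans hz).symm
  exact hy1 this

theorem turnVertex_injective_iff (O : PlaneMap n) : Function.Injective O.turnVertex ↔
    ∀ d d', d.2 = false → (O.rot d).2 = true → d'.2 = false → (O.rot d').2 = true →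
      O.rot.SameCycle d d' → d = d' := by
  constructor
  · intro h d d' h1 h2 h1' h2' hd
    have := @h ⟨d, h1, h2⟩ ⟨d', h1', h2'⟩ (Subtype.ext (vertexOf_eq_iff.2 hd))
    exact congrArg Subtype.val this
  · intro h d d' hd
    exact Subtype.ext (h _ _ d.2.1 d.2.2 d'.2.1 d'.2.2 (vertexOf_eq_iff.1 (congrArg Subtype.val hd)))

/-- The face of a peak. -/
def peakFace (O : PlaneMap n) (d : O.peaks) : O.Face := O.faceOf (dartFlip n d.1)

/-- At a dart `x` of maximal height in its face, the walk neither leaves upwards nor arrives from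
above. So `x` and the dart before it in the rotation are both ends of edges. -/
theorem peakFace_surjective {O : PlaneMap n} {h : Dart n → ℕ} (hh : O.IsHeight h) :
    Function.Surjective O.peakFace := by
  intro F
  obtain ⟨d, rfl⟩ := exists_faceOf_eq F
  obtain ⟨x, hx, hmax⟩ := Set.exists_max_image {x | O.facePerm.SameCycle d x} h
    (Set.toFinite _) ⟨d, .refl _ _⟩
  have hx' : O.facePerm.SameCycle d x := hx
  have h1 : x.2 = false := by
    by_contra h1
    have := hmax (O.facePerm x) (Perm.sameCycle_apply_right.2 hx')
    have := hh.lt_facePerm (d := x) (by simpa using h1)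
    omega
  have h2 : O.rot (O.rot⁻¹ x) = x := O.rot.apply_symm_apply _
  have h3 : O.facePerm (dartFlip n (O.rot⁻¹ x)) = x := by
    rw [facePerm_apply, dartFlip_dartFlip, h2]
  have h4 : O.facePerm.SameCycle (dartFlip n (O.rot⁻¹ x)) d := by
    rw [← Perm.sameCycle_apply_left, h3]
    exact hx'.symm
  refine ⟨⟨O.rot⁻¹ x, ?_, by rw [h2, h1]⟩, faceOf_eq_iff.2 h4⟩
  by_contra h5
  have h6 := hmax _ h4.symm
  have h7 := hh.lt_flip (d := O.rot⁻¹ x) (by simpa using h5)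
  rw [← hh.rot (O.rot⁻¹ x), h2] at h7
  omega

theorem peakFace_injective_iff (O : PlaneMap n) : Function.Injective O.peakFace ↔
    ∀ d d', d.2 = true → (O.facePerm d).2 = false → d'.2 = true →
      (O.facePerm d').2 = false → O.facePerm.SameCycle d d' → d = d' := by
  constructor
  · intro h d d' h1 h2 h1' h2' hd
    have := @h ⟨dartFlip n d, by simpa using h1, h2⟩ ⟨dartFlip n d', by simpa using h1', h2'⟩
      (by simpa [peakFace] using faceOf_eq_iff.2 hd)
    exact (dartFlip n).injective (congrArg Subtype.val this)
  · intro h d d' hd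
    refine Subtype.ext ((dartFlip n).injective (h _ _ (by simp [d.2.1]) ?_ (by simp [d'.2.1]) ?_
      (faceOf_eq_iff.1 hd)))
    · rw [facePerm_apply, dartFlip_dartFlip, d.2.2]
    · rw [facePerm_apply, dartFlip_dartFlip, d'.2.2]

/-- For orientations with one source and one sink, Euler's relation means that all vertices and
all faces are bipolar. -/
theorem euler_iff {O : PlaneMap n} {h : Dart n → ℕ} (hh : O.IsHeight h) {s t : O.Vertex}
    (hs : ∀ v, O.IsSource v ↔ v = s) (ht : ∀ v, O.IsSink v ↔ v = t) (hst : s ≠ t) :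
    Nat.card O.Vertex + Nat.card O.Face = n + 2 ↔
      Function.Injective O.turnVertex ∧ Function.Injective O.peakFace := by
  -- Non-polar vertices are at most as many as turns, faces at most as many as peaks, and turns and
  -- peaks add up to `n`. Euler's relation is the case of equality in both bounds.
  have h1 := Nat.card_le_card_of_surjective _ O.turnVertex_surjective
  have h2 := Nat.card_le_card_of_surjective _ (peakFace_surjective hh)
  have h3 := O.ncard_turns_add_ncard_peaks
  have h4 : O.nonPolar = Nat.card O.nonPolarSet := (Nat.card_coe_set_eq _).symm
  rw [← Nat.card_coe_set_eq, ← Nat.card_coe_set_eq] at h3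
  rw [card_vertex hs ht hst, h4]
  constructor
  · intro h5
    exact ⟨(O.turnVertex_surjective.bijective_of_nat_card_le (by omega)).1,
      ((peakFace_surjective hh).bijective_of_nat_card_le (by omega)).1⟩
  · rintro ⟨h5, h6⟩
    have h7 := Nat.card_le_card_of_injective _ h5
    have h8 := Nat.card_le_card_of_injective _ h6
    omega

theorem Good.isSource_iff {O : PlaneMap n} (hO : O.Good) (v : O.Vertex) :
    O.IsSource v ↔ v = O.tail O.root := by
  obtain ⟨d, rfl⟩ := exists_vertexOf_eq v
  constructor
  · intro h
    exact (vertexOf_eq_iff.2 (hO.source_unique d (isSource_vertexOf.1 h))).symm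
  · intro h
    rw [h]
    exact isSource_vertexOf.2 hO.source

theorem Good.isSink_iff {O : PlaneMap n} (hO : O.Good) (v : O.Vertex) :
    O.IsSink v ↔ v = O.vertexOf O.sinkDart := by
  obtain ⟨d, rfl⟩ := exists_vertexOf_eq v
  constructor
  · intro h
    exact (vertexOf_eq_iff.2 (hO.sink_unique d (isSink_vertexOf.1 h))).symm
  · intro h
    rw [h]
    exact isSink_vertexOf.2 hO.sink

theorem Good.nonPolar_eq {O : PlaneMap n} (hO : O.Good) : O.nonPolar = O.turns.ncard := by
  have : Function.Bijective O.turnVertex :=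
    ⟨O.turnVertex_injective_iff.2 hO.turn_inj, O.turnVertex_surjective⟩
  have := Nat.card_eq_of_bijective _ this
  rw [Nat.card_coe_set_eq, Nat.card_coe_set_eq] at this
  exact this.symm

theorem reflTransGen_of_sameCycle {O : PlaneMap n} {d d' : Dart n} (h : O.rot.SameCycle d d') :
    Relation.ReflTransGen (fun a b => b = O.rot a ∨ b = dartFlip n a) d d' :=
  h.induct .refl fun _ _ hz => hz.tail (.inl rfl)

/-- From any dart, going down along ingoing edges ends at a source, and there is only one. -/
theorem Good.connected {O : PlaneMap n} (hO : O.Good) (d d' : Dart n) :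
    Relation.ReflTransGen (fun a b => b = O.rot a ∨ b = dartFlip n a) d d' := by
  obtain ⟨h, hh⟩ := hO.height
  have key : ∀ m d, h d = m →
      Relation.ReflTransGen (fun a b => b = O.rot a ∨ b = dartFlip n a) d (O.root, true) ∧
      Relation.ReflTransGen (fun a b => b = O.rot a ∨ b = dartFlip n a) (O.root, true) d := by
    intro m
    induction m using Nat.strong_induction_on with
    | _ m ih =>
      intro d hd
      by_cases hs : ∀ x, O.rot.SameCycle d x → x.2 = true
      · have := hO.source_unique d hs
        exact ⟨reflTransGen_of_sameCycle this.symm, reflTransGen_of_sameCycle this⟩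
      · push Not at hs
        obtain ⟨x, hx, hx1⟩ := hs
        have h1 := hh.flip_lt (d := x) (by simpa using hx1)
        rw [← hh.sameCycle hx, hd] at h1
        obtain ⟨h2, h3⟩ := ih _ h1 _ rfl
        exact ⟨((reflTransGen_of_sameCycle hx).tail (.inr rfl)).trans h2,
          (h3.tail (.inr (dartFlip_dartFlip x).symm)).trans (reflTransGen_of_sameCycle hx.symm)⟩
  exact (key _ d rfl).1.trans (key _ d' rfl).2

theorem Good.source_ne_sink {O : PlaneMap n} (hO : O.Good) :
    O.tail O.root ≠ O.vertexOf O.sinkDart := by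
  intro h
  obtain ⟨f, hf⟩ := hO.height
  have := hO.source _ (vertexOf_eq_iff.1 h)
  simp [hf.sinkDart_snd] at this

theorem Good.isPlaneBipolar {O : PlaneMap n} (hO : O.Good) : O.IsPlaneBipolar := by
  obtain ⟨h, hh⟩ := hO.height
  refine ⟨hO.connected, ?_, exists_isHeight_iff.1 ⟨h, hh⟩, (hO.isSource_iff _).2 rfl,
    fun v => (hO.isSource_iff v).1, ⟨_, (hO.isSink_iff _).2 rfl, fun v => (hO.isSink_iff v).1⟩,
    fun v hv => ⟨O.rot O.sinkDart, ?_, ?_⟩⟩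
  · exact (euler_iff hh hO.isSource_iff hO.isSink_iff hO.source_ne_sink).2
      ⟨O.turnVertex_injective_iff.2 hO.turn_inj, O.peakFace_injective_iff.2 hO.peak_inj⟩
  · rw [vertexOf_rot, (hO.isSink_iff v).1 hv]
  · rw [hh.rot_sinkDart, outerFace, ← leftWalk_zero]
    exact faceOf_eq_iff.2 (leftWalk_sameCycle ..)

theorem IsPlaneBipolar.good {O : PlaneMap n} (hO : O.IsPlaneBipolar) : O.Good := by
  obtain ⟨h, hh⟩ := exists_isHeight_iff.2 hO.acyclic
  obtain ⟨t, ht, htu⟩ := hO.sink_unique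
  have hs : ∀ v, O.IsSource v ↔ v = O.tail O.root := fun v =>
    ⟨hO.source_unique v, fun h => h ▸ hO.source_root⟩
  have ht' : ∀ v, O.IsSink v ↔ v = t := fun v => ⟨htu v, fun h => h ▸ ht⟩
  have hst : O.tail O.root ≠ t := by
    rintro rfl
    exact ht O.root rfl
  obtain ⟨h1, h2⟩ := (euler_iff hh hs ht' hst).1 hO.planar
  rw [turnVertex_injective_iff] at h1
  rw [peakFace_injective_iff] at h2
  -- A dart of the outer face at the sink comes right after a peak, because the sink has only ends
  -- of edges. The outer face has one peak, and the left border also reaches it.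
  have hsink : O.vertexOf O.sinkDart = t := by
    obtain ⟨d, hd, hdf⟩ := hO.sink_outer t ht
    rw [← hd] at ht
    have h3 : O.rot (O.rot⁻¹ d) = d := O.rot.apply_symm_apply _
    have h4 : O.facePerm (dartFlip n (O.rot⁻¹ d)) = d := by
      rw [facePerm_apply, dartFlip_dartFlip, h3]
    have h5 : (O.rot⁻¹ d).2 = false := isSink_vertexOf.1 ht _ (by
      rw [← Perm.sameCycle_apply_right, h3])
    have h6 := h2 (dartFlip n O.sinkDart) (dartFlip n (O.rot⁻¹ d)) (by simp [hh.sinkDart_snd])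
      ?_ (by rw [dartFlip_snd, h5]; rfl) (by rw [h4]; exact isSink_vertexOf.1 ht _ (.refl _ _)) ?_
    · rw [(dartFlip n).injective h6, ← vertexOf_rot, h3, hd]
    · rw [facePerm_apply, dartFlip_dartFlip, hh.rot_sinkDart]
      exact hh.run_leftOuterDegree.down
    · rw [← Perm.sameCycle_apply_right, h4, dartFlip_sinkDart]
      exact (leftWalk_sameCycle O _ 0).trans (faceOf_eq_iff.1 hdf).symm
  refine ⟨⟨h, hh⟩, isSource_vertexOf.1 hO.source_root, fun d hd => ?_, ?_, fun d hd => ?_, h1, h2⟩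
  · exact (vertexOf_eq_iff.1 ((hs _).1 (isSource_vertexOf.2 hd))).symm
  · rw [← hsink] at ht
    exact isSink_vertexOf.1 ht
  · exact vertexOf_eq_iff.1 (hsink.trans ((ht' _).1 (isSink_vertexOf.2 hd)).symm)

end PlaneMap

namespace PlaneMap

variable {n : ℕ}

/-! ### Renaming the edges -/

/-- The action on darts of a permutation of the edges. -/
def dartMap (f : Perm (Fin n)) : Perm (Dart n) := Equiv.prodCongr f (Equiv.refl _)

@[simp] theorem dartMap_mk (f : Perm (Fin n)) (e : Fin n) (b : Bool) :
    dartMap f (e, b) = (f e, b) := rfl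

@[simp] theorem dartMap_snd (f : Perm (Fin n)) (d : Dart n) : (dartMap f d).2 = d.2 := rfl

@[simp] theorem dartMap_apply_symm (f : Perm (Fin n)) (d : Dart n) :
    dartMap f (dartMap f.symm d) = d := (dartMap f).apply_symm_apply d

@[simp] theorem dartMap_symm_apply (f : Perm (Fin n)) (d : Dart n) :
    dartMap f.symm (dartMap f d) = d := (dartMap f).symm_apply_apply d

theorem dartMap_flip (f : Perm (Fin n)) (d : Dart n) :
    dartMap f (dartFlip n d) = dartFlip n (dartMap f d) := rfl

/-- `f` preserves the rotations. -/
def Commutes (f : Perm (Fin n)) (O O' : PlaneMap n) : Prop :=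
  ∀ d, dartMap f (O.rot d) = O'.rot (dartMap f d)

theorem iso_iff {O O' : PlaneMap n} :
    O.Iso O' ↔ ∃ f, Commutes f O O' ∧ O'.faceOf (f O.root, true) = O'.outerFace := Iff.rfl

namespace Commutes

variable {f : Perm (Fin n)} {O O' : PlaneMap n}

theorem symm (h : Commutes f O O') : Commutes f.symm O' O := by
  intro d
  have h1 := h (dartMap f.symm d)
  rw [dartMap_apply_symm] at h1
  rw [← h1, dartMap_symm_apply]

theorem facePerm (h : Commutes f O O') (d : Dart n) :
    dartMap f (O.facePerm d) = O'.facePerm (dartMap f d) := h (dartFlip n d)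

theorem facePerm_pow (h : Commutes f O O') (d : Dart n) (j : ℕ) :
    dartMap f ((O.facePerm ^ j) d) = (O'.facePerm ^ j) (dartMap f d) := by
  induction j with
  | zero => rfl
  | succ j ih => rw [facePerm_pow_succ, facePerm_pow_succ, h.facePerm, ih]

theorem rot_pow (h : Commutes f O O') (d : Dart n) (j : ℕ) :
    dartMap f ((O.rot ^ j) d) = (O'.rot ^ j) (dartMap f d) := by
  induction j with
  | zero => rfl
  | succ j ih => rw [pow_succ', pow_succ', Perm.mul_apply, Perm.mul_apply, h, ih]

theorem sameCycle_rot (h : Commutes f O O') {d d' : Dart n} (hd : O.rot.SameCycle d d') :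
    O'.rot.SameCycle (dartMap f d) (dartMap f d') := by
  have := hd.eq_of_invariant (c := fun d => O'.vertexOf (dartMap f d)) fun x => by
    rw [h, vertexOf_rot]
  exact vertexOf_eq_iff.1 this

theorem sameCycle_facePerm (h : Commutes f O O') {d d' : Dart n}
    (hd : O.facePerm.SameCycle d d') : O'.facePerm.SameCycle (dartMap f d) (dartMap f d') := by
  have := hd.eq_of_invariant (c := fun d => O'.faceOf (dartMap f d)) fun x => by
    rw [h.facePerm, faceOf_facePerm]
  exact faceOf_eq_iff.1 this

theorem leftWalk (h : Commutes f O O') (hr : f O.root = O'.root) (j : ℕ) :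
    O'.leftWalk j = dartMap f (O.leftWalk j) := by
  rw [PlaneMap.leftWalk, PlaneMap.leftWalk, h.facePerm_pow, dartMap_mk, hr]

theorem leftOuterDegree (h : Commutes f O O') (hr : f O.root = O'.root) :
    O'.leftOuterDegree = O.leftOuterDegree := by
  simp only [PlaneMap.leftOuterDegree, h.leftWalk hr, dartMap_snd]

theorem sinkDart (h : Commutes f O O') (hr : f O.root = O'.root) :
    O'.sinkDart = dartMap f O.sinkDart := by
  rw [PlaneMap.sinkDart, h.leftOuterDegree hr, h.leftWalk hr, PlaneMap.sinkDart, dartMap_flip]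

theorem good (h : Commutes f O O') (hr : f O.root = O'.root) (hO : O.Good) : O'.Good := by
  have hs := h.symm
  have hsr : f.symm O'.root = O.root := by rw [← hr, f.symm_apply_apply]
  obtain ⟨t, ht⟩ := hO.height
  have hinj := (dartMap f.symm).injective
  have hback : ∀ {d x}, O.rot.SameCycle (dartMap f.symm d) x →
      O'.rot.SameCycle d (dartMap f x) := fun {d x} hx => by
    simpa using h.sameCycle_rot hx
  constructor
  · exact ⟨fun d => t (dartMap f.symm d), fun d => by simp only [hs d, ht.rot],
      fun e => ht.lt (f.symm e)⟩
  · intro d hd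
    refine hO.source (dartMap f.symm d) ?_
    rw [← hsr, ← dartMap_mk]
    exact hs.sameCycle_rot hd
  · intro d hd
    have := h.sameCycle_rot
      (hO.source_unique (dartMap f.symm d) fun x hx => hd (dartMap f x) (hback hx))
    simpa [hr] using this
  · intro d hd
    refine hO.sink (dartMap f.symm d) ?_
    rw [hs.sinkDart hsr]
    exact hs.sameCycle_rot hd
  · intro d hd
    have := h.sameCycle_rot
      (hO.sink_unique (dartMap f.symm d) fun x hx => hd (dartMap f x) (hback hx))
    rw [h.sinkDart hr]
    simpa using this
  · intro d d' hd1 hd2 hd1' hd2' hdd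
    refine hinj (hO.turn_inj _ _ hd1 ?_ hd1' ?_ (hs.sameCycle_rot hdd))
    · rwa [← hs]
    · rwa [← hs]
  · intro d d' hd1 hd2 hd1' hd2' hdd
    refine hinj (hO.peak_inj _ _ hd1 ?_ hd1' ?_ (hs.sameCycle_facePerm hdd))
    · rwa [← hs.facePerm]
    · rwa [← hs.facePerm]

end Commutes

theorem Good.last_peak {O : PlaneMap n} (hO : O.Good) :
    (dartFlip n O.sinkDart).2 = true ∧ (O.facePerm (dartFlip n O.sinkDart)).2 = false ∧
      O.facePerm.SameCycle (O.root, true) (dartFlip n O.sinkDart) := by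
  obtain ⟨h, hh⟩ := hO.height
  refine ⟨by simp [hh.sinkDart_snd], ?_, ?_⟩
  · rw [facePerm_apply, dartFlip_dartFlip]
    exact hO.sink _ (Perm.sameCycle_apply_right.2 (.refl _ _))
  · rw [dartFlip_sinkDart]
    exact leftWalk_sameCycle O 0 _

/-- The dart before the root in the outer face. -/
theorem Good.exists_before_root {O : PlaneMap n} (hO : O.Good) :
    ∃ d, O.facePerm d = (O.root, true) ∧ d.2 = false := by
  have h1 : O.rot (O.rot.symm (O.root, true)) = (O.root, true) := O.rot.apply_symm_apply _
  refine ⟨dartFlip n (O.rot.symm (O.root, true)), ?_, ?_⟩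
  · rw [facePerm_apply, dartFlip_dartFlip, h1]
  · have := hO.source (O.rot.symm (O.root, true)) (by
      rw [← Perm.sameCycle_apply_right, h1])
    rw [dartFlip_snd, this]
    rfl

/-- Going back along the outer face from the common last edge by the length of the border of `O`
leads, in `O`, to the dart before the root, which is an end. In a longer border of `O'` it would
still be an origin. -/
theorem Commutes.leftOuterDegree_le {f : Perm (Fin n)} {O O' : PlaneMap n} (h : Commutes f O O')
    (hO : O.Good) (hO' : O'.Good) (hs : dartMap f O.sinkDart = O'.sinkDart) :
    O'.leftOuterDegree ≤ O.leftOuterDegree := by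
  by_contra! hlt
  obtain ⟨k, hk, hlast, -⟩ := hO.leftWalk_last rfl
  obtain ⟨k', hk', hlast', hup'⟩ := hO'.leftWalk_last rfl
  obtain ⟨d, hd, hd2⟩ := hO.exists_before_root
  have h1 : (O.facePerm ^ (k + 1)) d = dartFlip n O.sinkDart := by
    rw [pow_succ, Perm.mul_apply, hd]
    exact hlast
  have h2 := congrArg (dartMap f) h1
  rw [h.facePerm_pow, dartMap_flip, hs, ← hlast'] at h2
  have h3 : (O'.facePerm ^ (k + 1)) (O'.leftWalk (k' - (k + 1))) = O'.leftWalk k' := by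
    rw [PlaneMap.leftWalk, ← Perm.mul_apply, ← pow_add, Nat.add_sub_cancel' (by omega)]
    rfl
  rw [← h3] at h2
  have h4 := (hup' (k' - (k + 1)) (by omega)).1
  rw [← (O'.facePerm ^ (k + 1)).injective h2, dartMap_snd, hd2] at h4
  simp at h4

/-- Isomorphisms preserve the root of a bipolar orientation. -/
theorem Iso.exists_commutes {O O' : PlaneMap n} (h : O.Iso O') (hO : O.Good) (hO' : O'.Good) :
    ∃ f, Commutes f O O' ∧ f O.root = O'.root := by
  obtain ⟨f, hf, hr⟩ := iso_iff.1 h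
  obtain ⟨h1, h2, h3⟩ := hO.last_peak
  obtain ⟨h1', h2', h3'⟩ := hO'.last_peak
  -- The last edge of the left border is the only peak of the outer face, hence is preserved. The
  -- borders then have equal lengths, and walking back gives the root.
  have hs : dartMap f O.sinkDart = O'.sinkDart := by
    refine (dartFlip n).injective ?_
    rw [← dartMap_flip]
    refine hO'.peak_inj _ _ h1 ?_ h1' h2' ?_
    · rwa [← hf.facePerm]
    · exact (hf.sameCycle_facePerm h3).symm.trans ((faceOf_eq_iff.1 hr).trans h3')
  have hs' : dartMap f.symm O'.sinkDart = O.sinkDart := by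
    rw [← hs, dartMap_symm_apply]
  have hdeg := le_antisymm (hf.leftOuterDegree_le hO hO' hs)
    (hf.symm.leftOuterDegree_le hO' hO hs')
  refine ⟨f, hf, ?_⟩
  have h4 := hf.facePerm_pow (O.root, true) (O.leftOuterDegree - 1)
  rw [← leftWalk, ← dartFlip_sinkDart, dartMap_flip, hs, dartFlip_sinkDart, leftWalk, hdeg] at h4
  exact congrArg Prod.fst ((O'.facePerm ^ _).injective h4).symm

/-- The map obtained by renaming the edges. -/
def relabel (f : Perm (Fin n)) (O : PlaneMap n) : PlaneMap n where
  rot := dartMap f * O.rot * (dartMap f)⁻¹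
  root := f O.root

theorem commutes_relabel (f : Perm (Fin n)) (O : PlaneMap n) : Commutes f O (O.relabel f) := by
  intro d
  simp [relabel]

theorem Commutes.iso {f : Perm (Fin n)} {O O' : PlaneMap n} (h : Commutes f O O')
    (hr : f O.root = O'.root) : O.Iso O' :=
  iso_iff.2 ⟨f, h, by rw [hr]; rfl⟩

theorem iso_relabel (f : Perm (Fin n)) (O : PlaneMap n) : O.Iso (O.relabel f) :=
  (commutes_relabel f O).iso rfl

end PlaneMap

/-! ### Insertions preserve `Good`, and every larger `Good` map is an insertion -/

namespace PlaneMap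

variable {n : ℕ}

/-- The number of darts at the sink. -/
noncomputable def sinkDegree (O : PlaneMap n) : ℕ := Function.minimalPeriod O.rot O.sinkDart

theorem insertL_root (O : PlaneMap n) {k : ℕ} (hk : 1 ≤ k) :
    (O.insertL k).root = if k - 1 = 0 then newEdge n else O.root.castSucc := by
  have : k - 1 = 0 ↔ k = 1 := by omega
  simp only [this]
  rfl

theorem Good.lStep_insertL {O : PlaneMap n} (hO : O.Good) {k : ℕ} (hk : 1 ≤ k)
    (hk' : k ≤ O.leftOuterDegree) : LStep O (O.insertL k) (O.leftWalk (k - 1)) O.sinkDart := by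
  obtain ⟨h, hh⟩ := hO.height
  refine LStep.of_rot rfl (hh.run_leftOuterDegree.up _ (by omega)) hh.sinkDart_snd ?_
  exact hO.sink _ (Perm.sameCycle_apply_right.2 (.refl _ _))

theorem Good.insertL {O : PlaneMap n} (hO : O.Good) {k : ℕ} (hk : 1 ≤ k)
    (hk' : k ≤ O.leftOuterDegree) : (O.insertL k).Good :=
  (hO.lStep_insertL hk hk').good hO (by omega) rfl rfl (O.insertL_root hk)

theorem Good.rStep_insertR {O : PlaneMap n} (hO : O.Good) (k : ℕ) :
    RStep O (O.insertR k) O.sinkDart ((O.rot ^ k) O.sinkDart) := by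
  obtain ⟨h, hh⟩ := hO.height
  refine RStep.of_rot rfl hh.sinkDart_snd (hO.sink _ ⟨k, by simp⟩) ?_
  exact hO.sink _ (Perm.sameCycle_apply_right.2 (.refl _ _))

theorem Good.insertR {O : PlaneMap n} (hO : O.Good) (k : ℕ) : (O.insertR k).Good :=
  (hO.rStep_insertR k).good hO ⟨k, by simp⟩ rfl rfl

/-- The exponent `0` is traded for the full period, in accordance with the index of `insertR`, which
runs from `1` to the degree of the sink. -/
theorem exists_pow_eq_of_sameCycle {α : Type*} [Finite α] {σ : Perm α} {x y : α}
    (h : σ.SameCycle x y) : ∃ k, 1 ≤ k ∧ k ≤ Function.minimalPeriod σ x ∧ (σ ^ k) x = y := by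
  obtain ⟨i, -, rfl⟩ := h.exists_pow_eq'
  have hpos : 0 < Function.minimalPeriod σ x :=
    Function.minimalPeriod_pos_of_mem_periodicPts (σ.injective.mem_periodicPts x)
  simp only [← Perm.iterate_eq_pow]
  by_cases h0 : i % Function.minimalPeriod σ x = 0
  · refine ⟨_, hpos, le_rfl, ?_⟩
    rw [Function.iterate_minimalPeriod, ← Function.iterate_mod_minimalPeriod_eq, h0]
    rfl
  · exact ⟨_, by omega, (Nat.mod_lt _ hpos).le, Function.iterate_mod_minimalPeriod_eq⟩

/-- A rotation that fixes the darts of the new edge comes from a rotation of the old darts. -/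
theorem exists_extRot_eq {ρ : Perm (Dart (n + 1))} (ht : ρ (newTail n) = newTail n)
    (hh : ρ (newHead n) = newHead n) :
    ∃ σ : Perm (Dart n), ∀ r, (PlaneMap.mk σ r).extRot = ρ := by
  have h1 : ∀ d, ∃ d', ρ (oldDart n d) = oldDart n d' := by
    intro d
    have : ∀ y, ρ (oldDart n d) = y → ∃ d', y = oldDart n d' := by
      intro y hy
      induction y using dart_cases with
      | tail => rw [← ht] at hy; exact absurd (ρ.injective hy) (oldDart_ne_new _ _)
      | head => rw [← hh] at hy; exact absurd (ρ.injective hy) (oldDart_ne_new _ _)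
      | old y => exact ⟨y, rfl⟩
    exact this _ rfl
  choose g hg using h1
  have hinj : Function.Injective g := by
    intro d d' h
    refine (oldDart n).injective (ρ.injective ?_)
    rw [hg, hg, h]
  refine ⟨Equiv.ofBijective g (Finite.injective_iff_bijective.1 hinj), fun r => ?_⟩
  ext1 d
  induction d using dart_cases with
  | tail => rw [extRot_new, ht]
  | head => rw [extRot_new, hh]
  | old d => rw [extRot_oldDart, hg]; rfl

/-- Alone at its vertex, the new tail would be at the source. But among the other edges, one with
the lowest origin also starts at a source, since an edge ending there would have a lower origin. -/
theorem Good.rot_newTail_ne {O : PlaneMap (n + 1)} (hO : O.Good) (hs : O.sinkDart = newHead n)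
    (hn : 0 < n) : O.rot (newTail n) ≠ newTail n := by
  intro hfix
  obtain ⟨h, hh⟩ := hO.height
  have : Nonempty (Fin n) := ⟨⟨0, hn⟩⟩
  obtain ⟨e, he⟩ := Finite.exists_min fun e : Fin n => h (oldDart n (e, true))
  have h1 : ∀ x, O.rot.SameCycle (newTail n) x → x = newTail n := fun x hx =>
    hx.induct (p := fun x => x = newTail n) rfl fun z _ hz => by rw [hz, hfix]
  have h2 := hO.source_unique (newTail n) fun x hx => by rw [h1 x hx]
  have h3 := hO.source_unique (oldDart n (e, true)) fun x hx => by
    induction x using dart_cases with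
    | tail => rfl
    | head =>
      have := hO.sink (oldDart n (e, true)) (by rw [hs]; exact hx.symm)
      simp at this
    | old x =>
      by_contra hx2
      obtain ⟨e', b⟩ := x
      have hb : b = false := by simpa using hx2
      subst hb
      have h4 := he e'
      have h5 := hh.lt e'.castSucc
      have h6 := hh.sameCycle hx
      simp only [oldDart_mk] at h4 h6
      omega
  exact oldDart_ne_new _ _ (h1 _ (h2.symm.trans h3))

/-- Alone at its vertex, the new head would have the same face on both sides, with the new tail as a
peak. The run from `a` stays in this face and ends at a peak which is `a` itself or is strictly
higher than the new tail: a second peak. -/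
theorem Good.rot_newHead_ne {O : PlaneMap (n + 1)} (hO : O.Good) {a : Dart n}
    (ha : O.rot (newTail n) = oldDart n a) (ha2 : a.2 = true) :
    O.rot (newHead n) ≠ newHead n := by
  intro hfix
  obtain ⟨h, hh⟩ := hO.height
  obtain ⟨ℓ, hr⟩ := exists_run hh (d := oldDart n a) ha2
  have h1 : O.facePerm (newTail n) = newHead n := hfix
  have h2 : O.facePerm (newHead n) = oldDart n a := ha
  have h3 : O.facePerm.SameCycle (newTail n) (oldDart n a) := by
    rw [← h2, ← h1, Perm.sameCycle_apply_right, Perm.sameCycle_apply_right]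
  have h4 := hO.peak_inj _ (newTail n) (hr.up ℓ (by omega))
    (by rw [← facePerm_pow_succ]; exact hr.down) rfl (by rw [h1])
    (Perm.SameCycle.symm (h3.trans ⟨ℓ, by simp⟩))
  have h5 : h (oldDart n a) = h (newTail n) := by rw [← ha, hh.rot]
  cases ℓ with
  | zero => exact oldDart_ne_new _ _ h4
  | succ ℓ =>
    have := hr.height_lt hh (i := 0) (j := ℓ + 1) (by omega) (by omega)
    rw [h4] at this
    change h (oldDart n a) < _ at this
    omega

theorem swap_mul_mul_swap {α : Type*} [DecidableEq α] (ρ : Perm α) (a b x y : α) :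
    swap a b * (swap a b * ρ * swap x y) * swap x y = ρ := by
  rw [mul_assoc, mul_assoc, mul_assoc, swap_mul_self, mul_one, ← mul_assoc, swap_mul_self, one_mul]

/-- Undoing the transpositions of `insertL` makes the new darts fixed points, so the rest is the
rotation of a smaller map; `LStep.of_good` then tells where the edge was attached. -/
theorem Good.exists_insertL_eq {O' : PlaneMap (n + 1)} (hO : O'.Good)
    (hs : O'.sinkDart = newHead n) {a : Dart n} (ha : O'.rot (newTail n) = oldDart n a)
    (ha2 : a.2 = true) :
    ∃ (O : PlaneMap n) (k : ℕ), O.Good ∧ 1 ≤ k ∧ k ≤ O.leftOuterDegree ∧ O' = O.insertL k := by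
  have hsink : ∀ d, O'.rot.SameCycle (newHead n) d → d.2 = false := by rw [← hs]; exact hO.sink
  obtain ⟨b, hb⟩ : ∃ b, O'.rot (oldDart n b) = newHead n := by
    have h1 : O'.rot (O'.rot.symm (newHead n)) = newHead n := O'.rot.apply_symm_apply _
    have h2 := hsink (O'.rot.symm (newHead n)) (by rw [← Perm.sameCycle_apply_right, h1])
    generalize O'.rot.symm (newHead n) = y at h1 h2
    induction y using dart_cases with
    | tail => simp at h2
    | head => exact absurd h1 (hO.rot_newHead_ne ha ha2)
    | old b => exact ⟨b, h1⟩
  have hb2 : b.2 = false := hsink (oldDart n b) (by rw [← hb, Perm.sameCycle_apply_left])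
  have hne : newHead n ≠ newTail n := by simp
  set ρ := swap (oldDart n a) (newTail n) * O'.rot * swap (oldDart n b) (newHead n) with hρ
  obtain ⟨σ, hσ⟩ := exists_extRot_eq (ρ := ρ)
    (by simp [hρ, swap_apply_of_ne_of_ne, ha])
    (by simp [hρ, swap_apply_of_ne_of_ne, hb])
  -- If the deleted edge is the root, the next edge clockwise at the source takes over.
  obtain ⟨r, hr⟩ : ∃ r : Fin n, O'.root = newEdge n ∧ a = (r, true) ∨ O'.root = r.castSucc := by
    by_cases h : O'.root = newEdge n
    · exact ⟨a.1, .inl ⟨h, by rw [← ha2]⟩⟩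
    · exact ⟨O'.root.castPred h, .inr (Fin.castSucc_castPred _ h).symm⟩
  have hrot : O'.rot = swap (oldDart n a) (newTail n) * (PlaneMap.mk σ r).extRot *
      swap (oldDart n b) (newHead n) := by
    rw [hσ, hρ, swap_mul_mul_swap]
  have hsb : (σ b).2 = false := by
    have h1 : oldDart n (σ b) = ρ (oldDart n b) := by rw [← hσ r, extRot_oldDart]
    have h2 := hsink (O'.rot (newHead n)) (Perm.sameCycle_apply_right.2 (.refl _ _))
    rw [← oldDart_snd, h1, hρ, Perm.mul_apply, Perm.mul_apply, swap_apply_left,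
      swap_apply_of_ne_of_ne, h2]
    · intro h; simp [h, ha2] at h2
    · intro h; simp [h] at h2
  obtain ⟨hgood, k, hk, hak, hbs, hroot⟩ := (LStep.of_rot hrot ha2 hb2 hsb).of_good hO hs hr
  refine ⟨_, k + 1, hgood, by omega, hk, ?_⟩
  refine PlaneMap.ext ?_ ?_
  · rw [hrot, hak, hbs]
    rfl
  · rw [hroot, insertL_root _ (by omega)]
    rfl

theorem Good.exists_insertR_eq {O' : PlaneMap (n + 1)} (hO : O'.Good)
    (hs : O'.sinkDart = newHead n) {c : Dart n} (hc : O'.rot (newTail n) = oldDart n c)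
    (hc2 : c.2 = false) :
    ∃ (O : PlaneMap n) (k : ℕ), O.Good ∧ 1 ≤ k ∧ k ≤ O.sinkDegree ∧ O' = O.insertR k := by
  have hsink : ∀ d, O'.rot.SameCycle (newHead n) d → d.2 = false := by rw [← hs]; exact hO.sink
  have hroot : O'.root ≠ newEdge n := by
    intro h
    have := hO.source (oldDart n c) (by rw [h, ← hc, Perm.sameCycle_apply_right])
    simp [hc2] at this
  -- `b` is the end of the border edge that precedes the new one. It exists because the origin of
  -- the new edge has the ingoing dart `c`, hence is not the source.
  obtain ⟨b, hb, hb2⟩ : ∃ b, O'.rot (oldDart n b) = newTail n ∧ b.2 = false := by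
    obtain ⟨k, -, hlast, hup⟩ := hO.leftWalk_last hs
    cases k with
    | zero => exact absurd (congrArg Prod.fst hlast) hroot
    | succ k =>
      have h1 := (hup k (by omega)).1
      rw [leftWalk_succ, facePerm_apply] at hlast
      generalize O'.leftWalk k = y at h1 hlast
      induction y using dart_cases with
      | tail =>
        have h2 : O'.rot (newHead n) = newTail n := hlast
        have := hsink (newTail n) (by rw [← h2, Perm.sameCycle_apply_right])
        simp at this
      | head => simp at h1
      | old y => exact ⟨dartFlip n y, hlast, by simpa using h1⟩
  have hne : newHead n ≠ newTail n := by simp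
  set ρ := swap (oldDart n c) (newHead n) * O'.rot * swap (oldDart n b) (newTail n) *
    swap (oldDart n b) (newHead n) with hρ
  obtain ⟨σ, hσ⟩ := exists_extRot_eq (ρ := ρ)
    (by simp [hρ, swap_apply_of_ne_of_ne, hb])
    (by simp [hρ, hc])
  obtain ⟨r, hr⟩ : ∃ r : Fin n, O'.root = r.castSucc :=
    ⟨O'.root.castPred hroot, (Fin.castSucc_castPred _ hroot).symm⟩
  have hrot : O'.rot = swap (oldDart n c) (newHead n) * (PlaneMap.mk σ r).extRot *
      swap (oldDart n b) (newHead n) * swap (oldDart n b) (newTail n) := by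
    rw [hσ, hρ]
    simp only [mul_assoc, swap_mul_self, mul_one, swap_mul_self_mul]
  have hsb : (σ b).2 = false := by
    have h1 : oldDart n (σ b) = ρ (oldDart n b) := by rw [← hσ r, extRot_oldDart]
    have h2 := hsink (O'.rot (newHead n)) (Perm.sameCycle_apply_right.2 (.refl _ _))
    rw [← oldDart_snd, h1, hρ, Perm.mul_apply, Perm.mul_apply, Perm.mul_apply, swap_apply_left,
      swap_apply_of_ne_of_ne (by simp) hne, swap_apply_def]
    split_ifs
    · rfl
    · exact hc2
    · exact h2
  obtain ⟨hgood, hbc, hbs⟩ := (RStep.of_rot hrot hb2 hc2 hsb).of_good hO hs hr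
  obtain ⟨k, hk, hk', hck⟩ := exists_pow_eq_of_sameCycle hbc
  rw [hbs] at hk' hck
  refine ⟨_, k, hgood, hk, hk', PlaneMap.ext ?_ hr⟩
  rw [hrot, hbs, ← hck]
  rfl

/-- Every bipolar orientation is obtained by the insertion of the last edge of its left border. -/
theorem Good.exists_insert_eq {O' : PlaneMap (n + 1)} (hO : O'.Good)
    (hs : O'.sinkDart = newHead n) (hn : 0 < n) :
    (∃ (O : PlaneMap n) (k : ℕ), O.Good ∧ 1 ≤ k ∧ k ≤ O.leftOuterDegree ∧ O' = O.insertL k) ∨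
    (∃ (O : PlaneMap n) (k : ℕ), O.Good ∧ 1 ≤ k ∧ k ≤ O.sinkDegree ∧ O' = O.insertR k) := by
  have h1 := hO.rot_newTail_ne hs hn
  obtain ⟨a, ha⟩ : ∃ a, O'.rot (newTail n) = oldDart n a := by
    have h2 : O'.rot.SameCycle (newTail n) (O'.rot (newTail n)) :=
      Perm.sameCycle_apply_right.2 (.refl _ _)
    generalize O'.rot (newTail n) = y at h1 h2
    induction y using dart_cases with
    | tail => exact absurd rfl h1
    | head =>
      have := hO.sink (newTail n) (by rw [hs]; exact h2.symm)
      simp at this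
    | old y => exact ⟨y, rfl⟩
  cases ha2 : a.2 with
  | true => exact .inl (hO.exists_insertL_eq hs ha ha2)
  | false => exact .inr (hO.exists_insertR_eq hs ha ha2)

end PlaneMap

namespace PlaneMap

variable {n : ℕ}

/-! ### Duality -/

/-- The first edge of the right border, as a dart of the source. -/
def rightDart (O : PlaneMap n) : Dart n := O.rot⁻¹ (O.root, true)

theorem rot_rightDart (O : PlaneMap n) : O.rot O.rightDart = (O.root, true) :=
  O.rot.apply_symm_apply _

theorem rightDart_eq_iff {O : PlaneMap n} {d : Dart n} :
    O.rightDart = d ↔ O.rot d = (O.root, true) := by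
  rw [rightDart, Perm.inv_eq_iff_eq, eq_comm]

theorem Good.rightDart_snd {O : PlaneMap n} (hO : O.Good) : O.rightDart.2 = true :=
  hO.source _ (by rw [← rot_rightDart, Perm.sameCycle_apply_left])

theorem Good.sinkDart_snd {O : PlaneMap n} (hO : O.Good) : O.sinkDart.2 = false :=
  hO.sink _ (.refl _ _)

/-- `D` is the mirror image of the dual of `O`. -/
structure MirDual (O D : PlaneMap n) : Prop where
  rot : D.rot = dartFlip n * O.rot * swap O.sinkDart O.rightDart
  sinkDart : D.sinkDart = O.sinkDart
  rightDart : D.rightDart = O.rightDart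

namespace MirDual

variable {O D : PlaneMap n}

/-- Both maps have the same two polar darts, hence the same transposition, and `dartFlip` is an
involution; so the relation between the rotations inverts itself. -/
theorem symm (h : MirDual O D) : MirDual D O where
  rot := by
    rw [h.sinkDart, h.rightDart, h.rot, ← mul_assoc, ← mul_assoc, dartFlip_mul_self, one_mul,
      mul_assoc, swap_mul_self, mul_one]
  sinkDart := h.sinkDart.symm
  rightDart := h.rightDart.symm

theorem rot_sinkDart (h : MirDual O D) : D.rot O.sinkDart = dartFlip n (O.root, true) := by
  rw [h.rot, Perm.mul_apply, Perm.mul_apply, swap_apply_left, O.rot_rightDart]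

theorem rot_rightDart (h : MirDual O D) : D.rot O.rightDart = dartFlip n (O.rot O.sinkDart) := by
  rw [h.rot, Perm.mul_apply, Perm.mul_apply, swap_apply_right]

theorem rot_of_ne (h : MirDual O D) {d : Dart n} (hd : d ≠ O.sinkDart) (hd' : d ≠ O.rightDart) :
    D.rot d = dartFlip n (O.rot d) := by
  rw [h.rot, Perm.mul_apply, Perm.mul_apply, swap_apply_of_ne_of_ne hd hd']

theorem eq_mir_dual (h : MirDual O D) (hO : O.Good) : D = O.dual.mir := by
  have hrot : D.rot = O.dual.mir.rot := by
    rw [h.rot]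
    simp only [mir, dual, mul_inv_rev, swap_inv, inv_inv, dartFlip_inv]
    rfl
  refine PlaneMap.ext hrot ?_
  have h1 : (O.rightDart.1, true) = O.rightDart := Prod.ext rfl hO.rightDart_snd.symm
  change _ = (O.dual.mir.rot (O.rightDart.1, true)).1
  rw [← hrot, h1, ← h.rightDart, D.rot_rightDart]

/-- The sink of `D` is the pole on the left of `O`: its darts, in the order used by `insertR`, are
the edges of the left border of `O`, in the order used by `insertL`. This is what makes the indices
of the two insertions agree. -/
theorem rot_pow_sinkDart (h : MirDual O D) (hO : O.Good) {j : ℕ} (hj : j < O.leftOuterDegree) :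
    (D.rot ^ (j + 1)) O.sinkDart = dartFlip n (O.leftWalk j) := by
  induction j with
  | zero =>
    rw [zero_add, pow_one, h.rot_sinkDart]
    rfl
  | succ j ih =>
    obtain ⟨k, hk, hlast, hup⟩ := hO.leftWalk_last rfl
    obtain ⟨h1, h2⟩ := hup j (by omega)
    rw [pow_succ', Perm.mul_apply, ih (by omega), h.rot_of_ne, leftWalk_succ, facePerm_apply]
    · intro h3
      exact h2 (by rw [← h3, dartFlip_dartFlip])
    · intro h3
      have := hO.rightDart_snd
      rw [← h3, dartFlip_snd, h1] at this
      simp at this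

theorem sinkDegree (h : MirDual O D) (hO : O.Good) : D.sinkDegree = O.leftOuterDegree := by
  obtain ⟨k, hk, hlast, hup⟩ := hO.leftWalk_last rfl
  rw [PlaneMap.sinkDegree, h.sinkDart, hk]
  have h1 : Function.IsPeriodicPt D.rot (k + 1) O.sinkDart := by
    rw [Function.IsPeriodicPt, Function.IsFixedPt, Perm.iterate_eq_pow,
      h.rot_pow_sinkDart hO (by omega), hlast, dartFlip_dartFlip]
  refine le_antisymm (h1.minimalPeriod_le (by omega)) ?_
  by_contra! hlt
  have hpos := h1.minimalPeriod_pos (by omega)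
  have h2 := Function.isPeriodicPt_minimalPeriod D.rot O.sinkDart
  obtain ⟨m, hm⟩ := Nat.exists_eq_succ_of_ne_zero hpos.ne'
  rw [hm, Function.IsPeriodicPt, Function.IsFixedPt, Perm.iterate_eq_pow,
    Nat.succ_eq_add_one, h.rot_pow_sinkDart hO (by omega)] at h2
  exact (hup m (by omega)).2 (dartFlip_eq_iff.1 h2)

/-- Duality exchanges the two kinds of insertions. -/
theorem insert {k : ℕ} (h : MirDual O D) (hO : O.Good) (hD : D.Good) (hk : 1 ≤ k)
    (hk' : k ≤ O.leftOuterDegree) : MirDual (O.insertL k) (D.insertR k) := by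
  have s := hO.lStep_insertL hk hk'
  have sD := hD.rStep_insertR k
  have hc : (D.rot ^ k) D.sinkDart = dartFlip n (O.leftWalk (k - 1)) := by
    obtain ⟨j, rfl⟩ := Nat.exists_eq_add_of_le' hk
    rw [h.sinkDart, h.rot_pow_sinkDart hO (by omega)]
    rfl
  rw [hc, h.sinkDart] at sD
  have hsO := s.sinkDart_eq hO (by omega) rfl rfl (O.insertL_root hk)
  have hsD := sD.sinkDart_eq hD h.sinkDart.symm rfl
  have hrb : O.rightDart ≠ O.sinkDart := by
    intro h1
    have := hO.rightDart_snd
    simp [h1, hO.sinkDart_snd] at this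
  have hroot_eq : (O.root, true) = O.leftWalk (k - 1) ↔ k - 1 = 0 :=
    ⟨fun h1 => (hO.leftWalk_inj (i := 0) (by omega) (by omega) h1).symm, fun h1 => by rw [h1]; rfl⟩
  have hOr : (O.insertL k).rot (oldDart n O.rightDart) = ((O.insertL k).root, true) := by
    rw [O.insertL_root hk]
    split_ifs with h1
    · exact s.before_tail _ (by rw [O.rot_rightDart, hroot_eq, h1])
    · rw [s.old _ hrb (by rwa [O.rot_rightDart, Ne, hroot_eq]), O.rot_rightDart]
      rfl
  have hDr : (D.insertR k).rot (oldDart n O.rightDart) = oldDart n (D.rot O.rightDart) := by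
    refine sD.old _ hrb ?_
    rw [h.rot_rightDart, Ne, (dartFlip n).apply_eq_iff_eq]
    exact s.rot_b_ne
  have hOr' := rightDart_eq_iff.2 hOr
  refine ⟨?_, by rw [hsO, hsD], ?_⟩
  · ext1 d
    rw [hsO, hOr', Perm.mul_apply, Perm.mul_apply]
    induction d using dart_cases with
    | tail => rw [swap_apply_of_ne_of_ne (by simp) (by simp), s.tail, sD.tail, dartFlip_oldDart]
    | head =>
      rw [swap_apply_left]
      by_cases h1 : D.rot O.sinkDart = dartFlip n (O.leftWalk (k - 1))
      · rw [sD.head_of_eq h1]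
        rw [h.rot_sinkDart, (dartFlip n).apply_eq_iff_eq] at h1
        rw [s.before_tail _ (by rw [O.rot_rightDart, h1])]
        rfl
      · rw [sD.head h1]
        rw [h.rot_sinkDart, (dartFlip n).apply_eq_iff_eq] at h1
        rw [s.old _ hrb (by rwa [O.rot_rightDart]), O.rot_rightDart, h.rot_sinkDart]
        rfl
    | old d =>
      by_cases hr : d = O.rightDart
      · subst hr
        rw [swap_apply_right, s.head, hDr, h.rot_rightDart, dartFlip_oldDart]
      rw [swap_apply_of_ne_of_ne (by simp) (by simpa using hr)]
      by_cases hb : d = O.sinkDart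
      · subst hb
        rw [sD.before_tail, s.before_head]
        rfl
      by_cases ha : O.rot d = O.leftWalk (k - 1)
      · rw [s.before_tail _ ha, sD.before_head _ hb (by rw [h.rot_of_ne hb hr, ha])]
        rfl
      · rw [s.old _ hb ha, sD.old _ hb, h.rot_of_ne hb hr, dartFlip_oldDart]
        rwa [h.rot_of_ne hb hr, Ne, (dartFlip n).apply_eq_iff_eq]
  · rw [hOr', rightDart_eq_iff, hDr, ← h.rightDart, D.rot_rightDart]
    rfl

end MirDual

/-! ### Degrees of the source and of the sink -/

theorem minimalPeriod_eq_ncard {α : Type*} [Finite α] (σ : Perm α) (x : α) :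
    Function.minimalPeriod σ x = Set.ncard {y | σ.SameCycle x y} := by
  have h1 : {y | σ.SameCycle x y} = (fun k => σ^[k] x) '' Set.Iio (Function.minimalPeriod σ x) := by
    ext y
    constructor
    · intro h
      obtain ⟨i, -, rfl⟩ := Perm.SameCycle.exists_pow_eq' h
      rw [← Perm.iterate_eq_pow]
      exact ⟨i % Function.minimalPeriod σ x, Nat.mod_lt _
        (Function.minimalPeriod_pos_of_mem_periodicPts (σ.injective.mem_periodicPts x)),
        Function.iterate_mod_minimalPeriod_eq⟩
    · rintro ⟨k, -, rfl⟩
      exact ⟨k, by simp [Perm.iterate_eq_pow]⟩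
  rw [h1, Set.InjOn.ncard_image Function.iterate_injOn_Iio_minimalPeriod]
  simp

theorem Good.degree_sink {O : PlaneMap n} (hO : O.Good) {t : O.Vertex} (ht : O.IsSink t) :
    O.degree t = O.sinkDegree := by
  rw [(hO.isSink_iff t).1 ht, degree, sinkDegree, minimalPeriod_eq_ncard]
  congr 1
  ext d
  exact vertexOf_eq_iff.trans Perm.sameCycle_comm

/-- The number of darts at the source. -/
noncomputable def sourceDegree (O : PlaneMap n) : ℕ :=
  Function.minimalPeriod (O.rot⁻¹ : Perm (Dart n)) O.rightDart

theorem Good.degree_source {O : PlaneMap n} (hO : O.Good) {s : O.Vertex} (hs : O.IsSource s) :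
    O.degree s = O.sourceDegree := by
  rw [(hO.isSource_iff s).1 hs, degree, sourceDegree, minimalPeriod_eq_ncard]
  congr 1
  ext d
  change O.vertexOf d = O.vertexOf (O.root, true) ↔ O.rot⁻¹.SameCycle O.rightDart d
  rw [Perm.sameCycle_inv, ← rot_rightDart, vertexOf_rot, vertexOf_eq_iff, Perm.sameCycle_comm]

/-! ### The right border -/

theorem rightWalk_zero (O : PlaneMap n) : O.rightWalk 0 = O.rightDart := rfl

theorem rightWalk_succ (O : PlaneMap n) (j : ℕ) :
    O.rightWalk (j + 1) = O.rot⁻¹ (dartFlip n (O.rightWalk j)) := by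
  rw [rightWalk, pow_succ', Perm.mul_apply]
  rfl

theorem rot_rightWalk_succ (O : PlaneMap n) (j : ℕ) :
    O.rot (O.rightWalk (j + 1)) = dartFlip n (O.rightWalk j) := by
  rw [rightWalk_succ]
  exact O.rot.apply_symm_apply _

theorem rightWalk_succ_eq {O : PlaneMap n} {j : ℕ} {d : Dart n}
    (h : O.rot d = dartFlip n (O.rightWalk j)) : O.rightWalk (j + 1) = d := by
  refine O.rot.injective ?_
  rw [rot_rightWalk_succ, h]

theorem rightOuterDegree_eq {O : PlaneMap n} {ℓ : ℕ} (h1 : ∀ j < ℓ, (O.rightWalk j).2 = true)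
    (h2 : (O.rightWalk ℓ).2 = false) : O.rightOuterDegree = ℓ := by
  refine le_antisymm (Nat.sInf_le h2) ?_
  refine le_csInf ⟨ℓ, h2⟩ fun j hj => ?_
  by_contra hlt
  have h3 := h1 j (by omega)
  have h4 : (O.rightWalk j).2 = false := hj
  simp [h3] at h4

/-- The right border is a forward run in the mirror image, which has the same heights. Read
backwards it belongs to the outer face, whose unique peak shows that the walk stops at `sinkDart`.
-/
theorem Good.rightWalk {O : PlaneMap n} (hO : O.Good) :
    (∀ j < O.rightOuterDegree, (O.rightWalk j).2 = true) ∧ 0 < O.rightOuterDegree ∧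
      O.rightWalk O.rightOuterDegree = O.sinkDart := by
  obtain ⟨h, hh⟩ := hO.height
  have hh' : O.mir.IsHeight h :=
    ⟨fun d => by rw [← hh.rot]; exact congrArg h (O.rot.apply_symm_apply d), hh.lt⟩
  obtain ⟨ℓ, hr⟩ := exists_run hh' (d := O.rightDart) hO.rightDart_snd
  have hw : ∀ j, (O.mir.facePerm ^ j) O.rightDart = O.rightWalk j := fun _ => rfl
  have h1 : ∀ j < ℓ + 1, (O.rightWalk j).2 = true := fun j hj => by rw [← hw, hr.up j hj]
  have h2 : (O.rightWalk (ℓ + 1)).2 = false := by rw [← hw, hr.down]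
  have h3 := rightOuterDegree_eq h1 h2
  have h4 : ∀ j, O.facePerm.SameCycle (dartFlip n (O.rightWalk j)) (O.root, true) := by
    intro j
    induction j with
    | zero =>
      rw [← Perm.sameCycle_apply_left, facePerm_apply, dartFlip_dartFlip, rightWalk_zero,
        rot_rightDart]
    | succ j ih =>
      rw [← Perm.sameCycle_apply_left, facePerm_apply, dartFlip_dartFlip, rot_rightWalk_succ]
      exact ih
  obtain ⟨h5, h6, h7⟩ := hO.last_peak
  rw [h3]
  refine ⟨h1, by omega, (dartFlip n).injective ?_⟩
  refine hO.peak_inj _ _ (by simp [h2]) ?_ h5 h6 ((h4 _).trans h7)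
  rw [facePerm_apply, dartFlip_dartFlip, rot_rightWalk_succ, dartFlip_snd, h1 ℓ (by omega)]
  rfl

/-- The right border of `D` runs counterclockwise through the darts at the source of `O`. When it
would come back to `rightDart`, the transposition diverts it to `sinkDart`. -/
theorem MirDual.rightOuterDegree {O D : PlaneMap n} (h : MirDual O D) (hO : O.Good) :
    D.rightOuterDegree = O.sourceDegree := by
  obtain ⟨τ, hτ⟩ : ∃ τ : Perm (Dart n), O.rot⁻¹ = τ := ⟨_, rfl⟩
  obtain ⟨r, hr⟩ : ∃ r, O.rightDart = r := ⟨_, rfl⟩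
  have hsc : ∀ j, (τ^[j] r).2 = true := fun j => hO.source _ (by
    rw [← O.rot_rightDart, Perm.sameCycle_apply_left, ← Perm.sameCycle_inv, hτ, hr]
    exact ⟨j, by rw [zpow_natCast, Perm.iterate_eq_pow]⟩)
  have hdeg : O.sourceDegree = Function.minimalPeriod τ r := by rw [← hτ, ← hr]; rfl
  have hpos : 0 < O.sourceDegree :=
    Function.minimalPeriod_pos_of_mem_periodicPts (O.rot⁻¹.injective.mem_periodicPts _)
  have hstep : ∀ d, D.rot⁻¹ (dartFlip n d) = swap O.sinkDart r (τ d) := by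
    intro d
    rw [h.rot, mul_inv_rev, mul_inv_rev, swap_inv, hτ, hr, dartFlip_inv, Perm.mul_apply, Perm.mul_apply,
      dartFlip_dartFlip]
  have h1 : ∀ j < O.sourceDegree, D.rightWalk j = τ^[j] r := by
    intro j hj
    induction j with
    | zero => exact h.rightDart.trans hr
    | succ j ih =>
      rw [rightWalk_succ, ih (by omega), hstep, ← Function.iterate_succ_apply' τ,
        swap_apply_of_ne_of_ne]
      · intro h2
        have := hsc (j + 1)
        simp [h2, hO.sinkDart_snd] at this
      · intro h2
        have : Function.IsPeriodicPt τ (j + 1) r := h2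
        have := this.minimalPeriod_le (by omega)
        rw [hdeg] at hj
        omega
  refine rightOuterDegree_eq (fun j hj => by rw [h1 j hj, hsc]) ?_
  obtain ⟨m, hm⟩ := Nat.exists_eq_succ_of_ne_zero hpos.ne'
  have h2 : τ^[m + 1] r = r := by
    rw [← Nat.succ_eq_add_one, ← hm, hdeg]
    exact Function.iterate_minimalPeriod
  rw [hm, rightWalk_succ, h1 m (by omega), hstep, ← Function.iterate_succ_apply' τ, h2,
    swap_apply_right, hO.sinkDart_snd]

end PlaneMap

namespace PlaneMap

variable {n : ℕ}

/-! ### Parameters of the insertions -/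

theorem Good.leftOuterDegree_insertL {O : PlaneMap n} (hO : O.Good) {k : ℕ} (hk : 1 ≤ k)
    (hk' : k ≤ O.leftOuterDegree) : (O.insertL k).leftOuterDegree = k := by
  rw [((hO.lStep_insertL hk hk').run hO (by omega) rfl rfl (O.insertL_root hk)).leftOuterDegree]
  omega

theorem Good.leftOuterDegree_insertR {O : PlaneMap n} (hO : O.Good) (k : ℕ) :
    (O.insertR k).leftOuterDegree = O.leftOuterDegree + 1 :=
  ((hO.rStep_insertR k).run hO rfl rfl).leftOuterDegree

theorem Good.sinkDart_insertL {O : PlaneMap n} (hO : O.Good) {k : ℕ} (hk : 1 ≤ k)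
    (hk' : k ≤ O.leftOuterDegree) : (O.insertL k).sinkDart = newHead n :=
  (hO.lStep_insertL hk hk').sinkDart_eq hO (by omega) rfl rfl (O.insertL_root hk)

theorem Good.sinkDart_insertR {O : PlaneMap n} (hO : O.Good) (k : ℕ) :
    (O.insertR k).sinkDart = newHead n :=
  (hO.rStep_insertR k).sinkDart_eq hO rfl rfl

theorem LStep.turns_eq {O : PlaneMap n} {O' : PlaneMap (n + 1)} {a b : Dart n}
    (s : LStep O O' a b) : O'.turns = oldDart n '' O.turns := by
  ext d
  induction d using dart_cases with
  | tail => simp [turns]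
  | head => simp [turns, s.head, s.rot_b_in]
  | old d => simp [turns, s.rot_old_snd]

/-- The additional turn belongs to the vertex split off the sink. Through `Good.nonPolar_eq`,
counting turns counts the non-polar vertices. -/
theorem RStep.turns_eq {O : PlaneMap n} {O' : PlaneMap (n + 1)} {b c : Dart n}
    (s : RStep O O' b c) : O'.turns = insert (oldDart n b) (oldDart n '' O.turns) := by
  ext d
  induction d using dart_cases with
  | tail => simp [turns]
  | head => simp [turns, s.rot_head_snd]
  | old d =>
    by_cases h : d = b
    · subst h
      simp [turns, s.before_tail, s.b_in]
    · simp [turns, s.rot_old_snd h, h]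

theorem Good.nonPolar_insertL {O : PlaneMap n} (hO : O.Good) {k : ℕ} (hk : 1 ≤ k)
    (hk' : k ≤ O.leftOuterDegree) : (O.insertL k).nonPolar = O.nonPolar := by
  rw [(hO.insertL hk hk').nonPolar_eq, hO.nonPolar_eq, (hO.lStep_insertL hk hk').turns_eq,
    Set.ncard_image_of_injective _ (oldDart n).injective]

theorem Good.nonPolar_insertR {O : PlaneMap n} (hO : O.Good) (k : ℕ) :
    (O.insertR k).nonPolar = O.nonPolar + 1 := by
  have s := hO.rStep_insertR k
  rw [(hO.insertR k).nonPolar_eq, hO.nonPolar_eq, s.turns_eq, Set.ncard_insert_of_notMem,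
    Set.ncard_image_of_injective _ (oldDart n).injective]
  rintro ⟨d, hd, hdb⟩
  rw [(oldDart n).injective hdb] at hd
  simpa [s.rot_b_in] using hd.2

theorem Good.rightOuterDegree_insertL {O : PlaneMap n} (hO : O.Good) {k : ℕ} (hk : 1 ≤ k)
    (hk' : k ≤ O.leftOuterDegree) : (O.insertL k).rightOuterDegree = O.rightOuterDegree := by
  have s := hO.lStep_insertL hk hk'
  obtain ⟨hup, hpos, hlast⟩ := hO.rightWalk
  have hrb : O.rightDart ≠ O.sinkDart := by
    intro h1
    have := hO.rightDart_snd
    simp [h1, hO.sinkDart_snd] at this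
  have h0 : (O.insertL k).rightDart = oldDart n O.rightDart := by
    rw [rightDart_eq_iff, O.insertL_root hk]
    split_ifs with h1
    · rw [s.before_tail]
      rw [O.rot_rightDart, h1, leftWalk_zero]
    · rw [s.old _ hrb, O.rot_rightDart, oldDart_mk]
      rw [O.rot_rightDart, ← leftWalk_zero]
      exact fun h => h1 (hO.leftWalk_inj (by omega) (by omega) h).symm
  have hold : ∀ j < O.rightOuterDegree, (O.insertL k).rightWalk j = oldDart n (O.rightWalk j) := by
    intro j hj
    induction j with
    | zero => rw [rightWalk_zero, h0, rightWalk_zero]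
    | succ j ih =>
      refine rightWalk_succ_eq ?_
      rw [ih (by omega), s.old, rot_rightWalk_succ, dartFlip_oldDart]
      · intro h
        have := hup _ hj
        simp [h, hO.sinkDart_snd] at this
      · intro h
        have := s.a_out
        rw [← h, rot_rightWalk_succ, dartFlip_snd, hup j (by omega)] at this
        simp at this
  obtain ⟨m, hm⟩ : ∃ m, O.rightOuterDegree = m + 1 := ⟨_, (Nat.sub_add_cancel hpos).symm⟩
  refine rightOuterDegree_eq (fun j hj => by rw [hold j hj, oldDart_snd, hup j hj]) ?_
  rw [hm, rightWalk_succ_eq (d := newHead n)]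
  rw [hm] at hlast
  rw [s.head, hold m (by omega), dartFlip_oldDart, ← rot_rightWalk_succ, hlast]

/-- For `k = 1` all the edges at the sink move to the new vertex, so the new edge prolongs the right
border too. For `k > 1` the last edge of the right border still ends at the sink. -/
theorem Good.rightOuterDegree_insertR {O : PlaneMap n} (hO : O.Good) {k : ℕ} (hk : 1 ≤ k)
    (hk' : k ≤ O.sinkDegree) :
    (O.insertR k).rightOuterDegree = O.rightOuterDegree + if k = 1 then 1 else 0 := by
  have s := hO.rStep_insertR k
  obtain ⟨hup, hpos, hlast⟩ := hO.rightWalk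
  have hk1 : O.rot O.sinkDart = (O.rot ^ k) O.sinkDart ↔ k = 1 := by
    constructor
    · intro h
      obtain ⟨j, rfl⟩ := Nat.exists_eq_add_of_le' hk
      rw [pow_succ', Perm.mul_apply] at h
      have h1 : Function.IsPeriodicPt O.rot j O.sinkDart := by
        rw [Function.IsPeriodicPt, Function.IsFixedPt, Perm.iterate_eq_pow]
        exact (O.rot.injective h).symm
      by_contra hj
      have := h1.minimalPeriod_le (by omega)
      rw [sinkDegree] at hk'
      omega
    · rintro rfl
      rw [pow_one]
  have hrb : O.rightDart ≠ O.sinkDart := by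
    intro h1
    have := hO.rightDart_snd
    simp [h1, hO.sinkDart_snd] at this
  have h0 : (O.insertR k).rightDart = oldDart n O.rightDart := by
    rw [rightDart_eq_iff, s.old _ hrb, O.rot_rightDart]
    · rfl
    · intro h
      have := s.c_in
      rw [← h, O.rot_rightDart] at this
      simp at this
  have hold : ∀ j < O.rightOuterDegree, (O.insertR k).rightWalk j = oldDart n (O.rightWalk j) := by
    intro j hj
    induction j with
    | zero => rw [rightWalk_zero, h0, rightWalk_zero]
    | succ j ih =>
      refine rightWalk_succ_eq ?_
      have h1 := hup _ hj
      rw [ih (by omega), s.old, rot_rightWalk_succ, dartFlip_oldDart]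
      · intro h
        simp [h, hO.sinkDart_snd] at h1
      · intro h
        have := hO.sink (O.rightWalk (j + 1)) (by
          rw [← Perm.sameCycle_apply_right, h]
          exact ⟨k, by simp⟩)
        simp [h1] at this
  obtain ⟨m, hm⟩ : ∃ m, O.rightOuterDegree = m + 1 := ⟨_, (Nat.sub_add_cancel hpos).symm⟩
  have hflip : dartFlip (n + 1) ((O.insertR k).rightWalk m) = oldDart n (O.rot O.sinkDart) := by
    rw [hm] at hlast
    rw [hold m (by omega), dartFlip_oldDart, ← rot_rightWalk_succ, hlast]
  by_cases h1 : k = 1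
  · have h2 : (O.insertR k).rightWalk O.rightOuterDegree = newTail n := by
      rw [hm]
      refine rightWalk_succ_eq ?_
      rw [s.tail, hflip, ← hk1.2 h1]
    have h3 : (O.insertR k).rightWalk (O.rightOuterDegree + 1) = newHead n := by
      refine rightWalk_succ_eq ?_
      rw [s.head_of_eq (hk1.2 h1), h2]
      rfl
    rw [if_pos h1]
    refine rightOuterDegree_eq (fun j hj => ?_) (by rw [h3])
    rcases (Nat.lt_succ_iff.1 hj).lt_or_eq with h4 | rfl
    · rw [hold j h4, oldDart_snd, hup j h4]
    · rw [h2]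
  · rw [if_neg h1, add_zero]
    refine rightOuterDegree_eq (fun j hj => by rw [hold j hj, oldDart_snd, hup j hj]) ?_
    rw [hm, rightWalk_succ_eq (d := newHead n)]
    rw [s.head (fun h => h1 (hk1.1 h)), hflip]

/-! ### The one-edge orientation -/

theorem good_single : single.Good := by
  have hh : single.IsHeight (fun d => if d.2 then 0 else 1) := ⟨fun _ => rfl, fun _ => by simp⟩
  have hsc : ∀ {d d' : Dart 1}, single.rot.SameCycle d d' → d = d' := fun h =>
    h.eq_of_invariant (c := id) fun _ => rfl
  have hr : single.Run (single.root, true) 1 := ⟨fun j hj => by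
    obtain rfl : j = 0 := by omega
    rfl, rfl⟩
  have hs : single.sinkDart = (0, false) := by
    rw [sinkDart, hr.leftOuterDegree]
    rfl
  have hd : ∀ {d d' : Dart 1}, d.2 = d'.2 → d = d' := fun h => Prod.ext (Subsingleton.elim _ _) h
  refine ⟨⟨_, hh⟩, fun d h => ?_, fun d h => ?_, fun d h => ?_, fun d h => ?_,
    fun d d' h _ h' _ _ => hd (h.trans h'.symm), fun d d' h _ h' _ _ => hd (h.trans h'.symm)⟩
  · rw [← hsc h]
  · have : d = (single.root, true) := hd (h d (.refl _ _))
    rw [this]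
  · rw [← hsc h, hs]
  · have : d = (0, false) := hd (h d (.refl _ _))
    rw [hs, this]

theorem leftOuterDegree_single : single.leftOuterDegree = 1 :=
  Run.leftOuterDegree ⟨fun j hj => by
    obtain rfl : j = 0 := by omega
    rfl, rfl⟩

theorem rightOuterDegree_single : single.rightOuterDegree = 1 :=
  rightOuterDegree_eq (fun j hj => by
    obtain rfl : j = 0 := by omega
    rfl) rfl

theorem nonPolar_single : single.nonPolar = 0 := by
  rw [good_single.nonPolar_eq, Set.ncard_eq_zero]
  ext d
  simp only [turns, Set.mem_ofPred_eq, Set.mem_empty_iff_false, iff_false, not_and]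
  intro h
  change ¬ d.2 = true
  simp [h]

theorem mirDual_single : MirDual single single := by
  refine ⟨?_, rfl, rfl⟩
  have hs : single.sinkDart = (0, false) := by
    rw [sinkDart, leftOuterDegree_single]
    rfl
  rw [hs]
  change (1 : Perm (Dart 1)) = dartFlip 1 * 1 * swap (0, false) (0, true)
  decide

end PlaneMap

namespace BaxterPerm

variable {n : ℕ}

/-! ### Insertions in permutations -/

theorem val_succAbove (p : Fin (n + 1)) (i : Fin n) :
    (p.succAbove i : ℕ) = if (i : ℕ) < p then (i : ℕ) else i + 1 := by
  rw [Fin.succAbove]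
  split_ifs with h1 h2 h2
  · rfl
  · exact absurd h1 h2
  · exact absurd h2 h1
  · rfl

theorem insertMax_of_lt (σ : Perm (Fin n)) {p : Fin (n + 1)} {x : Fin n} (h : x.castSucc < p) :
    insertMax σ p x.castSucc = (σ x).castSucc := by
  rw [← insertMax_succAbove σ p, Fin.succAbove_of_castSucc_lt _ _ h]

theorem insertMax_of_le (σ : Perm (Fin n)) {p : Fin (n + 1)} {x : Fin n} (h : p ≤ x.castSucc) :
    insertMax σ p x.succ = (σ x).castSucc := by
  rw [← insertMax_succAbove σ p, Fin.succAbove_of_le_castSucc _ _ h]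

theorem insertMax_removeMax (π : Perm (Fin (n + 1))) :
    insertMax (removeMax π) (maxPos π) = π := by
  set e := ((finSuccEquiv' (maxPos π)).symm.trans π).trans (finSuccEquiv' (Fin.last n)) with he
  have h0 : e none = none := by simp [he, maxPos]
  have h1 : (removeMax π).optionCongr = e := by
    ext1 x
    cases x with
    | none => rw [h0]; rfl
    | some x =>
      have : ∃ y, e (some x) = some y := by
        rw [← Option.ne_none_iff_exists']
        intro h
        have := e.injective (h.trans h0.symm)
        simp at this
      exact Equiv.removeNone_some e this
  ext1 x
  rw [insertMax, h1, he]
  simp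

theorem rev_rev (π : Perm (Fin n)) : rev (rev π) = π := by
  ext1 x
  simp [rev]

theorem rev_insertMax (σ : Perm (Fin n)) (p : Fin (n + 1)) :
    rev (insertMax σ p) = insertMax (rev σ) p.rev := by
  ext1 x
  rcases Fin.eq_self_or_eq_succAbove p.rev x with rfl | ⟨i, rfl⟩
  · simp [rev, insertMax_self]
  · simp [rev, insertMax_succAbove, Fin.rev_succAbove]

theorem isRLMax_iff_rev {π : Perm (Fin n)} {p : Fin n} : IsRLMax π p ↔ IsLRMax (rev π) p.rev := by
  constructor
  · intro h j hj
    simpa [rev] using h j.rev (Fin.lt_rev_iff.1 hj)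
  · intro h j hj
    simpa [rev] using h j.rev (Fin.rev_lt_rev.2 hj)

theorem isLRMax_iff_rev {π : Perm (Fin n)} {p : Fin n} : IsLRMax π p ↔ IsRLMax (rev π) p.rev := by
  rw [isRLMax_iff_rev, rev_rev, Fin.rev_rev]

theorem isLRMin_iff_rev {π : Perm (Fin n)} {p : Fin n} : IsLRMin π p ↔ IsRLMin (rev π) p.rev := by
  constructor
  · intro h j hj
    simpa [rev] using h j.rev (Fin.rev_lt_iff.1 hj)
  · intro h j hj
    simpa [rev] using h j.rev (Fin.rev_lt_rev.2 hj)

/-! ### Baxter permutations -/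

theorem IsBaxter.rev {π : Perm (Fin n)} (h : IsBaxter π) : IsBaxter (rev π) := by
  rintro ⟨i, j, j', k, hij, hjk, hj', hpat⟩
  have hne : k ≠ j' := by
    rintro rfl
    rcases hpat with ⟨h1, h2, -⟩ | ⟨-, h1, h2⟩
    · exact lt_irrefl _ (h1.trans h2)
    · exact lt_irrefl _ (h1.trans h2)
  have hne' : (k : ℕ) ≠ j' := fun h => hne (Fin.ext h)
  have hi := i.2
  have hk := k.2
  rw [Fin.lt_def] at hij hjk
  refine h ⟨k.rev, j'.rev, j.rev, i.rev, ?_, ?_, ?_, ?_⟩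
  · rw [Fin.lt_def, Fin.val_rev, Fin.val_rev]; omega
  · rw [Fin.lt_def, Fin.val_rev, Fin.val_rev]; omega
  · rw [Fin.val_rev, Fin.val_rev]; omega
  · rcases hpat with ⟨h1, h2, h3⟩ | ⟨h1, h2, h3⟩
    · exact .inr ⟨h1, h2, h3⟩
    · exact .inl ⟨h1, h2, h3⟩

/-- A forbidden pattern of `σ` persists unless the new maximum separates its two adjacent entries;
in that case the maximum replaces the larger of the two. -/
theorem IsBaxter.of_insertMax {σ : Perm (Fin n)} {p : Fin (n + 1)}
    (h : IsBaxter (insertMax σ p)) : IsBaxter σ := by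
  rintro ⟨i, j, j', k, hij, hjk, hj', hpat⟩
  rw [Fin.lt_def] at hij hjk
  have hlast : ∀ x, (insertMax σ p (p.succAbove x)) < insertMax σ p p := fun x => by
    rw [insertMax_self, insertMax_succAbove]
    exact Fin.castSucc_lt_last _
  have hmono : ∀ {x y}, σ x < σ y →
      insertMax σ p (p.succAbove x) < insertMax σ p (p.succAbove y) := fun hxy => by
    rw [insertMax_succAbove, insertMax_succAbove]
    exact hxy
  by_cases hp : (p : ℕ) = j'
  · rcases hpat with ⟨h1, h2, h3⟩ | ⟨h1, h2, h3⟩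
    · refine h ⟨p.succAbove i, p, p.succAbove j', p.succAbove k, ?_, ?_, ?_,
        .inl ⟨hmono h1, hmono h2, hlast _⟩⟩
      · rw [Fin.lt_def, val_succAbove]; split_ifs <;> omega
      · rw [Fin.lt_def, val_succAbove]; split_ifs <;> omega
      · rw [val_succAbove]; split_ifs <;> omega
    · refine h ⟨p.succAbove i, p.succAbove j, p, p.succAbove k, ?_, ?_, ?_,
        .inr ⟨hmono h1, hmono h2, hlast _⟩⟩
      · exact (Fin.strictMono_succAbove p) (Fin.lt_def.2 hij)
      · exact (Fin.strictMono_succAbove p) (Fin.lt_def.2 hjk)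
      · rw [val_succAbove]; split_ifs <;> omega
  · refine h ⟨p.succAbove i, p.succAbove j, p.succAbove j', p.succAbove k,
      (Fin.strictMono_succAbove p) (Fin.lt_def.2 hij),
      (Fin.strictMono_succAbove p) (Fin.lt_def.2 hjk), ?_, ?_⟩
    · rw [val_succAbove, val_succAbove]; split_ifs <;> omega
    · exact hpat.imp (fun h => ⟨hmono h.1, hmono h.2.1, hmono h.2.2⟩)
        (fun h => ⟨hmono h.1, hmono h.2.1, hmono h.2.2⟩)

/-- The new maximum can only be the largest entry of a pattern. If the pattern descends from it, the
next entry is the lr-maximum at `p`, which exceeds all earlier old entries. If the pattern ascends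
to it, the entry at `p` can take its place. -/
theorem IsBaxter.insertMax_castSucc {σ : Perm (Fin n)} (h : IsBaxter σ) {p : Fin n}
    (hp : IsLRMax σ p) : IsBaxter (insertMax σ p.castSucc) := by
  rintro ⟨i, j, j', k, hij, hjk, hj', hpat⟩
  have hnot : ∀ x y, insertMax σ p.castSucc x < insertMax σ p.castSucc y →
      ∃ x', x = p.castSucc.succAbove x' := by
    intro x y hxy
    rcases Fin.eq_self_or_eq_succAbove p.castSucc x with rfl | hx
    · rw [insertMax_self] at hxy
      exact absurd (Fin.le_last _) hxy.not_ge
    · exact hx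
  have hmono : ∀ {x y}, insertMax σ p.castSucc (p.castSucc.succAbove x) <
      insertMax σ p.castSucc (p.castSucc.succAbove y) → σ x < σ y := fun hxy => by
    rwa [insertMax_succAbove, insertMax_succAbove] at hxy
  have hval := fun x => val_succAbove p.castSucc x
  simp only [Fin.val_castSucc] at hval
  rw [Fin.lt_def] at hij hjk
  rcases hpat with ⟨h1, h2, h3⟩ | ⟨h1, h2, h3⟩
  · obtain ⟨y', rfl⟩ := hnot _ _ h1
    obtain ⟨x, rfl⟩ := hnot _ _ h2
    obtain ⟨z, rfl⟩ := hnot _ _ h3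
    replace h1 := hmono h1
    replace h2 := hmono h2
    rw [hval] at hij hjk hj'
    rcases Fin.eq_self_or_eq_succAbove p.castSucc j with rfl | ⟨y, rfl⟩
    · simp only [Fin.val_castSucc] at hij hj'
      have hy : y' = p := Fin.ext (by split_ifs at hj' <;> omega)
      subst hy
      have := hp x (Fin.lt_def.2 (by split_ifs at hij <;> omega))
      exact lt_asymm h1 this
    · rw [hval] at hij hjk hj'
      refine h ⟨x, y, y', z, ?_, ?_, ?_, .inl ⟨h1, h2, hmono h3⟩⟩
      · rw [Fin.lt_def]; split_ifs at hij <;> omega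
      · rw [Fin.lt_def]; split_ifs at hjk <;> omega
      · split_ifs at hj' <;> omega
  · obtain ⟨y, rfl⟩ := hnot _ _ h1
    obtain ⟨z, rfl⟩ := hnot _ _ h2
    obtain ⟨x, rfl⟩ := hnot _ _ h3
    replace h1 := hmono h1
    replace h2 := hmono h2
    rw [hval] at hij hjk hj'
    rw [hval] at hij hjk
    rcases Fin.eq_self_or_eq_succAbove p.castSucc j' with rfl | ⟨y', rfl⟩
    · simp only [Fin.val_castSucc] at hj'
      have hxp : (x : ℕ) < p := by split_ifs at hij hj' <;> omega
      have h4 := hp x (Fin.lt_def.2 hxp)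
      refine h ⟨x, y, p, z, ?_, ?_, ?_, .inr ⟨h1, h2, h4⟩⟩
      · rw [Fin.lt_def]; split_ifs at hij <;> omega
      · rw [Fin.lt_def]; split_ifs at hjk <;> omega
      · split_ifs at hj' <;> omega
    · rw [hval] at hj'
      refine h ⟨x, y, y', z, ?_, ?_, ?_, .inr ⟨h1, h2, hmono h3⟩⟩
      · rw [Fin.lt_def]; split_ifs at hij <;> omega
      · rw [Fin.lt_def]; split_ifs at hjk <;> omega
      · split_ifs at hj' <;> omega

theorem IsBaxter.insertMax_succ {σ : Perm (Fin n)} (h : IsBaxter σ) {p : Fin n}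
    (hp : IsRLMax σ p) : IsBaxter (insertMax σ p.succ) := by
  have := (h.rev.insertMax_castSucc (isRLMax_iff_rev.1 hp)).rev
  rwa [rev_insertMax, rev_rev, Fin.rev_castSucc, Fin.rev_rev] at this

/-- Otherwise the right neighbour `q` of the maximum has a larger value before it, at `i`, and the
left neighbour `r` has a larger value after it, at `k`. With the maximum, either `r`, `q`, `k` or
`i`, `r`, `q` form a forbidden pattern, according to the order of the two neighbours. -/
theorem IsBaxter.position {σ : Perm (Fin (n + 1))} {p : Fin (n + 2)}
    (h : IsBaxter (insertMax σ p)) :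
    (∃ q, IsLRMax σ q ∧ p = q.castSucc) ∨ (∃ q, IsRLMax σ q ∧ p = q.succ) := by
  by_cases h0 : (p : ℕ) = 0
  · exact .inl ⟨0, fun j hj => absurd hj (Fin.not_lt_zero j), Fin.ext h0⟩
  by_cases hl : (p : ℕ) = n + 1
  · exact .inr ⟨Fin.last n, fun j hj => absurd (Fin.le_last j) hj.not_ge, Fin.ext hl⟩
  have hp := p.2
  obtain ⟨q, hq⟩ : ∃ q : Fin (n + 1), (q : ℕ) = p := ⟨⟨p, by omega⟩, rfl⟩
  obtain ⟨r, hr⟩ : ∃ r : Fin (n + 1), (r : ℕ) + 1 = p := ⟨⟨p - 1, by omega⟩, by simp; omega⟩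
  by_contra! hcon
  have h1 : ¬ IsLRMax σ q := fun h => hcon.1 q h (Fin.ext (by simp [hq]))
  have h2 : ¬ IsRLMax σ r := fun h => hcon.2 r h (Fin.ext (by simp [hr]))
  simp only [not_forall, not_lt] at h1 h2
  obtain ⟨i, hi, hi'⟩ := h1
  obtain ⟨k, hk, hk'⟩ := h2
  have hlast : ∀ x, (insertMax σ p (p.succAbove x)) < insertMax σ p p := fun x => by
    rw [insertMax_self, insertMax_succAbove]
    exact Fin.castSucc_lt_last _
  have hmono : ∀ {x y}, σ x < σ y →
      insertMax σ p (p.succAbove x) < insertMax σ p (p.succAbove y) := fun hxy => by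
    rw [insertMax_succAbove, insertMax_succAbove]
    exact hxy
  have hi2 : σ q < σ i := lt_of_le_of_ne hi' fun h => hi.ne' (σ.injective h)
  have hk2 : σ r < σ k := lt_of_le_of_ne hk' fun h => hk.ne (σ.injective h)
  have hqr : q ≠ r := fun h => by subst h; omega
  rw [Fin.lt_def] at hi hk
  rcases lt_or_gt_of_ne (fun h => hqr (σ.injective h)) with hlt | hlt
  · have hkq : (k : ℕ) ≠ q := fun h => lt_asymm hlt (by rwa [Fin.ext h] at hk2)
    refine h ⟨p.succAbove r, p, p.succAbove q, p.succAbove k, ?_, ?_, ?_,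
      .inl ⟨hmono hlt, hmono hk2, hlast _⟩⟩
    · rw [Fin.lt_def, val_succAbove]; split_ifs <;> omega
    · rw [Fin.lt_def, val_succAbove]; split_ifs <;> omega
    · rw [val_succAbove]; split_ifs <;> omega
  · have hir : (i : ℕ) ≠ r := fun h => lt_asymm hlt (by rwa [Fin.ext h] at hi2)
    refine h ⟨p.succAbove i, p.succAbove r, p, p.succAbove q, ?_, ?_, ?_,
      .inr ⟨hmono hlt, hmono hi2, hlast _⟩⟩
    · rw [Fin.lt_def, val_succAbove, val_succAbove]; split_ifs <;> omega
    · rw [Fin.lt_def, val_succAbove, val_succAbove]; split_ifs <;> omega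
    · rw [val_succAbove]; split_ifs <;> omega

theorem IsBaxter.exists_insertMax_eq {π : Perm (Fin (n + 2))} (h : IsBaxter π) :
    ∃ (σ : Perm (Fin (n + 1))) (p : Fin (n + 1)), IsBaxter σ ∧
      ((IsLRMax σ p ∧ π = insertMax σ p.castSucc) ∨ (IsRLMax σ p ∧ π = insertMax σ p.succ)) := by
  rw [← insertMax_removeMax π] at h
  rcases h.position with ⟨q, hq, hp⟩ | ⟨q, hq, hp⟩
  · exact ⟨removeMax π, q, h.of_insertMax, .inl ⟨hq, by rw [← hp, insertMax_removeMax]⟩⟩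
  · exact ⟨removeMax π, q, h.of_insertMax, .inr ⟨hq, by rw [← hp, insertMax_removeMax]⟩⟩

/-! ### Statistics -/

theorem card_filter_succAbove (P : Fin (n + 1) → Prop) [DecidablePred P] (p : Fin (n + 1)) :
    (Finset.univ.filter P).card =
      (if P p then 1 else 0) + (Finset.univ.filter fun i => P (p.succAbove i)).card := by
  rw [Finset.card_filter, Fin.sum_univ_succAbove _ p, Finset.card_filter]

theorem isLRMax_insertMax_self (σ : Perm (Fin n)) (p : Fin (n + 1)) : IsLRMax (insertMax σ p) p := by
  intro j hj
  obtain ⟨i, rfl⟩ := Fin.exists_succAbove_eq hj.ne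
  rw [insertMax_self, insertMax_succAbove]
  exact Fin.castSucc_lt_last _

theorem isLRMax_insertMax_succAbove {σ : Perm (Fin n)} {p : Fin (n + 1)} {i : Fin n} :
    IsLRMax (insertMax σ p) (p.succAbove i) ↔ IsLRMax σ i ∧ i.castSucc < p := by
  constructor
  · intro h
    refine ⟨fun j hj => ?_, ?_⟩
    · simpa [insertMax_succAbove] using h (p.succAbove j) (Fin.strictMono_succAbove p hj)
    · by_contra hp
      have := h p (Fin.lt_succAbove_iff_le_castSucc _ _ |>.2 (not_lt.1 hp))
      rw [insertMax_self] at this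
      exact absurd (Fin.le_last _) this.not_ge
  · rintro ⟨h, hp⟩ j hj
    obtain ⟨x, rfl⟩ := Fin.exists_succAbove_eq (x := j) (y := p)
      (hj.trans (Fin.succAbove_lt_iff_castSucc_lt _ _ |>.2 hp)).ne
    rw [insertMax_succAbove, insertMax_succAbove]
    exact h x ((Fin.strictMono_succAbove p).lt_iff_lt.1 hj)

theorem lrMaxima_insertMax (σ : Perm (Fin n)) (p : Fin (n + 1)) :
    lrMaxima (insertMax σ p) =
      (Finset.univ.filter fun i => IsLRMax σ i ∧ i.castSucc < p).card + 1 := by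
  rw [lrMaxima, card_filter_succAbove _ p, if_pos (isLRMax_insertMax_self σ p), add_comm]
  simp only [isLRMax_insertMax_succAbove]

theorem lrMaxima_insertMax_castSucc {σ : Perm (Fin n)} {p : Fin n} (hp : IsLRMax σ p) :
    lrMaxima (insertMax σ p.castSucc) =
      (Finset.univ.filter fun q => IsLRMax σ q ∧ q ≤ p).card := by
  have h1 : (Finset.univ.filter fun q => IsLRMax σ q ∧ q ≤ p) =
      insert p (Finset.univ.filter fun i => IsLRMax σ i ∧ i.castSucc < p.castSucc) := by
    ext q
    simp only [Finset.mem_filter, Finset.mem_univ, true_and, Finset.mem_insert,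
      Fin.castSucc_lt_castSucc_iff]
    constructor
    · rintro ⟨h, hq⟩
      exact hq.eq_or_lt.imp id fun hq => ⟨h, hq⟩
    · rintro (rfl | ⟨h, hq⟩)
      · exact ⟨hp, le_rfl⟩
      · exact ⟨h, hq.le⟩
  rw [lrMaxima_insertMax, h1, Finset.card_insert_of_notMem (by simp)]

/-- No lr-maximum lies to the right of an rl-maximum, so the new value hides none of them. -/
theorem lrMaxima_insertMax_succ {σ : Perm (Fin n)} {p : Fin n} (hp : IsRLMax σ p) :
    lrMaxima (insertMax σ p.succ) = lrMaxima σ + 1 := by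
  rw [lrMaxima_insertMax, lrMaxima]
  congr 2
  ext q
  simp only [Finset.mem_filter, Finset.mem_univ, true_and, and_iff_left_iff_imp,
    Fin.castSucc_lt_succ_iff]
  intro hq
  by_contra hlt
  exact lt_asymm (hp q (not_le.1 hlt)) (hq p (not_le.1 hlt))

theorem isRLMin_insertMax_succAbove {σ : Perm (Fin n)} {p : Fin (n + 1)} {i : Fin n} :
    IsRLMin (insertMax σ p) (p.succAbove i) ↔ IsRLMin σ i := by
  constructor
  · intro h j hj
    simpa [insertMax_succAbove] using h (p.succAbove j) (Fin.strictMono_succAbove p hj)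
  · intro h j hj
    rcases Fin.eq_self_or_eq_succAbove p j with rfl | ⟨x, rfl⟩
    · rw [insertMax_self, insertMax_succAbove]
      exact Fin.castSucc_lt_last _
    · rw [insertMax_succAbove, insertMax_succAbove]
      exact h x ((Fin.strictMono_succAbove p).lt_iff_lt.1 hj)

theorem isRLMin_insertMax_self {σ : Perm (Fin n)} {p : Fin (n + 1)} :
    IsRLMin (insertMax σ p) p ↔ p = Fin.last n := by
  constructor
  · intro h
    by_contra hp
    have := h (Fin.last n) (Fin.lt_last_iff_ne_last.2 hp)
    rw [insertMax_self] at this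
    exact absurd (Fin.le_last _) this.not_ge
  · rintro rfl j hj
    exact absurd (Fin.le_last _) hj.not_ge

theorem rlMinima_insertMax (σ : Perm (Fin n)) (p : Fin (n + 1)) :
    rlMinima (insertMax σ p) = rlMinima σ + if p = Fin.last n then 1 else 0 := by
  rw [rlMinima, card_filter_succAbove _ p, add_comm]
  simp only [isRLMin_insertMax_succAbove, isRLMin_insertMax_self]
  rfl

/-- The ascent that leads to an lr-maximum, if it is not the first entry, becomes an ascent followed
by a descent. -/
theorem ascents_insertMax_castSucc {σ : Perm (Fin (n + 1))} {p : Fin (n + 1)}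
    (hp : IsLRMax σ p) : ascents (insertMax σ p.castSucc) = ascents σ := by
  rw [ascents, card_filter_succAbove _ p, if_neg, zero_add, ascents]
  · congr 1
    ext i
    simp only [Finset.mem_filter, Finset.mem_univ, true_and]
    by_cases h1 : i.castSucc < p
    · rw [Fin.succAbove_of_castSucc_lt _ _ h1, insertMax_of_lt σ (Fin.castSucc_lt_castSucc_iff.2 h1)]
      by_cases h2 : i.succ = p
      · subst h2
        rw [Fin.succ_castSucc, insertMax_self]
        exact iff_of_true (Fin.castSucc_lt_last _) (hp _ Fin.castSucc_lt_succ)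
      · have h3 : i.succ < p := lt_of_le_of_ne (Fin.castSucc_lt_iff_succ_le.1 h1) h2
        rw [Fin.succ_castSucc, insertMax_of_lt σ (Fin.castSucc_lt_castSucc_iff.2 h3)]
        exact Iff.rfl
    · rw [not_lt] at h1
      rw [Fin.succAbove_of_le_castSucc _ _ h1, ← Fin.succ_castSucc,
        insertMax_of_le σ (Fin.castSucc_le_castSucc_iff.2 h1), insertMax_of_le σ]
      · exact Iff.rfl
      · exact Fin.castSucc_le_castSucc_iff.2 (h1.trans Fin.castSucc_lt_succ.le)
  · rw [insertMax_self]
    exact (Fin.le_last _).not_gt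

/-- An rl-maximum is followed by a descent or by nothing; the step up to the new value is the
additional ascent. -/
theorem ascents_insertMax_succ {σ : Perm (Fin (n + 1))} {p : Fin (n + 1)}
    (hp : IsRLMax σ p) : ascents (insertMax σ p.succ) = ascents σ + 1 := by
  rw [ascents, card_filter_succAbove _ p, if_pos, add_comm, ascents]
  · congr 2
    ext i
    simp only [Finset.mem_filter, Finset.mem_univ, true_and]
    by_cases h1 : i.castSucc < p
    · have h3 : i.succ ≤ p := Fin.castSucc_lt_iff_succ_le.1 h1
      rw [Fin.succAbove_of_castSucc_lt _ _ h1, insertMax_of_lt σ, Fin.succ_castSucc,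
        insertMax_of_lt σ]
      · exact Iff.rfl
      · exact Fin.castSucc_lt_succ_iff.2 h3
      · exact Fin.castSucc_lt_succ_iff.2 h1.le
    · rw [not_lt] at h1
      have h4 : p < i.succ := h1.trans_lt Fin.castSucc_lt_succ
      rw [Fin.succAbove_of_le_castSucc _ _ h1, insertMax_of_le σ (x := i.succ)]
      · by_cases h2 : p = i.castSucc
        · subst h2
          rw [← Fin.succ_castSucc, insertMax_self]
          exact iff_of_false (Fin.le_last _).not_gt (hp _ h4).not_gt
        · have h3 : p < i.castSucc := lt_of_le_of_ne h1 h2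
          rw [← Fin.succ_castSucc, insertMax_of_le σ]
          · exact Iff.rfl
          · exact Fin.succ_le_castSucc_iff.2 h3
      · exact Fin.succ_le_castSucc_iff.2 h4
  · rw [insertMax_self, insertMax_of_lt σ Fin.castSucc_lt_succ]
    exact Fin.castSucc_lt_last _

theorem card_filter_rev (P : Fin n → Prop) [DecidablePred P] :
    (Finset.univ.filter P).card = (Finset.univ.filter fun i : Fin n => P i.rev).card := by
  rw [Finset.card_filter, Finset.card_filter]
  exact (Equiv.sum_comp Fin.revPerm fun i => if P i then 1 else 0).symm

theorem lrMaxima_rev (π : Perm (Fin n)) : lrMaxima (rev π) = rlMaxima π := by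
  rw [lrMaxima, card_filter_rev, rlMaxima]
  simp only [← isRLMax_iff_rev]

theorem rlMinima_rev (π : Perm (Fin n)) : rlMinima (rev π) = lrMinima π := by
  rw [rlMinima, card_filter_rev, lrMinima]
  simp only [← isLRMin_iff_rev]

/-! ### Ranks of the maxima -/

theorem rank_injOn {P : Fin n → Prop} [DecidablePred P] {p p' : Fin n} (hp : P p) (hp' : P p')
    (h : (Finset.univ.filter fun q => P q ∧ q ≤ p).card =
      (Finset.univ.filter fun q => P q ∧ q ≤ p').card) : p = p' := by
  have key : ∀ p p', P p' → p < p' → (Finset.univ.filter fun q => P q ∧ q ≤ p).card <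
      (Finset.univ.filter fun q => P q ∧ q ≤ p').card := by
    intro p p' hp' hlt
    refine Finset.card_lt_card ⟨fun q hq => ?_, fun hsub => ?_⟩
    · simp only [Finset.mem_filter, Finset.mem_univ, true_and] at hq ⊢
      exact ⟨hq.1, hq.2.trans hlt.le⟩
    · have := hsub (show p' ∈ _ by simp [hp'])
      simp only [Finset.mem_filter, Finset.mem_univ, true_and] at this
      exact this.2.not_gt hlt
  rcases lt_trichotomy p p' with hlt | heq | hlt
  · exact absurd h (key _ _ hp' hlt).ne
  · exact heq
  · exact absurd h (key _ _ hp hlt).ne'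

theorem rank_pos {P : Fin n → Prop} [DecidablePred P] {p : Fin n} (hp : P p) :
    1 ≤ (Finset.univ.filter fun q => P q ∧ q ≤ p).card :=
  Finset.card_pos.2 ⟨p, by simp [hp]⟩

theorem rank_le (P : Fin n → Prop) [DecidablePred P] (p : Fin n) :
    (Finset.univ.filter fun q => P q ∧ q ≤ p).card ≤ (Finset.univ.filter P).card :=
  Finset.card_le_card fun q hq => by
    simp only [Finset.mem_filter, Finset.mem_univ, true_and] at hq ⊢
    exact hq.1

theorem exists_rank_eq {P : Fin n → Prop} [DecidablePred P] {k : ℕ} (hk : 1 ≤ k)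
    (hk' : k ≤ (Finset.univ.filter P).card) :
    ∃ p, P p ∧ (Finset.univ.filter fun q => P q ∧ q ≤ p).card = k := by
  obtain ⟨p, hp, h⟩ := Finset.surj_on_of_inj_on_of_card_le
    (s := Finset.univ.filter P) (t := Finset.Icc 1 (Finset.univ.filter P).card)
    (fun p _ => (Finset.univ.filter fun q => P q ∧ q ≤ p).card)
    (fun p hp => Finset.mem_Icc.2 ⟨rank_pos (Finset.mem_filter.1 hp).2, rank_le P p⟩)
    (fun p p' hp hp' h => rank_injOn (Finset.mem_filter.1 hp).2 (Finset.mem_filter.1 hp').2 h)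
    (by simp) k (Finset.mem_Icc.2 ⟨hk, hk'⟩)
  exact ⟨p, (Finset.mem_filter.1 hp).2, h.symm⟩

theorem rlRank_eq_rank_rev (σ : Perm (Fin n)) (p : Fin n) :
    (Finset.univ.filter fun q => IsRLMax σ q ∧ p ≤ q).card =
      (Finset.univ.filter fun q => IsLRMax (rev σ) q ∧ q ≤ p.rev).card := by
  rw [card_filter_rev]
  simp only [isRLMax_iff_rev, Fin.rev_rev, Fin.le_rev_iff]

/-- The last position always carries an rl-maximum. This matches the case `k = 1` of
`Good.rightOuterDegree_insertR` with the insertion at the end in `rlMinima_insertMax`. -/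
theorem rlRank_eq_one_iff {σ : Perm (Fin (n + 1))} {p : Fin (n + 1)} (hp : IsRLMax σ p) :
    (Finset.univ.filter fun q => IsRLMax σ q ∧ p ≤ q).card = 1 ↔ p.succ = Fin.last (n + 1) := by
  have hl : IsRLMax σ (Fin.last n) := fun j hj => absurd (Fin.le_last j) hj.not_ge
  rw [← Fin.succ_last, Fin.succ_inj]
  constructor
  · intro h
    exact Finset.card_le_one.1 h.le p (by simpa using hp) _ (by simpa [Fin.le_last] using hl)
  · rintro rfl
    rw [Finset.card_eq_one]
    refine ⟨Fin.last n, ?_⟩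
    ext q
    simp only [Finset.mem_filter, Finset.mem_univ, true_and, Finset.mem_singleton,
      Fin.last_le_iff]
    exact ⟨fun h => h.2, fun h => ⟨h ▸ hl, h⟩⟩

end BaxterPerm

namespace PlaneMap

variable {n : ℕ}

/-! ### Insertions and isomorphisms -/

theorem Commutes.sinkDegree {f : Perm (Fin n)} {O O' : PlaneMap n} (h : Commutes f O O')
    (hr : f O.root = O'.root) : O'.sinkDegree = O.sinkDegree := by
  rw [PlaneMap.sinkDegree, PlaneMap.sinkDegree, Function.minimalPeriod_eq_minimalPeriod_iff]
  intro j
  rw [Function.IsPeriodicPt, Function.IsFixedPt, Function.IsPeriodicPt, Function.IsFixedPt,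
    Perm.iterate_eq_pow, Perm.iterate_eq_pow, h.sinkDart hr, ← h.rot_pow,
    (dartMap f).apply_eq_iff_eq]

theorem exists_extend_perm (g : Perm (Fin n)) :
    ∃ f : Perm (Fin (n + 1)), f (newEdge n) = newEdge n ∧ ∀ e, f e.castSucc = (g e).castSucc :=
  ⟨g.viaFintypeEmbedding Fin.castSuccEmb,
    Perm.viaFintypeEmbedding_apply_notMem_range _ _ (by
      rintro ⟨e, he⟩
      exact Fin.castSucc_ne_last e he),
    fun e => Perm.viaFintypeEmbedding_apply_image g Fin.castSuccEmb e⟩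

theorem exists_restrict_perm {f : Perm (Fin (n + 1))} (hf : f (newEdge n) = newEdge n) :
    ∃ g : Perm (Fin n), ∀ e, f e.castSucc = (g e).castSucc := by
  have h1 : ∀ e : Fin n, f e.castSucc ≠ Fin.last n := fun e h =>
    Fin.castSucc_ne_last e (f.injective (h.trans hf.symm))
  have hinj : Function.Injective fun e : Fin n => (f e.castSucc).castPred (h1 e) := by
    intro e e' h
    exact Fin.castSucc_injective _ (f.injective (Fin.castPred_inj.1 h))
  exact ⟨Equiv.ofBijective _ (Finite.injective_iff_bijective.1 hinj),
    fun e => (Fin.castSucc_castPred _ (h1 e)).symm⟩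

theorem dartMap_oldDart {f : Perm (Fin (n + 1))} {g : Perm (Fin n)}
    (hfg : ∀ e, f e.castSucc = (g e).castSucc) (d : Dart n) :
    dartMap f (oldDart n d) = oldDart n (dartMap g d) := by
  rcases d with ⟨e, b⟩
  rw [oldDart_mk, dartMap_mk, dartMap_mk, oldDart_mk, hfg]

theorem commutes_iff_extRot {f : Perm (Fin (n + 1))} {g : Perm (Fin n)}
    (hf : f (newEdge n) = newEdge n) (hfg : ∀ e, f e.castSucc = (g e).castSucc)
    {O O' : PlaneMap n} :
    Commutes g O O' ↔ dartMap f * O.extRot = O'.extRot * dartMap f := by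
  constructor
  · intro h
    ext1 d
    rw [Perm.mul_apply, Perm.mul_apply]
    induction d using dart_cases with
    | tail => rw [extRot_new, dartMap_mk, hf, extRot_new]
    | head => rw [extRot_new, dartMap_mk, hf, extRot_new]
    | old d =>
      rw [extRot_oldDart, dartMap_oldDart hfg, dartMap_oldDart hfg, extRot_oldDart, h]
  · intro h d
    have h1 := congrArg (fun ρ : Perm (Dart (n + 1)) => ρ (oldDart n d)) h
    simp only [Perm.mul_apply] at h1
    rw [extRot_oldDart, dartMap_oldDart hfg, dartMap_oldDart hfg, extRot_oldDart] at h1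
    exact (oldDart n).injective h1

theorem commutes_iff_mul {f : Perm (Fin n)} {O O' : PlaneMap n} :
    Commutes f O O' ↔ dartMap f * O.rot = O'.rot * dartMap f :=
  ⟨fun h => Equiv.ext h, fun h d => congrArg (fun ρ : Perm (Dart n) => ρ d) h⟩

theorem mul_swap_comm {α : Type*} [DecidableEq α] {F ρ ρ' : Perm α} (h : F * ρ = ρ' * F)
    (a b x y : α) : F * (swap a b * ρ * swap x y) =
      swap (F a) (F b) * ρ' * swap (F x) (F y) * F := by
  rw [← mul_assoc, ← mul_assoc, mul_swap_eq_swap_mul F a b, mul_assoc (swap (F a) (F b)), h,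
    mul_assoc _ (swap (F x) (F y)) F, ← mul_swap_eq_swap_mul F x y]
  simp only [mul_assoc]

theorem Commutes.insertL {g : Perm (Fin n)} {O O' : PlaneMap n} (h : Commutes g O O')
    (hr : g O.root = O'.root) (k : ℕ) : (O.insertL k).Iso (O'.insertL k) := by
  obtain ⟨f, hf, hfg⟩ := exists_extend_perm g
  have h1 := (commutes_iff_extRot hf hfg).1 h
  refine Commutes.iso (f := f) (commutes_iff_mul.2 ?_) ?_
  · have h2 := mul_swap_comm h1 (oldDart n (O.leftWalk (k - 1))) (newTail n)
      (oldDart n O.sinkDart) (newHead n)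
    rw [dartMap_oldDart hfg, dartMap_oldDart hfg, dartMap_mk f _ true, dartMap_mk f _ false, hf, ← h.leftWalk hr,
      ← h.sinkDart hr] at h2
    exact h2
  · simp only [PlaneMap.insertL]
    split_ifs
    · exact hf
    · rw [hfg, hr]

theorem Commutes.insertR {g : Perm (Fin n)} {O O' : PlaneMap n} (h : Commutes g O O')
    (hr : g O.root = O'.root) (k : ℕ) : (O.insertR k).Iso (O'.insertR k) := by
  obtain ⟨f, hf, hfg⟩ := exists_extend_perm g
  have h1 := (commutes_iff_extRot hf hfg).1 h
  refine Commutes.iso (f := f) (commutes_iff_mul.2 ?_) ?_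
  · have h2 := mul_swap_comm h1 (oldDart n ((O.rot ^ k) O.sinkDart)) (newHead n)
      (oldDart n O.sinkDart) (newHead n)
    -- `insertR` has one transposition on the left and two on the right; a trivial transposition
    -- fills the missing place.
    have h3 := mul_swap_comm h2 (newTail n) (newTail n) (oldDart n O.sinkDart) (newTail n)
    rw [swap_self, swap_self, ← Perm.one_def, one_mul, one_mul,
      dartMap_oldDart hfg, dartMap_oldDart hfg, dartMap_mk f _ true, dartMap_mk f _ false, hf, h.rot_pow,
      ← h.sinkDart hr] at h3
    exact h3
  · simp only [PlaneMap.insertR]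
    rw [hfg, hr]

/-- The neighbours of the new darts in the rotation determine `a` and `b`, so these are preserved
too; skipping the new darts then gives the rotation of the smaller map. -/
theorem Commutes.of_lStep {f : Perm (Fin (n + 1))} {O P : PlaneMap n} {O' P' : PlaneMap (n + 1)}
    {a b a' b' : Dart n} (h : Commutes f O' P') (hf : f (newEdge n) = newEdge n)
    (s : LStep O O' a b) (t : LStep P P' a' b') {g : Perm (Fin n)}
    (hfg : ∀ e, f e.castSucc = (g e).castSucc) : Commutes g O P ∧ dartMap g a = a' := by
  have ha : dartMap g a = a' := (oldDart n).injective (by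
    rw [← dartMap_oldDart hfg, ← s.tail, h, dartMap_mk, hf, t.tail])
  have hb : dartMap g b = b' := (oldDart n).injective (by
    refine P'.rot.injective ?_
    rw [← dartMap_oldDart hfg, ← h, s.before_head, t.before_head, dartMap_mk, hf])
  refine ⟨fun d => (oldDart n).injective ?_, ha⟩
  have hinj := (dartMap g).injective
  by_cases h1 : d = b
  · rw [h1, hb, ← t.head, ← dartMap_oldDart hfg, ← s.head, h, dartMap_mk, hf]
  by_cases h2 : O.rot d = a
  · have h3 := h (oldDart n d)
    rw [s.before_tail d h2, dartMap_oldDart hfg, dartMap_mk, hf] at h3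
    rw [h2, ha]
    by_contra h4
    by_cases h5 : dartMap g d = b'
    · exact h1 (hinj (h5.trans hb.symm))
    · rw [t.old _ h5 (fun h6 => h4 (by rw [h6]))] at h3
      exact new_ne_oldDart _ _ h3
  · have h3 := h (oldDart n d)
    rw [s.old d h1 h2, dartMap_oldDart hfg, dartMap_oldDart hfg] at h3
    have h5 : dartMap g d ≠ b' := fun h5 => h1 (hinj (h5.trans hb.symm))
    by_cases h4 : P.rot (dartMap g d) = a'
    · rw [t.before_tail _ h4] at h3
      exact absurd h3 (oldDart_ne_new _ _)
    · rw [h3, t.old _ h5 h4]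

theorem Commutes.of_rStep {f : Perm (Fin (n + 1))} {O P : PlaneMap n} {O' P' : PlaneMap (n + 1)}
    {b c b' c' : Dart n} (h : Commutes f O' P') (hf : f (newEdge n) = newEdge n)
    (s : RStep O O' b c) (t : RStep P P' b' c') {g : Perm (Fin n)}
    (hfg : ∀ e, f e.castSucc = (g e).castSucc) : Commutes g O P := by
  have hc : dartMap g c = c' := (oldDart n).injective (by
    rw [← dartMap_oldDart hfg, ← s.tail, h, dartMap_mk, hf, t.tail])
  have hb : dartMap g b = b' := (oldDart n).injective (by
    refine P'.rot.injective ?_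
    rw [← dartMap_oldDart hfg, ← h, s.before_tail, t.before_tail, dartMap_mk, hf])
  have hinj := (dartMap g).injective
  have hhead := h (newHead n)
  rw [dartMap_mk f _ false, hf] at hhead
  intro d
  refine (oldDart n).injective ?_
  by_cases h1 : d = b
  · subst h1
    rw [hb]
    by_cases h2 : O.rot d = c
    · rw [s.head_of_eq h2, dartMap_mk, hf] at hhead
      rw [h2, hc]
      by_contra h3
      rw [t.head (fun h4 => h3 (by rw [h4]))] at hhead
      exact new_ne_oldDart _ _ hhead
    · rw [s.head h2, dartMap_oldDart hfg] at hhead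
      by_cases h3 : P.rot b' = c'
      · rw [t.head_of_eq h3] at hhead
        exact absurd hhead (oldDart_ne_new _ _)
      · rw [hhead, t.head h3]
  have h5 : dartMap g d ≠ b' := fun h5 => h1 (hinj (h5.trans hb.symm))
  have h3 := h (oldDart n d)
  by_cases h2 : O.rot d = c
  · rw [s.before_head d h1 h2, dartMap_oldDart hfg, dartMap_mk, hf] at h3
    rw [h2, hc]
    by_contra h4
    rw [t.old _ h5 (fun h6 => h4 (by rw [h6]))] at h3
    exact new_ne_oldDart _ _ h3
  · rw [s.old d h1 h2, dartMap_oldDart hfg, dartMap_oldDart hfg] at h3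
    by_cases h4 : P.rot (dartMap g d) = c'
    · rw [t.before_head _ h5 h4] at h3
      exact absurd h3 (oldDart_ne_new _ _)
    · rw [h3, t.old _ h5 h4]

theorem Commutes.newEdge_of_sinkDart {f : Perm (Fin (n + 1))} {O O' : PlaneMap (n + 1)}
    (h : Commutes f O O') (hr : f O.root = O'.root) (hs : O.sinkDart = newHead n)
    (hs' : O'.sinkDart = newHead n) : f (newEdge n) = newEdge n := by
  have := h.sinkDart hr
  rw [hs, hs', dartMap_mk] at this
  exact (congrArg Prod.fst this).symm

theorem Iso.of_insertL {O P : PlaneMap n} (hO : O.Good) (hP : P.Good) {k k' : ℕ} (hk : 1 ≤ k)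
    (hkO : k ≤ O.leftOuterDegree) (hk' : 1 ≤ k') (hkP : k' ≤ P.leftOuterDegree)
    (h : (O.insertL k).Iso (P.insertL k')) : O.Iso P ∧ k = k' := by
  obtain ⟨f, hf, hr⟩ := h.exists_commutes (hO.insertL hk hkO) (hP.insertL hk' hkP)
  have hnew := hf.newEdge_of_sinkDart hr (hO.sinkDart_insertL hk hkO) (hP.sinkDart_insertL hk' hkP)
  obtain ⟨g, hfg⟩ := exists_restrict_perm hnew
  have hkk : k = k' := by
    rw [← hO.leftOuterDegree_insertL hk hkO, ← hP.leftOuterDegree_insertL hk' hkP,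
      hf.leftOuterDegree hr]
  subst hkk
  obtain ⟨h1, h2⟩ := hf.of_lStep hnew (hO.lStep_insertL hk hkO) (hP.lStep_insertL hk' hkP) hfg
  refine ⟨h1.iso ?_, rfl⟩
  rw [O.insertL_root hk, P.insertL_root hk] at hr
  split_ifs at hr with h0
  · rw [h0, leftWalk_zero, leftWalk_zero] at h2
    exact congrArg Prod.fst h2
  · rw [hfg] at hr
    exact Fin.castSucc_injective _ hr

/-- The indices are not compared directly. The degree of the sink is enough, since it will be the
number of rl-maxima, which gives back the place of the insertion. -/
theorem Iso.of_insertR {O P : PlaneMap n} (hO : O.Good) (hP : P.Good) {k k' : ℕ}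
    (h : (O.insertR k).Iso (P.insertR k')) :
    O.Iso P ∧ (O.insertR k).sinkDegree = (P.insertR k').sinkDegree := by
  obtain ⟨f, hf, hr⟩ := h.exists_commutes (hO.insertR k) (hP.insertR k')
  have hnew := hf.newEdge_of_sinkDart hr (hO.sinkDart_insertR k) (hP.sinkDart_insertR k')
  obtain ⟨g, hfg⟩ := exists_restrict_perm hnew
  refine ⟨(hf.of_rStep hnew (hO.rStep_insertR k) (hP.rStep_insertR k') hfg).iso ?_,
    (hf.sinkDegree hr).symm⟩
  have hr' : f O.root.castSucc = P.root.castSucc := hr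
  rw [hfg] at hr'
  exact Fin.castSucc_injective _ hr'

/-- The dart that follows the origin of the last border edge is outgoing after `insertL` and ingoing
after `insertR`. -/
theorem not_iso_insertL_insertR {O P : PlaneMap n} (hO : O.Good) (hP : P.Good) {k k' : ℕ}
    (hk : 1 ≤ k) (hkO : k ≤ O.leftOuterDegree) : ¬ (O.insertL k).Iso (P.insertR k') := by
  intro h
  obtain ⟨f, hf, hr⟩ := h.exists_commutes (hO.insertL hk hkO) (hP.insertR k')
  have hnew := hf.newEdge_of_sinkDart hr (hO.sinkDart_insertL hk hkO) (hP.sinkDart_insertR k')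
  have s := hO.lStep_insertL hk hkO
  have t := hP.rStep_insertR k'
  have h1 := congrArg Prod.snd (hf (newTail n))
  rw [dartMap_mk f _ true, hnew, t.tail, dartMap_snd, s.tail, oldDart_snd, oldDart_snd, s.a_out,
    t.c_in] at h1
  simp at h1

end PlaneMap

open BaxterPerm

/-! ### The canonical map -/

theorem canonicalMap_insertMax_castSucc {n : ℕ} {σ : Perm (Fin (n + 1))} {p : Fin (n + 1)}
    (hp : IsLRMax σ p) : canonicalMap (n + 1) (insertMax σ p.castSucc) =
      (canonicalMap n σ).insertL (Finset.univ.filter fun q => IsLRMax σ q ∧ q ≤ p).card := by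
  rw [canonicalMap, maxPos_insertMax, removeMax_insertMax, if_pos ⟨p, hp, rfl⟩]
  simp only [Fin.castSucc_le_castSucc_iff]

theorem canonicalMap_insertMax_succ {n : ℕ} {σ : Perm (Fin (n + 1))} {p : Fin (n + 1)}
    (hp : IsRLMax σ p) : canonicalMap (n + 1) (insertMax σ p.succ) =
      (canonicalMap n σ).insertR (Finset.univ.filter fun q => IsRLMax σ q ∧ p ≤ q).card := by
  rw [canonicalMap, maxPos_insertMax, removeMax_insertMax, if_neg]
  · simp only [Fin.succ_le_succ_iff]
  -- `canonicalMap` tests the first kind of insertion first. An lr-maximum right after the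
  -- rl-maximum `p` would be both larger and smaller than it.
  · rintro ⟨q, hq, hqp⟩
    have hpq : p < q := by
      rw [Fin.lt_def]
      have := congrArg Fin.val hqp
      simp only [Fin.val_castSucc, Fin.val_succ] at this
      omega
    exact lt_asymm (hp q hpq) (hq p hpq)

/-- The properties of the image of a Baxter permutation. -/
structure CanonicalSpec {n : ℕ} (π : Perm (Fin (n + 1))) : Prop where
  good : (canonicalMap n π).Good
  nonPolar : (canonicalMap n π).nonPolar = ascents π
  left : (canonicalMap n π).leftOuterDegree = lrMaxima π
  right : (canonicalMap n π).rightOuterDegree = rlMinima π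
  dual : (canonicalMap n π).MirDual (canonicalMap n (rev π))

/-- The degree of the sink is not followed through the insertions: it is the left outer degree of
the image of `rev π`. -/
theorem CanonicalSpec.sinkDegree {n : ℕ} {π : Perm (Fin (n + 1))} (h : CanonicalSpec π)
    (h' : CanonicalSpec (rev π)) : (canonicalMap n π).sinkDegree = rlMaxima π := by
  rw [h.dual.symm.sinkDegree h'.good, h'.left, lrMaxima_rev]

theorem CanonicalSpec.sourceDegree {n : ℕ} {π : Perm (Fin (n + 1))} (h : CanonicalSpec π)
    (h' : CanonicalSpec (rev π)) : (canonicalMap n π).sourceDegree = lrMinima π := by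
  rw [← h.dual.rightOuterDegree h.good, h'.right, rlMinima_rev]

theorem rlRank_rev {n : ℕ} (σ : Perm (Fin n)) (p : Fin n) :
    (Finset.univ.filter fun q => IsRLMax (rev σ) q ∧ p.rev ≤ q).card =
      (Finset.univ.filter fun q => IsLRMax σ q ∧ q ≤ p).card := by
  rw [rlRank_eq_rank_rev, rev_rev, Fin.rev_rev]

theorem CanonicalSpec.insertMax_castSucc {n : ℕ} {σ : Perm (Fin (n + 1))} (h : CanonicalSpec σ)
    (h' : CanonicalSpec (rev σ)) {p : Fin (n + 1)} (hp : IsLRMax σ p) :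
    CanonicalSpec (insertMax σ p.castSucc) := by
  have hk := rank_pos hp
  have hk' := rank_le (IsLRMax σ) p
  change _ ≤ lrMaxima σ at hk'
  rw [← h.left] at hk'
  constructor
  · rw [canonicalMap_insertMax_castSucc hp]
    exact h.good.insertL hk hk'
  · rw [canonicalMap_insertMax_castSucc hp, h.good.nonPolar_insertL hk hk', h.nonPolar,
      ascents_insertMax_castSucc hp]
  · rw [canonicalMap_insertMax_castSucc hp, h.good.leftOuterDegree_insertL hk hk',
      lrMaxima_insertMax_castSucc hp]
  · rw [canonicalMap_insertMax_castSucc hp, h.good.rightOuterDegree_insertL hk hk', h.right,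
      rlMinima_insertMax, if_neg (Fin.castSucc_ne_last p), add_zero]
  · rw [rev_insertMax, Fin.rev_castSucc, canonicalMap_insertMax_castSucc hp,
      canonicalMap_insertMax_succ (isLRMax_iff_rev.1 hp), rlRank_rev]
    exact h.dual.insert h.good h'.good hk hk'

theorem CanonicalSpec.insertMax_succ {n : ℕ} {σ : Perm (Fin (n + 1))} (h : CanonicalSpec σ)
    (h' : CanonicalSpec (rev σ)) {p : Fin (n + 1)} (hp : IsRLMax σ p) :
    CanonicalSpec (insertMax σ p.succ) := by
  have hp' := isRLMax_iff_rev.1 hp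
  have hrank := rlRank_eq_rank_rev σ p
  have hk := rank_pos hp'
  have hk' := rank_le (IsLRMax (rev σ)) p.rev
  change _ ≤ lrMaxima (rev σ) at hk'
  rw [← h'.left] at hk'
  -- The same rank has two bounds: the left outer degree on the side of `rev σ`, and the degree of
  -- the sink on the side of `σ`.
  have hkO := hk'
  rw [h'.left, lrMaxima_rev, ← h.sinkDegree h', ← hrank] at hkO
  constructor
  · rw [canonicalMap_insertMax_succ hp]
    exact h.good.insertR _
  · rw [canonicalMap_insertMax_succ hp, h.good.nonPolar_insertR, h.nonPolar,
      ascents_insertMax_succ hp]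
  · rw [canonicalMap_insertMax_succ hp, h.good.leftOuterDegree_insertR, h.left,
      lrMaxima_insertMax_succ hp]
  · rw [canonicalMap_insertMax_succ hp,
      h.good.rightOuterDegree_insertR (by rw [hrank]; exact hk) hkO, h.right, rlMinima_insertMax]
    simp only [rlRank_eq_one_iff hp]
  · rw [rev_insertMax, Fin.rev_succ, canonicalMap_insertMax_castSucc hp',
      canonicalMap_insertMax_succ hp, hrank]
    exact (h.dual.symm.insert h'.good h.good hk hk').symm

/-- Each step uses the induction hypothesis for both `σ` and `rev σ`, which are Baxter together;
this is how the duality enters the count of the sites. -/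
theorem canonicalSpec {n : ℕ} {π : Perm (Fin (n + 1))} (hπ : IsBaxter π) : CanonicalSpec π := by
  induction n with
  | zero =>
    obtain rfl : π = 1 := Subsingleton.elim (α := Perm (Fin 1)) _ _
    exact ⟨PlaneMap.good_single, PlaneMap.nonPolar_single, PlaneMap.leftOuterDegree_single,
      PlaneMap.rightOuterDegree_single, PlaneMap.mirDual_single⟩
  | succ n ih =>
    obtain ⟨σ, p, hσ, ⟨hp, rfl⟩ | ⟨hp, rfl⟩⟩ := hπ.exists_insertMax_eq
    · exact (ih hσ).insertMax_castSucc (ih hσ.rev) hp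
    · exact (ih hσ).insertMax_succ (ih hσ.rev) hp

/-! ### Bijectivity up to isomorphism -/

theorem rlMaxima_insertMax_succ {n : ℕ} {σ : Perm (Fin n)} {p : Fin n} (hp : IsRLMax σ p) :
    rlMaxima (insertMax σ p.succ) =
      (Finset.univ.filter fun q => IsRLMax σ q ∧ p ≤ q).card := by
  rw [← lrMaxima_rev, rev_insertMax, Fin.rev_succ,
    lrMaxima_insertMax_castSucc (isRLMax_iff_rev.1 hp), rlRank_eq_rank_rev]

/-- The image determines the kind of the last insertion, then the image of the parent, then the
index: by the left outer degree for `insertL`, by the degree of the sink for `insertR`. -/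
theorem canonicalMap_injective {n : ℕ} {π π' : Perm (Fin (n + 1))} (hπ : IsBaxter π)
    (hπ' : IsBaxter π') (h : (canonicalMap n π).Iso (canonicalMap n π')) : π = π' := by
  induction n with
  | zero => exact Subsingleton.elim (α := Perm (Fin 1)) _ _
  | succ n ih =>
    have hspec := fun {π : Perm (Fin (n + 1))} (h : IsBaxter π) => canonicalSpec h
    have hrank : ∀ {σ : Perm (Fin (n + 1))} (p), IsBaxter σ →
        (Finset.univ.filter fun q => IsLRMax σ q ∧ q ≤ p).card ≤
          (canonicalMap n σ).leftOuterDegree := fun p hσ => by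
      rw [(hspec hσ).left]
      exact rank_le _ p
    have hdeg : (canonicalMap (n + 1) π).sinkDegree = rlMaxima π :=
      (canonicalSpec hπ).sinkDegree (canonicalSpec hπ.rev)
    have hdeg' : (canonicalMap (n + 1) π').sinkDegree = rlMaxima π' :=
      (canonicalSpec hπ').sinkDegree (canonicalSpec hπ'.rev)
    obtain ⟨σ, p, hσ, ⟨hp, rfl⟩ | ⟨hp, rfl⟩⟩ := hπ.exists_insertMax_eq <;>
      obtain ⟨σ', p', hσ', ⟨hp', rfl⟩ | ⟨hp', rfl⟩⟩ := hπ'.exists_insertMax_eq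
    · rw [canonicalMap_insertMax_castSucc hp, canonicalMap_insertMax_castSucc hp'] at h
      obtain ⟨h1, h2⟩ := h.of_insertL (hspec hσ).good (hspec hσ').good (rank_pos hp) (hrank p hσ)
        (rank_pos hp') (hrank p' hσ')
      obtain rfl := ih hσ hσ' h1
      rw [rank_injOn hp hp' h2]
    · rw [canonicalMap_insertMax_castSucc hp, canonicalMap_insertMax_succ hp'] at h
      exact absurd h (PlaneMap.not_iso_insertL_insertR (hspec hσ).good (hspec hσ').good
        (rank_pos hp) (hrank p hσ))
    · rw [canonicalMap_insertMax_succ hp, canonicalMap_insertMax_castSucc hp'] at h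
      exact absurd h.symm (PlaneMap.not_iso_insertL_insertR (hspec hσ').good (hspec hσ).good
        (rank_pos hp') (hrank p' hσ'))
    · rw [canonicalMap_insertMax_succ hp, canonicalMap_insertMax_succ hp'] at h
      obtain ⟨h1, h2⟩ := h.of_insertR (hspec hσ).good (hspec hσ').good
      obtain rfl := ih hσ hσ' h1
      rw [← canonicalMap_insertMax_succ hp, ← canonicalMap_insertMax_succ hp', hdeg, hdeg',
        rlMaxima_insertMax_succ hp, rlMaxima_insertMax_succ hp', rlRank_eq_rank_rev,
        rlRank_eq_rank_rev] at h2
      rw [Fin.rev_injective (rank_injOn (isRLMax_iff_rev.1 hp) (isRLMax_iff_rev.1 hp') h2)]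

theorem canonicalMap_surjective {n : ℕ} {O : PlaneMap (n + 1)} (hO : O.Good) :
    ∃ π, IsBaxter π ∧ (canonicalMap n π).Iso O := by
  induction n with
  | zero =>
    refine ⟨1, ?_, ?_⟩
    · rintro ⟨i, j, -, -, hij, -⟩
      exact absurd hij (by rw [Subsingleton.elim (α := Fin 1) i j]; exact lt_irrefl _)
    · have hsink := hO.sinkDart_snd
      obtain ⟨h, hh⟩ := hO.height
      refine PlaneMap.Commutes.iso (f := 1) (fun d => ?_) (Subsingleton.elim (α := Fin 1) _ _)
      change d = O.rot d
      -- The two darts of a single edge have different heights, so the rotation cannot exchange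
      -- them.
      have h1 : h (O.rot d) = h d := hh.rot d
      have h2 := hh.lt 0
      rcases d with ⟨e, b⟩
      obtain rfl : e = 0 := Subsingleton.elim (α := Fin 1) _ _
      generalize O.rot (0, b) = x at h1
      rcases x with ⟨e, b'⟩
      obtain rfl : e = 0 := Subsingleton.elim (α := Fin 1) _ _
      cases b <;> cases b' <;> first | rfl | (exfalso; omega)
  | succ n ih =>
    -- The last edge of the left border receives the largest label, as it has after an insertion.
    set f := swap O.sinkDart.1 (PlaneMap.newEdge (n + 1)) with hf
    have hc := PlaneMap.commutes_relabel f O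
    have hgood := hc.good rfl hO
    have hs : (O.relabel f).sinkDart = PlaneMap.newHead (n + 1) := by
      rw [hc.sinkDart rfl]
      refine Prod.ext ?_ hO.sinkDart_snd
      exact swap_apply_left _ _
    have hiso := (PlaneMap.iso_relabel f O).symm
    rcases hgood.exists_insert_eq hs (Nat.succ_pos n) with
      ⟨P, k, hP, hk, hk', hOP⟩ | ⟨P, k, hP, hk, hk', hOP⟩ <;> rw [hOP] at hiso <;>
      obtain ⟨σ, hσ, hσP⟩ := ih hP <;>
      have hspec := canonicalSpec hσ <;>
      obtain ⟨g, hg, hgr⟩ := hσP.exists_commutes hspec.good hP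
    · rw [hg.leftOuterDegree hgr, hspec.left] at hk'
      obtain ⟨p, hp, rfl⟩ := exists_rank_eq hk hk'
      refine ⟨_, hσ.insertMax_castSucc hp, ?_⟩
      rw [canonicalMap_insertMax_castSucc hp]
      exact (hg.insertL hgr _).trans hiso
    · rw [hg.sinkDegree hgr, hspec.sinkDegree (canonicalSpec hσ.rev), ← lrMaxima_rev] at hk'
      obtain ⟨p, hp, rfl⟩ := exists_rank_eq hk hk'
      have hp' : IsRLMax σ p.rev := by rw [isRLMax_iff_rev, Fin.rev_rev]; exact hp
      refine ⟨_, hσ.insertMax_succ hp', ?_⟩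
      rw [canonicalMap_insertMax_succ hp', rlRank_eq_rank_rev, Fin.rev_rev]
      exact (hg.insertR hgr _).trans hiso

theorem mainTheorem2 :
    -- `Λ` is given by the recursion: `1` is sent to the one-edge orientation,
    canonicalMap 0 1 = PlaneMap.single ∧
    -- `Λ (L_k σ) = L_k (Λ σ)`, where `L_k` inserts just before the `k`-th lr-maximum,
    (∀ (n : ℕ) (σ : Equiv.Perm (Fin (n + 1))) (p : Fin (n + 1)) (k : ℕ),
      BaxterPerm.IsBaxter σ → BaxterPerm.IsLRMax σ p →
      (Finset.univ.filter fun q => BaxterPerm.IsLRMax σ q ∧ q ≤ p).card = k →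
      BaxterPerm.IsBaxter (BaxterPerm.insertMax σ p.castSucc) ∧
      canonicalMap (n + 1) (BaxterPerm.insertMax σ p.castSucc) = (canonicalMap n σ).insertL k) ∧
    -- `Λ (R_k σ) = R_k (Λ σ)`, where `R_k` inserts just after the `k`-th rl-maximum,
    (∀ (n : ℕ) (σ : Equiv.Perm (Fin (n + 1))) (p : Fin (n + 1)) (k : ℕ),
      BaxterPerm.IsBaxter σ → BaxterPerm.IsRLMax σ p →
      (Finset.univ.filter fun q => BaxterPerm.IsRLMax σ q ∧ p ≤ q).card = k →
      BaxterPerm.IsBaxter (BaxterPerm.insertMax σ p.succ) ∧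
      canonicalMap (n + 1) (BaxterPerm.insertMax σ p.succ) = (canonicalMap n σ).insertR k) ∧
    -- and every Baxter permutation of size at least `2` is obtained in this way;
    (∀ (n : ℕ) (π : Equiv.Perm (Fin (n + 2))), BaxterPerm.IsBaxter π →
      ∃ (σ : Equiv.Perm (Fin (n + 1))) (p : Fin (n + 1)), BaxterPerm.IsBaxter σ ∧
        ((BaxterPerm.IsLRMax σ p ∧ π = BaxterPerm.insertMax σ p.castSucc) ∨
          (BaxterPerm.IsRLMax σ p ∧ π = BaxterPerm.insertMax σ p.succ))) ∧
    -- `Λ` is a bijection from Baxter permutations of size `n + 1` to plane bipolar orientations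
    -- with `n + 1` edges,
    -- (`planeBipolarSetoid` identifies isomorphic plane bipolar orientations),
    (∃ h : ∀ (n : ℕ) (π : {π : Equiv.Perm (Fin (n + 1)) // BaxterPerm.IsBaxter π}),
        (canonicalMap n π.1).IsPlaneBipolar,
      ∀ n : ℕ, Function.Bijective
        (fun π : {π : Equiv.Perm (Fin (n + 1)) // BaxterPerm.IsBaxter π} =>
          (Quotient.mk (planeBipolarSetoid (n + 1)) ⟨canonicalMap n π.1, h n π⟩ :
            PlaneBipolar (n + 1)))) ∧
    -- with the following correspondences of parameters and symmetry.
    (∀ (n : ℕ) (π : Equiv.Perm (Fin (n + 1))), BaxterPerm.IsBaxter π →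
      (canonicalMap n π).nonPolar = BaxterPerm.ascents π ∧
      (canonicalMap n π).leftOuterDegree = BaxterPerm.lrMaxima π ∧
      (canonicalMap n π).rightOuterDegree = BaxterPerm.rlMinima π ∧
      (∀ t, (canonicalMap n π).IsSink t →
        (canonicalMap n π).degree t = BaxterPerm.rlMaxima π) ∧
      (∀ s, (canonicalMap n π).IsSource s →
        (canonicalMap n π).degree s = BaxterPerm.lrMinima π) ∧
      BaxterPerm.IsBaxter (BaxterPerm.rev π) ∧
      (canonicalMap n (BaxterPerm.rev π)).Iso (canonicalMap n π).dual.mir) := by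
  refine ⟨rfl, ?_, ?_, ?_, ?_, ?_⟩
  · rintro n σ p k hσ hp rfl
    exact ⟨hσ.insertMax_castSucc hp, canonicalMap_insertMax_castSucc hp⟩
  · rintro n σ p k hσ hp rfl
    exact ⟨hσ.insertMax_succ hp, canonicalMap_insertMax_succ hp⟩
  · intro n π hπ
    exact hπ.exists_insertMax_eq
  · refine ⟨fun n π => (canonicalSpec π.2).good.isPlaneBipolar, fun n => ⟨?_, ?_⟩⟩
    · intro π π' h
      exact Subtype.ext (canonicalMap_injective π.2 π'.2 (Quotient.exact h))
    · intro O
      induction O using Quotient.inductionOn with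
      | h O =>
        obtain ⟨π, hπ, h⟩ := canonicalMap_surjective O.2.good
        exact ⟨⟨π, hπ⟩, Quotient.sound h⟩
  · intro n π hπ
    have h := canonicalSpec hπ
    have h' := canonicalSpec hπ.rev
    refine ⟨h.nonPolar, h.left, h.right, fun t ht => ?_, fun s hs => ?_, hπ.rev, ?_⟩
    · rw [h.good.degree_sink ht, h.sinkDegree h']
    · rw [h.good.degree_source hs, h.sourceDegree h']
    · rw [← h.dual.eq_mir_dual h.good]
      exact PlaneMap.Iso.refl _
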